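/- **Setting.** Let $\mathcal M$ be a von Neumann algebra on a Hilbert space $H$, and let $\{P_t\}_{t\ge 0}$ be a cp semigroup on $\mathcal M$: each $P_t:\mathcal M\to\mathcal M$ is a unital, normal, completely positive linear map, $P_{s+t}=P_sP_t$, and $P_0=\mathrm{id}$ (no continuity in $t$ is assumed). For a partition $\mathfrak p=\{0=t_0<t_1<\dots<t_n=t\}$ of $[0,t]$, let $H_{\mathfrak p,t}=\mathcal M\otimes_{P_{t_1}}\mathcal M\otimes_{P_{t_2-t_1}}\cdots\mathcal M\otimes_{P_{t-t_{n-1}}}H$ be the Hausdorff completion of the algebraic tensor product for the semi-inner product (linear in the second variable) $$\langle T_1\otimes\dots\otimes T_n\otimes h,\ S_1\otimes\dots\otimes S_n\otimes k\rangle=\langle h,\ P_{t-t_{n-1}}(T_n^*\cdots P_{t_2-t_1}(T_2^*P_{t_1}(T_1^*S_1)S_2)\cdots S_n)k\rangle .$$ Let $H_t=\varinjlim H_{\mathfrak p,t}$ under refinement, with respect to the isometries that insert factors $I$ at the new points ($H_0=H$). $\mathcal M$ acts on $H_t$ by $a\cdot(T_1\otimes\dots\otimes T_n\otimes h)=aT_1\otimes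 T_2\otimes\dots\otimes T_n\otimes h$ (by $a\cdot h=ah$ on $H_0=H$), and $\mathcal M'$ acts by $b(T_1\otimes\dots\otimes T_n\otimes h)=T_1\otimes\dots\otimes T_n\otimes bh$. Let $\iota_t:H\to H_t$ be the isometry $h\mapsto I\otimes\dots\otimes I\otimes h$. Let $E(t)=\mathcal L_{\mathcal M}(H,H_t)$ be the space of bounded operators $X:H\to H_t$ with $Xa=a\cdot X$ for all $a\in\mathcal M$, with $b\cdot X=bX$ and $X\cdot b=Xb$ for $b\in\mathcal M'$, and $\langle X,Y\rangle=X^*Y\in\mathcal M'$. Identify $\mathcal M'$ with $E(0)$ by $b\mapsto\iota_0 b$, and $X\otimes Y$ (for $X\in E(t)$, $Y\in E(s)$) with $(I_s\otimes X)Y\in E(t+s)$, where $I_s\otimes X:H_s\to H_{t+s}$ is the operator $S_1\otimes\dots\otimes S_m\otimes h\mapsto S_1\otimes\dots\otimes S_m\otimes Xh$ (a tensor over the partition $\mathfrak p_2$ of $[0,s]$ followed by one over the partition $\mathfrak p_1$ of $[0,t]$ is a tensor over the partition $\mathfrak p_2\cup(\mathfrak p_1+s)$ of $[0,t+s]$).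 Put $T_t(X)=\iota_t^*X\in B(H)$ for $X\in E(t)$. Let $E(t)\otimes H$ be the Hausdorff completion of the algebraic tensor product for $\langle X\otimes h,Y\otimes k\rangle=\langle h,X^*Yk\rangle$, let $\widetilde T_t:E(t)\otimes H\to H$ be the operator $X\otimes h\mapsto T_t(X)h$, and for $S\in\mathcal M$ let $I_{E(t)}\otimes S$ be the operator $X\otimes h\mapsto X\otimes Sh$. **Theorem.** 1. $\{E(t)\}_{t\ge0}$ is a discrete product system over $\mathcal M'$: each $E(t)$ is a $W^*$-correspondence over $\mathcal M'$ (a self-dual right Hilbert $\mathcal M'$-module with a normal unital left action of $\mathcal M'$ by adjointable operators), and the identifications above are isomorphisms of correspondences $\mathcal M'\simeq E(0)$ and $E(t)\otimes_{\mathcal M'}E(s)\simeq E(t+s)$ (self-dual tensor product) for all $s,t\ge0$. 2. $\{T_t\}_{t\ge0}$ is a completely contractive covariant representation of $\{E(t)\}_{t\ge0}$ on $H$: each $T_t$ is linear, completely contractive, and continuous from the $\sigma$-topology of $E(t)$ (given by the functionals $X\mapsto\sum_n w_n(\langle\eta_n,X\rangle)$ with $\eta_n\in E(t)$, $w_n\in(\mathcal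 M')_*$ and $\sum_n\|w_n\|\|\eta_n\|<\infty$) to the $\sigma$-weak topology of $B(H)$; $T_0$ is a normal $*$-representation of $E(0)=\mathcal M'$, namely the identity representation; $T_{t+s}(X\otimes Y)=T_t(X)T_s(Y)$; and $T_t(b\cdot X\cdot c)=T_0(b)T_t(X)T_0(c)$ for $b,c\in\mathcal M'$. 3. It is fully coisometric: $\widetilde T_t\widetilde T_t^*=I_H$ for all $t\ge0$. 4. $P_t(S)=\widetilde T_t(I_{E(t)}\otimes S)\widetilde T_t^*$ for all $t\ge0$ and $S\in\mathcal M$. -/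

import Mathlib

open scoped NNReal InnerProductSpace ComplexOrder

universe u v

noncomputable section

namespace QMarkov

/-! ### Operator-algebraic preliminaries -/

section Prelim

variable {H : Type u} [NormedAddCommGroup H] [InnerProductSpace ℂ H] [CompleteSpace H]

instance : SMulMemClass (VonNeumannAlgebra H) ℂ (H →L[ℂ] H) where
  smul_mem {s} c _ hx := s.toStarSubalgebra.smul_mem hx c

/-- The `σ`-weak (ultraweak) topology on `B(G)`: the initial topology for the functionals
`x ↦ ∑ₙ ⟨hₙ, x kₙ⟩` with `∑ ‖hₙ‖² < ∞` and `∑ ‖kₙ‖² < ∞`. -/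
abbrev sigmaWeak (G : Type v) [NormedAddCommGroup G] [InnerProductSpace ℂ G] :
    TopologicalSpace (G →L[ℂ] G) :=
  ⨅ p : {p : (ℕ → G) × (ℕ → G) //
      (Summable fun n => ‖p.1 n‖ ^ 2) ∧ Summable fun n => ‖p.2 n‖ ^ 2},
    TopologicalSpace.induced (fun x => ∑' n, ⟪p.1.1 n, x (p.1.2 n)⟫_ℂ) inferInstance

/-- The relative `σ`-weak topology of a von Neumann algebra. -/
abbrev sigmaWeakOn (N : VonNeumannAlgebra H) : TopologicalSpace N :=
  (sigmaWeak H).induced (fun a : N => (a : H →L[ℂ] H))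

/-- Normality (`σ`-weak continuity) of a map from a von Neumann algebra to `B(G)`. -/
def IsNormalInto (N : VonNeumannAlgebra H) {G : Type v} [NormedAddCommGroup G]
    [InnerProductSpace ℂ G] (φ : N → (G →L[ℂ] G)) : Prop :=
  @Continuous _ _ (sigmaWeakOn N) (sigmaWeak G) φ

/-- The elements of the predual `N_*`: the `σ`-weakly continuous functionals in `N*`. -/
def IsNormalFunctional (N : VonNeumannAlgebra H) (w : N →L[ℂ] ℂ) : Prop :=
  @Continuous _ _ (sigmaWeakOn N) inferInstance w

/-- Complete positivity of `φ : M → M`: for every `n` the amplification `[aᵢⱼ] ↦ [φ(aᵢⱼ)]` carries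
positive operators on `Hⁿ` with entries in `M` to positive operators on `Hⁿ`. (An operator on a
complex Hilbert space is positive iff its quadratic form takes values in `[0, ∞)`.) -/
def IsCompletelyPositive (M : VonNeumannAlgebra H) (φ : M → M) : Prop :=
  ∀ (n : ℕ) (a : Fin n → Fin n → M),
    (∀ h : Fin n → H, 0 ≤ ∑ i, ∑ j, ⟪h i, (a i j : H →L[ℂ] H) (h j)⟫_ℂ) →
    ∀ h : Fin n → H, 0 ≤ ∑ i, ∑ j, ⟪h i, (φ (a i j) : H →L[ℂ] H) (h j)⟫_ℂ

/-- The operator `Gⁿ → G'ⁿ` between `ℓ²`-direct sums with matrix `[aᵢⱼ]`. Its norm is the norm of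
`[aᵢⱼ]` in `Mₙ(B(G, G'))`. -/
def matrixOp {n : ℕ} {G : Type u} {G' : Type v} [NormedAddCommGroup G] [InnerProductSpace ℂ G]
    [NormedAddCommGroup G'] [InnerProductSpace ℂ G'] (a : Fin n → Fin n → (G →L[ℂ] G')) :
    PiLp 2 (fun _ : Fin n => G) →L[ℂ] PiLp 2 (fun _ : Fin n => G') :=
  (PiLp.continuousLinearEquiv 2 ℂ (fun _ : Fin n => G')).symm.toContinuousLinearMap ∘L
    ContinuousLinearMap.pi fun i => ∑ j, a i j ∘L PiLp.proj 2 (fun _ : Fin n => G) j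

/-- A cp semigroup on `M`: a semigroup `{P_t}_{t ≥ 0}` of unital, normal, completely positive linear
maps on `M` with `P_0 = id`. No continuity in `t` is assumed. -/
structure CPSemigroup (M : VonNeumannAlgebra H) where
  toFun : ℝ≥0 → M →ₗ[ℂ] M
  map_one : ∀ t, toFun t 1 = 1
  completelyPositive : ∀ t, IsCompletelyPositive M (toFun t)
  normal : ∀ t, IsNormalInto M fun a => (toFun t a : H →L[ℂ] H)
  zero : toFun 0 = LinearMap.id
  add : ∀ s t, toFun (s + t) = toFun s ∘ₗ toFun t

end Prelim

/-! ### Correspondences, product systems and covariant representations -/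

section Correspondences

variable {H : Type u} [NormedAddCommGroup H] [InnerProductSpace ℂ H] [CompleteSpace H]

/-- The operations of a correspondence over `N`: left action `left a ξ = a·ξ`, right action
`right ξ a = ξ·a`, and `N`-valued inner product `ip ξ η = ⟨ξ, η⟩`, linear in `η`. The laws are in
`IsWStarCorrespondence`. -/
structure CorrespondenceData (N : VonNeumannAlgebra H) (E : Type v) where
  left : N → E → E
  right : E → N → E
  ip : E → E → N

namespace CorrespondenceData

variable {N : VonNeumannAlgebra H} {E : Type v} (C : CorrespondenceData N E)

/-- The Hilbert module norm `‖ξ‖ = ‖⟨ξ, ξ⟩‖^{1/2}`. -/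
def norm (ξ : E) : ℝ := √‖C.ip ξ ξ‖

/-- The `σ`-topology of a Hilbert module over a von Neumann algebra: the initial topology for the
functionals `ξ ↦ ∑ₙ wₙ(⟨ηₙ, ξ⟩)` with `ηₙ ∈ E`, `wₙ ∈ N_*` and `∑ ‖wₙ‖ ‖ηₙ‖ < ∞`. -/
abbrev sigmaTopology : TopologicalSpace E :=
  ⨅ p : {p : (ℕ → E) × (ℕ → (N →L[ℂ] ℂ)) //
      (∀ n, IsNormalFunctional N (p.2 n)) ∧ Summable fun n => ‖p.2 n‖ * C.norm (p.1 n)},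
    TopologicalSpace.induced (fun ξ => ∑' n, p.1.2 n (C.ip (p.1.1 n) ξ)) inferInstance

end CorrespondenceData

/-- `E` is a `W*`-correspondence over `N`: a self-dual (complete) right Hilbert `C*`-module over `N`
with a normal unital `*`-homomorphism of `N` into the adjointable operators on `E`. -/
structure IsWStarCorrespondence {N : VonNeumannAlgebra H} {E : Type v} [AddCommGroup E]
    [Module ℂ E] (C : CorrespondenceData N E) : Prop where
  /- `E` is a right `N`-module -/
  right_one : ∀ ξ, C.right ξ 1 = ξ
  right_mul : ∀ ξ a b, C.right ξ (a * b) = C.right (C.right ξ a) b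
  right_add : ∀ ξ a b, C.right ξ (a + b) = C.right ξ a + C.right ξ b
  add_right : ∀ ξ η a, C.right (ξ + η) a = C.right ξ a + C.right η a
  right_smul : ∀ (c : ℂ) ξ a, C.right ξ (c • a) = c • C.right ξ a
  smul_right : ∀ (c : ℂ) ξ a, C.right (c • ξ) a = c • C.right ξ a
  /- with an `N`-valued inner product -/
  ip_add : ∀ ξ η ζ, C.ip ξ (η + ζ) = C.ip ξ η + C.ip ξ ζ
  ip_smul : ∀ (c : ℂ) ξ η, C.ip ξ (c • η) = c • C.ip ξ η
  ip_right : ∀ ξ η a, C.ip ξ (C.right η a) = C.ip ξ η * a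
  star_ip : ∀ ξ η, star (C.ip ξ η) = C.ip η ξ
  ip_nonneg : ∀ ξ, (C.ip ξ ξ : H →L[ℂ] H).IsPositive
  ip_definite : ∀ ξ, C.ip ξ ξ = 0 → ξ = 0
  /- in whose norm it is complete -/
  complete : ∀ x : ℕ → E,
    (∀ ε > 0, ∃ n₀, ∀ m ≥ n₀, ∀ n ≥ n₀, C.norm (x m - x n) < ε) →
    ∃ ξ, ∀ ε > 0, ∃ n₀, ∀ n ≥ n₀, C.norm (x n - ξ) < ε
  /- `a ↦ (ξ ↦ a·ξ)` is a unital `*`-homomorphism into the adjointable module maps -/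
  left_one : ∀ ξ, C.left 1 ξ = ξ
  left_mul : ∀ a b ξ, C.left (a * b) ξ = C.left a (C.left b ξ)
  left_add : ∀ a b ξ, C.left (a + b) ξ = C.left a ξ + C.left b ξ
  add_left : ∀ a ξ η, C.left a (ξ + η) = C.left a ξ + C.left a η
  left_smul : ∀ (c : ℂ) a ξ, C.left (c • a) ξ = c • C.left a ξ
  smul_left : ∀ (c : ℂ) a ξ, C.left a (c • ξ) = c • C.left a ξ
  left_right : ∀ a ξ b, C.left a (C.right ξ b) = C.right (C.left a ξ) b
  ip_left : ∀ a ξ η, C.ip (C.left a ξ) η = C.ip ξ (C.left (star a) η)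
  /- which is normal -/
  left_normal : ∀ ξ η, IsNormalInto N fun a => (C.ip ξ (C.left a η) : H →L[ℂ] H)
  /- every bounded module map `E → N` is implemented by an element of `E` -/
  self_dual : ∀ Φ : E →ₗ[ℂ] N, (∀ ξ a, Φ (C.right ξ a) = Φ ξ * a) →
    (∃ c : ℝ, ∀ ξ, ‖Φ ξ‖ ≤ c * C.norm ξ) → ∃ η, ∀ ξ, Φ ξ = C.ip η ξ

/-- The data of a discrete product system over `N`: a family `{E(t)}_{t ≥ 0}`, the identification
`unit : N → E(0)`, and the identification `E(t) ⊗ E(s) → E(t + s)`, given by the images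
`mul t s ξ η` of the tensors `ξ ⊗ η`. -/
structure ProductSystemData (N : VonNeumannAlgebra H) where
  E : ℝ≥0 → Type v
  [addCommGroup : ∀ t, AddCommGroup (E t)]
  [module : ∀ t, Module ℂ (E t)]
  corr : ∀ t, CorrespondenceData N (E t)
  unit : N → E 0
  mul : ∀ t s, E t → E s → E (t + s)

attribute [instance] ProductSystemData.addCommGroup ProductSystemData.module

/-- Discrete product systems over `N`: each `E(t)` is a `W*`-correspondence over `N`, `E(0) ≃ N`
through `unit` and `E(t) ⊗_N E(s) ≃ E(t + s)` through `mul`, as correspondences. For the latter: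
`mul` is bilinear, balanced and bimodular, it carries the inner product
`⟨ξ ⊗ η, ξ' ⊗ η'⟩ = ⟨η, ⟨ξ, ξ'⟩·η'⟩` of the tensor product to that of `E(t + s)`, and the products
generate the self-dual module `E(t + s)`, i.e. only `0` is orthogonal to all of them. -/
structure IsDiscreteProductSystem {N : VonNeumannAlgebra H} (D : ProductSystemData.{u, v} N) :
    Prop where
  correspondence : ∀ t, IsWStarCorrespondence (D.corr t)
  unit_bijective : Function.Bijective D.unit
  unit_add : ∀ a b, D.unit (a + b) = D.unit a + D.unit b
  unit_smul : ∀ (c : ℂ) a, D.unit (c • a) = c • D.unit a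
  unit_left : ∀ a b, D.unit (a * b) = (D.corr 0).left a (D.unit b)
  unit_right : ∀ a b, D.unit (a * b) = (D.corr 0).right (D.unit a) b
  unit_ip : ∀ a b, (D.corr 0).ip (D.unit a) (D.unit b) = star a * b
  add_mul : ∀ t s ξ ξ' η, D.mul t s (ξ + ξ') η = D.mul t s ξ η + D.mul t s ξ' η
  mul_add : ∀ t s ξ η η', D.mul t s ξ (η + η') = D.mul t s ξ η + D.mul t s ξ η'
  smul_mul : ∀ t s (c : ℂ) ξ η, D.mul t s (c • ξ) η = c • D.mul t s ξ η
  mul_smul : ∀ t s (c : ℂ) ξ η, D.mul t s ξ (c • η) = c • D.mul t s ξ η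
  mul_balanced : ∀ t s ξ a η,
    D.mul t s ((D.corr t).right ξ a) η = D.mul t s ξ ((D.corr s).left a η)
  mul_left : ∀ t s a ξ η,
    D.mul t s ((D.corr t).left a ξ) η = (D.corr (t + s)).left a (D.mul t s ξ η)
  mul_right : ∀ t s ξ η a,
    D.mul t s ξ ((D.corr s).right η a) = (D.corr (t + s)).right (D.mul t s ξ η) a
  mul_ip : ∀ t s ξ η ξ' η',
    (D.corr (t + s)).ip (D.mul t s ξ η) (D.mul t s ξ' η') =
      (D.corr s).ip η ((D.corr s).left ((D.corr t).ip ξ ξ') η')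
  mul_generates : ∀ t s ζ, (∀ ξ η, (D.corr (t + s)).ip (D.mul t s ξ η) ζ = 0) → ζ = 0

/-- Complete contractivity of `T : E → B(G)`: `‖[T(ξᵢⱼ)]‖ ≤ ‖[ξᵢⱼ]‖` for all matrices over `E`, where
`‖[ξᵢⱼ]‖² = ‖[∑ₖ ⟨ξₖᵢ, ξₖⱼ⟩]‖` is the norm of the Hilbert `Mₙ(N)`-module `Mₙ(E)`. -/
def IsCompletelyContractive {N : VonNeumannAlgebra H} {E : Type v} (C : CorrespondenceData N E)
    {G : Type u} [NormedAddCommGroup G] [InnerProductSpace ℂ G] (T : E → (G →L[ℂ] G)) : Prop :=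
  ∀ (n : ℕ) (ξ : Fin n → Fin n → E),
    ‖matrixOp fun i j => T (ξ i j)‖ ^ 2 ≤
      ‖matrixOp fun i j => ((∑ k, C.ip (ξ k i) (ξ k j) : N) : H →L[ℂ] H)‖

/-- Completely contractive covariant representations `{T_t}_{t ≥ 0}` of a product system on `G`.
Besides the defining properties, the conclusions that each `(T_t, T_0)` is covariant and that `T_0`
is normal are listed as well. -/
structure IsCovariantRepresentation {N : VonNeumannAlgebra H} (D : ProductSystemData.{u, v} N)
    {G : Type u} [NormedAddCommGroup G] [InnerProductSpace ℂ G] [CompleteSpace G]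
    (T : ∀ t, D.E t →ₗ[ℂ] (G →L[ℂ] G)) : Prop where
  completelyContractive : ∀ t, IsCompletelyContractive (D.corr t) (T t)
  continuous : ∀ t, @Continuous _ _ (D.corr t).sigmaTopology (sigmaWeak G) (T t)
  /- `T_0` is a `*`-representation of `E(0) = N` -/
  zero_one : T 0 (D.unit 1) = 1
  zero_mul : ∀ a b, T 0 (D.unit (a * b)) = T 0 (D.unit a) * T 0 (D.unit b)
  zero_star : ∀ a, T 0 (D.unit (star a)) = star (T 0 (D.unit a))
  zero_normal : IsNormalInto N fun a => T 0 (D.unit a)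
  /- `T_{t+s} = T_t ⊗ T_s` under `E(t + s) = E(t) ⊗ E(s)` -/
  map_mul : ∀ t s ξ η, T (t + s) (D.mul t s ξ η) = T t ξ * T s η
  /- each `(T_t, T_0)` is covariant -/
  map_left : ∀ t a ξ, T t ((D.corr t).left a ξ) = T 0 (D.unit a) * T t ξ
  map_right : ∀ t ξ a, T t ((D.corr t).right ξ a) = T t ξ * T 0 (D.unit a)

end Correspondences

/-! ### Hausdorff completions of `X ⊗ H` for operator-valued positive kernels -/

section Kernel

variable {H : Type u} [NormedAddCommGroup H] [InnerProductSpace ℂ H] {X : Type u}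

/-- A positive `B(H)`-valued kernel on `X`. -/
structure PosKernel (X : Type u) (H : Type u) [NormedAddCommGroup H] [InnerProductSpace ℂ H] where
  ker : X → X → (H →L[ℂ] H)
  nonneg : ∀ (s : Finset X) (v : X → H), 0 ≤ ∑ x ∈ s, ∑ y ∈ s, ⟪v x, ker x y (v y)⟫_ℂ

namespace PosKernel

/-- The formal finite sums `∑ x ⊗ hₓ`, with the semi-inner product determined by
`⟨x ⊗ h, y ⊗ k⟩ = ⟨h, K(x, y) k⟩`. -/
def Pre (_K : PosKernel X H) : Type u := X →₀ H

variable (K : PosKernel X H)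

instance : AddCommGroup K.Pre := inferInstanceAs (AddCommGroup (X →₀ H))

instance : Module ℂ K.Pre := inferInstanceAs (Module ℂ (X →₀ H))

/-- The semi-inner product on formal sums. -/
def form (v w : X →₀ H) : ℂ := v.sum fun x h => w.sum fun y k => ⟪h, K.ker x y k⟫_ℂ

theorem form_add_left (v v' w : X →₀ H) : K.form (v + v') w = K.form v w + K.form v' w := by
  classical
  unfold form
  rw [Finsupp.sum_add_index']
  · intro x
    simp
  · intro x h h'
    simp [← Finsupp.sum_add]

theorem form_add_right (v w w' : X →₀ H) : K.form v (w + w') = K.form v w + K.form v w' := by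
  classical
  unfold form
  rw [← Finsupp.sum_add]
  refine Finsupp.sum_congr fun x _ => ?_
  rw [Finsupp.sum_add_index']
  · intro x
    simp
  · intro x h h'
    simp

theorem form_smul_left (c : ℂ) (v w : X →₀ H) :
    K.form (c • v) w = (starRingEnd ℂ) c * K.form v w := by
  classical
  unfold form
  rw [Finsupp.sum_smul_index' (by simp)]
  simp only [Finsupp.sum, Finset.mul_sum]
  refine Finset.sum_congr rfl fun x _ => Finset.sum_congr rfl fun y _ => ?_
  exact inner_smul_left _ _ _

theorem form_smul_right (c : ℂ) (v w : X →₀ H) :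
    K.form v (c • w) = c * K.form v w := by
  classical
  unfold form
  have : ∀ x, ∀ h : H, ((c • w).sum fun y k => ⟪h, K.ker x y k⟫_ℂ) =
      c * w.sum fun y k => ⟪h, K.ker x y k⟫_ℂ := by
    intro x h
    rw [Finsupp.sum_smul_index' (by simp)]
    simp [Finsupp.sum, Finset.mul_sum]
  simp only [this]
  simp [Finsupp.sum, Finset.mul_sum]

theorem form_self_nonneg (v : X →₀ H) : 0 ≤ K.form v v := K.nonneg v.support v

theorem form_conj (v w : X →₀ H) : (starRingEnd ℂ) (K.form w v) = K.form v w := by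
  have h1 := (Complex.nonneg_iff.1 (K.form_self_nonneg (v + w))).2
  have h2 := (Complex.nonneg_iff.1 (K.form_self_nonneg (v + Complex.I • w))).2
  have hv := (Complex.nonneg_iff.1 (K.form_self_nonneg v)).2
  have hw := (Complex.nonneg_iff.1 (K.form_self_nonneg w)).2
  simp only [form_add_left, form_add_right, form_smul_left, form_smul_right, Complex.add_im,
    Complex.add_re, Complex.mul_im, Complex.mul_re, Complex.conj_I, Complex.I_re, Complex.I_im,
    Complex.neg_re, Complex.neg_im] at h1 h2
  apply Complex.ext
  · simp only [Complex.conj_re]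
    linarith
  · simp only [Complex.conj_im]
    linarith

/-- The semi-inner product structure on formal sums. -/
abbrev core : PreInnerProductSpace.Core ℂ K.Pre where
  inner v w := K.form v w
  conj_inner_symm v w := K.form_conj v w
  re_inner_nonneg v := (Complex.nonneg_iff.1 (K.form_self_nonneg v)).1
  add_left := K.form_add_left
  smul_left v w c := K.form_smul_left c v w

instance : SeminormedAddCommGroup K.Pre :=
  InnerProductSpace.Core.toSeminormedAddCommGroup (c := K.core)

instance : InnerProductSpace ℂ K.Pre := InnerProductSpace.ofCore K.core

/-- The Hilbert space `X ⊗_K H`: the Hausdorff completion of the formal sums `∑ x ⊗ hₓ` for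
`⟨x ⊗ h, y ⊗ k⟩ = ⟨h, K(x, y) k⟩`. All linear relations among the `x ⊗ h` that this form respects
hold in it automatically; so if `X` is the set of decomposable tensors of an algebraic tensor product
and `K` is multilinear, then this is the Hausdorff completion of that tensor product. -/
abbrev Space : Type u := UniformSpace.Completion K.Pre

/-- `x ⊗ h` as a vector in `X ⊗_K H`. -/
def tensₗ (x : X) : H →ₗ[ℂ] K.Space :=
  (UniformSpace.Completion.toComplL (𝕜 := ℂ) (E := K.Pre)).toLinearMap ∘ₗ
    (Finsupp.lsingle x : H →ₗ[ℂ] (X →₀ H))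

theorem inner_tensₗ (x y : X) (h k : H) :
    ⟪K.tensₗ x h, K.tensₗ y k⟫_ℂ = ⟪h, K.ker x y k⟫_ℂ := by
  refine (UniformSpace.Completion.inner_coe (𝕜 := ℂ) (E := K.Pre)
    (Finsupp.single x h : X →₀ H) (Finsupp.single y k : X →₀ H)).trans ?_
  change K.form _ _ = _
  simp [form]

/-- The operator `h ↦ x ⊗ h`. -/
def tens (x : X) : H →L[ℂ] K.Space :=
  (K.tensₗ x).mkContinuous (√‖K.ker x x‖) fun h => by
    refine le_of_sq_le_sq ?_ (by positivity)
    rw [mul_pow, Real.sq_sqrt (norm_nonneg _), ← inner_self_eq_norm_sq (𝕜 := ℂ), inner_tensₗ]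
    calc _ ≤ ‖⟪h, K.ker x x h⟫_ℂ‖ := RCLike.re_le_norm _
      _ ≤ ‖h‖ * ‖K.ker x x h‖ := norm_inner_le_norm _ _
      _ ≤ ‖h‖ * (‖K.ker x x‖ * ‖h‖) := by gcongr; exact (K.ker x x).le_opNorm h
      _ = _ := by ring

theorem inner_tens (x y : X) (h k : H) :
    ⟪K.tens x h, K.tens y k⟫_ℂ = ⟪h, K.ker x y k⟫_ℂ := K.inner_tensₗ x y h k

theorem sum_tens (v : X →₀ H) :
    ((show K.Pre from v) : K.Space) = ∑ x ∈ v.support, K.tens x (v x) := by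
  conv_lhs => rw [← Finsupp.sum_single v]
  exact map_sum (UniformSpace.Completion.toComplL (𝕜 := ℂ) (E := K.Pre)) _ _

theorem induction_tens {p : K.Space → Prop} (hc : IsClosed {u | p u})
    (h : ∀ (s : Finset X) (v : X → H), p (∑ x ∈ s, K.tens x (v x))) (u : K.Space) : p u := by
  refine UniformSpace.Completion.induction_on u hc fun v => ?_
  have := h (show X →₀ H from v).support (show X →₀ H from v)
  rwa [← sum_tens] at this

theorem ext_tens {F : Type v} [NormedAddCommGroup F] [NormedSpace ℂ F] {A B : K.Space →L[ℂ] F}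
    (h : ∀ x k, A (K.tens x k) = B (K.tens x k)) : A = B := by
  ext u
  refine K.induction_tens (isClosed_eq A.continuous B.continuous) (fun s v => ?_) u
  simp [map_sum, h]

theorem norm_sum_tens (s : Finset X) (v : X → H) :
    ‖∑ x ∈ s, K.tens x (v x)‖ ^ 2 = (∑ x ∈ s, ∑ y ∈ s, ⟪v x, K.ker x y (v y)⟫_ℂ).re := by
  rw [← inner_self_eq_norm_sq (𝕜 := ℂ), sum_inner]
  simp [inner_sum, inner_tens]

variable {F : Type v} [NormedAddCommGroup F] [InnerProductSpace ℂ F] [CompleteSpace F]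

/-- The bounded operator on `X ⊗_K H` determined by `x ⊗ h ↦ L x h`. -/
def lift (L : X → (H →L[ℂ] F)) (c : ℝ)
    (hL : ∀ (s : Finset X) (v : X → H),
      ‖∑ x ∈ s, L x (v x)‖ ≤ c * ‖∑ x ∈ s, K.tens x (v x)‖) : K.Space →L[ℂ] F :=
  (LinearMap.mkContinuous (E := K.Pre)
    (Finsupp.lsum ℂ (fun x => (L x).toLinearMap) : (X →₀ H) →ₗ[ℂ] F) c
    fun v => by
      have := hL (show X →₀ H from v).support (show X →₀ H from v)
      rw [← sum_tens, UniformSpace.Completion.norm_coe] at this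
      exact this).extend (UniformSpace.Completion.toComplL (𝕜 := ℂ) (E := K.Pre))

theorem lift_tens (L : X → (H →L[ℂ] F)) (c : ℝ)
    (hL : ∀ (s : Finset X) (v : X → H),
      ‖∑ x ∈ s, L x (v x)‖ ≤ c * ‖∑ x ∈ s, K.tens x (v x)‖) (x : X) (h : H) :
    K.lift L c hL (K.tens x h) = L x h := by
  unfold lift
  refine (ContinuousLinearMap.extend_eq _ ?_ ?_ _).trans ?_
  · exact UniformSpace.Completion.denseRange_coe
  · exact UniformSpace.Completion.isUniformInducing_coe _
  · change (Finsupp.lsum ℂ (fun x => (L x).toLinearMap) : (X →₀ H) →ₗ[ℂ] F)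
      (Finsupp.single x h) = L x h
    simp

theorem norm_lift_le (L : X → (H →L[ℂ] F)) (c : ℝ)
    (hL : ∀ (s : Finset X) (v : X → H),
      ‖∑ x ∈ s, L x (v x)‖ ≤ c * ‖∑ x ∈ s, K.tens x (v x)‖) (u : K.Space) :
    ‖K.lift L c hL u‖ ≤ c * ‖u‖ := by
  refine K.induction_tens (p := fun u => ‖K.lift L c hL u‖ ≤ c * ‖u‖)
    (isClosed_le (by fun_prop) (by fun_prop)) (fun s v => ?_) u
  simpa [map_sum, lift_tens] using hL s v

end PosKernel

end Kernel

/-! ### The Hilbert spaces `H_t` -/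

section Construction

variable {H : Type u} [NormedAddCommGroup H] [InnerProductSpace ℂ H] [CompleteSpace H]

theorem exists_defect {G : Type v} [NormedAddCommGroup G] [InnerProductSpace ℂ G] [CompleteSpace G]
    (x : H →L[ℂ] G) : ∃ c : H →L[ℂ] H,
      star c * c = ((‖x‖ ^ 2 : ℝ) : ℂ) • (1 : H →L[ℂ] H) - x.adjoint ∘L x ∧
      ∀ m, Commute (x.adjoint ∘L x) m → Commute c m := by
  set d : H →L[ℂ] H := ((‖x‖ ^ 2 : ℝ) : ℂ) • (1 : H →L[ℂ] H) - x.adjoint ∘L x with hd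
  have hpos : 0 ≤ d := by
    rw [ContinuousLinearMap.nonneg_iff_isPositive, ContinuousLinearMap.isPositive_iff_complex]
    intro h
    have e : ⟪d h, h⟫_ℂ = ((‖x‖ ^ 2 * ‖h‖ ^ 2 - ‖x h‖ ^ 2 : ℝ) : ℂ) := by
      have h1 : ⟪h, h⟫_ℂ = ((‖h‖ ^ 2 : ℝ) : ℂ) := by
        rw [inner_self_eq_norm_sq_to_K]; simp
      have h2 : ⟪x h, x h⟫_ℂ = ((‖x h‖ ^ 2 : ℝ) : ℂ) := by
        rw [inner_self_eq_norm_sq_to_K]; simp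
      simp only [hd, sub_apply, smul_apply,
        one_apply_eq_self, ContinuousLinearMap.comp_apply, inner_sub_left,
        inner_smul_left, ContinuousLinearMap.adjoint_inner_left, h1, h2]
      simp
    rw [e]
    rw [RCLike.re_eq_complex_re, Complex.ofReal_re]
    refine ⟨rfl, ?_⟩
    have := x.le_opNorm h
    have h3 : ‖x h‖ ^ 2 ≤ (‖x‖ * ‖h‖) ^ 2 := by gcongr
    nlinarith
  refine ⟨CFC.sqrt d, ?_, fun m hm => ?_⟩
  · rw [(CFC.sqrt_nonneg d).isSelfAdjoint.star_eq, CFC.sqrt_mul_sqrt_self d hpos]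
  · have hc : Commute d m := by
      rw [hd]
      exact Commute.sub_left ((Commute.one_left m).smul_left _) hm
    exact hc.cfcₙ_nnreal _

variable {M : VonNeumannAlgebra H}

/-- Partitions `0 = t_0 < t_1 < ⋯ < t_n = t` of `[0, t]`, as finite sets of points. -/
structure Partition (t : ℝ≥0) where
  nodes : Finset ℝ≥0
  zero_mem : 0 ∈ nodes
  right_mem : t ∈ nodes
  le_right : ∀ r ∈ nodes, r ≤ t

namespace Partition

/-- The coarsest partition `{0, t}`. -/
def trivial (t : ℝ≥0) : Partition t where
  nodes := {0, t}
  zero_mem := by simp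
  right_mem := by simp
  le_right := by simp

/-- The common refinement of two partitions. -/
def sup {t : ℝ≥0} (p q : Partition t) : Partition t where
  nodes := p.nodes ∪ q.nodes
  zero_mem := Finset.mem_union_left _ p.zero_mem
  right_mem := Finset.mem_union_left _ p.right_mem
  le_right r hr := (Finset.mem_union.1 hr).elim (p.le_right r) (q.le_right r)

/-- The partition `p₂ ∨ (p₁ + s)` of `[0, t + s]`, for partitions `p₁` of `[0, t]` and `p₂` of
`[0, s]`. -/
def concat {t s : ℝ≥0} (p₂ : Partition s) (p₁ : Partition t) : Partition (t + s) where
  nodes := p₂.nodes ∪ p₁.nodes.image (· + s)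
  zero_mem := Finset.mem_union_left _ p₂.zero_mem
  right_mem := Finset.mem_union_right _ (Finset.mem_image_of_mem _ p₁.right_mem)
  le_right r hr := by
    rcases Finset.mem_union.1 hr with h | h
    · exact (p₂.le_right r h).trans le_add_self
    · obtain ⟨x, hx, rfl⟩ := Finset.mem_image.1 h
      exact add_le_add_left (p₁.le_right x hx) s

end Partition

/-- A decomposable tensor `T_1 ⊗ ⋯ ⊗ T_n` over a partition `0 = t_0 < ⋯ < t_n = t`, written as the
function with value `T_{k+1}` at `t_k` for `k < n` and value `I` elsewhere. In this form, refining the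
partition (which inserts factors `I` at the new points) does not change the function. -/
structure Tensor (M : VonNeumannAlgebra H) (t : ℝ≥0) where
  part : Partition t
  val : ℝ≥0 → M
  val_eq_one : ∀ r, r ∉ part.nodes.erase t → val r = 1

@[ext]
theorem Tensor.ext {t : ℝ≥0} {x y : Tensor M t} (h₁ : x.part.nodes = y.part.nodes)
    (h₂ : x.val = y.val) : x = y := by
  obtain ⟨⟨p, _, _, _⟩, f, _⟩ := x
  obtain ⟨⟨q, _, _, _⟩, g, _⟩ := y
  cases h₁
  cases h₂
  rfl

namespace CPSemigroup

variable (P : CPSemigroup M)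

theorem apply_add (s t : ℝ≥0) (a : M) : P.toFun (s + t) a = P.toFun s (P.toFun t a) := by
  rw [P.add]; rfl

/-- For a list `t_{k+1} < ⋯ < t_n` following `t_k`, the map sending `A` to
`P_{t_n - t_{n-1}}(⋯ P_{t_{k+1} - t_k}(f(t_k)^* A g(t_k)) ⋯ g(t_{n-1}))`, i.e. the iteration of
`A ↦ P_{t_{j+1} - t_j}(f(t_j)^* A g(t_j))`. -/
def chain (f g : ℝ≥0 → M) : ℝ≥0 → List ℝ≥0 → (M →ₗ[ℂ] M)
  | _, [] => LinearMap.id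
  | a, b :: l => chain f g b l ∘ₗ P.toFun (b - a) ∘ₗ
      LinearMap.mulLeft ℂ (star (f a)) ∘ₗ LinearMap.mulRight ℂ (g a)

theorem chain_cons (f g : ℝ≥0 → M) (a b : ℝ≥0) (l : List ℝ≥0) (A : M) :
    P.chain f g a (b :: l) A = P.chain f g b l (P.toFun (b - a) (star (f a) * (A * g a))) := rfl

/-- For a partition `0 = t_0 < ⋯ < t_n = t` and `f = T_1 ⊗ ⋯ ⊗ T_n`, `g = S_1 ⊗ ⋯ ⊗ S_n`,
`corr p f g A = P_{t_n - t_{n-1}}(T_n^* ⋯ P_{t_2 - t_1}(T_2^* P_{t_1}(T_1^* A S_1) S_2) ⋯ S_n)`. -/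
def corr (p : Finset ℝ≥0) (f g : ℝ≥0 → M) : M →ₗ[ℂ] M :=
  P.chain f g 0 ((p.erase 0).sort (· ≤ ·))

/-! Positivity -/

theorem map_pos {X : Type u} (s : Finset X) (t : ℝ≥0) (A : X → X → M)
    (hA : ∀ v : X → H, 0 ≤ ∑ x ∈ s, ∑ y ∈ s, ⟪v x, (A x y : H →L[ℂ] H) (v y)⟫_ℂ) (v : X → H) :
    0 ≤ ∑ x ∈ s, ∑ y ∈ s, ⟪v x, (P.toFun t (A x y) : H →L[ℂ] H) (v y)⟫_ℂ := by
  classical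
  have key : ∀ F : X → X → ℂ, ∑ x ∈ s, ∑ y ∈ s, F x y =
      ∑ i : Fin s.card, ∑ j : Fin s.card, F (s.equivFin.symm i) (s.equivFin.symm j) := by
    intro F
    have h1 : ∀ G : X → ℂ, ∑ x ∈ s, G x = ∑ i : Fin s.card, G (s.equivFin.symm i) := by
      intro G
      rw [← Finset.sum_coe_sort s G]
      exact (Equiv.sum_comp s.equivFin.symm (fun x : s => G x)).symm
    rw [h1]
    exact Finset.sum_congr rfl fun i _ => h1 _
  rw [key]
  refine P.completelyPositive t s.card
    (fun i j => A (s.equivFin.symm i) (s.equivFin.symm j)) (fun h => ?_)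
    (fun i => v (s.equivFin.symm i))
  have := hA (fun x => if hx : x ∈ s then h (s.equivFin ⟨x, hx⟩) else 0)
  rw [key] at this
  simpa using this

theorem chain_pos {X : Type u} (s : Finset X) (f : X → ℝ≥0 → M) (l : List ℝ≥0) :
    ∀ (a : ℝ≥0) (A : X → X → M),
    (∀ v : X → H, 0 ≤ ∑ x ∈ s, ∑ y ∈ s, ⟪v x, (A x y : H →L[ℂ] H) (v y)⟫_ℂ) → ∀ v : X → H,
    0 ≤ ∑ x ∈ s, ∑ y ∈ s, ⟪v x, (P.chain (f x) (f y) a l (A x y) : H →L[ℂ] H) (v y)⟫_ℂ := by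
  induction l with
  | nil => exact fun a A hA v => hA v
  | cons b l ih =>
    intro a A hA v
    refine ih b (fun x y => P.toFun (b - a) (star (f x a) * (A x y * f y a))) ?_ v
    refine P.map_pos s (b - a) (fun x y => star (f x a) * (A x y * f y a)) fun w => ?_
    refine (hA fun x => (f x a : H →L[ℂ] H) (w x)).trans_eq
      (Finset.sum_congr rfl fun x _ => Finset.sum_congr rfl fun y _ => ?_)
    change _ = ⟪w x, (star (f x a : H →L[ℂ] H)) ((A x y : H →L[ℂ] H)
      ((f y a : H →L[ℂ] H) (w y)))⟫_ℂ
    rw [ContinuousLinearMap.star_eq_adjoint, ContinuousLinearMap.adjoint_inner_right]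

/-! Invariance under refinement -/

theorem chain_orderedInsert (f g : ℝ≥0 → M) (τ : ℝ≥0) (hf : f τ = 1) (hg : g τ = 1)
    (l : List ℝ≥0) : ∀ (a : ℝ≥0) (_ : (a :: l).Pairwise (· ≤ ·)) (_ : a ≤ τ)
    (_ : ∃ b ∈ l, τ ≤ b) (A : M),
    P.chain f g a (l.orderedInsert (· ≤ ·) τ) A = P.chain f g a l A := by
  induction l with
  | nil => rintro a - - ⟨b, hb, -⟩; simp at hb
  | cons b l ih =>
    rintro a hl haτ ⟨c, hc, hτc⟩ A
    by_cases hτb : τ ≤ b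
    · rw [List.orderedInsert_cons_of_le _ _ hτb, chain_cons, chain_cons, chain_cons, hf, hg]
      simp only [star_one, one_mul, mul_one]
      rw [← P.apply_add, tsub_add_tsub_cancel hτb haτ]
    · rw [List.orderedInsert_of_not_le _ _ hτb, chain_cons, chain_cons]
      refine ih b hl.of_cons (not_le.1 hτb).le ⟨c, ?_, hτc⟩ _
      rcases List.mem_cons.1 hc with rfl | h
      · exact absurd hτc hτb
      · exact h

theorem corr_insert (p : Finset ℝ≥0) (t τ : ℝ≥0) (h0 : 0 ∈ p) (ht : t ∈ p) (hτt : τ ≤ t)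
    (f g : ℝ≥0 → M) (hf : f τ = 1) (hg : g τ = 1) :
    P.corr (insert τ p) f g = P.corr p f g := by
  classical
  by_cases hτ : τ ∈ p
  · rw [Finset.insert_eq_of_mem hτ]
  have hτ0 : τ ≠ 0 := fun h => hτ (h ▸ h0)
  have hlist : ((insert τ p).erase 0).sort (· ≤ ·) =
      ((p.erase 0).sort (· ≤ ·)).orderedInsert (· ≤ ·) τ := by
    refine List.Perm.eq_of_pairwise' (r := (· ≤ ·)) (Finset.pairwise_sort _ _)
      ((Finset.pairwise_sort _ _).orderedInsert τ _) ?_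
    refine List.Perm.trans ?_ (List.perm_orderedInsert _ τ _).symm
    rw [List.perm_ext_iff_of_nodup (Finset.sort_nodup _ _)]
    · intro r
      simp only [Finset.mem_sort, Finset.mem_erase, Finset.mem_insert, List.mem_cons]
      constructor
      · rintro ⟨h1, h2 | h2⟩ <;> tauto
      · rintro (rfl | h) <;> tauto
    · refine List.nodup_cons.2 ⟨?_, Finset.sort_nodup _ _⟩
      simp [hτ]
  ext A : 1
  unfold corr
  rw [hlist]
  refine P.chain_orderedInsert f g τ hf hg _ 0 ?_ zero_le ⟨t, ?_, hτt⟩ A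
  · refine List.pairwise_cons.2 ⟨fun _ _ => zero_le, Finset.pairwise_sort _ _⟩
  · rw [Finset.mem_sort, Finset.mem_erase]
    refine ⟨fun h => hτ0 ?_, ht⟩
    subst h
    exact le_antisymm hτt zero_le

theorem corr_mono {t : ℝ≥0} (p q : Finset ℝ≥0) (h0 : 0 ∈ p) (ht : t ∈ p) (hpq : p ⊆ q)
    (hq : ∀ r ∈ q, r ≤ t) (f g : ℝ≥0 → M) (hf : ∀ r ∉ p, f r = 1) (hg : ∀ r ∉ p, g r = 1) :
    P.corr q f g = P.corr p f g := by
  classical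
  suffices h : ∀ d : Finset ℝ≥0, (∀ r ∈ d, r ≤ t ∧ r ∉ p) → P.corr (p ∪ d) f g = P.corr p f g by
    have := h (q \ p) (fun r hr => ⟨hq r (Finset.mem_sdiff.1 hr).1, (Finset.mem_sdiff.1 hr).2⟩)
    rwa [Finset.union_sdiff_of_subset hpq] at this
  intro d
  induction d using Finset.induction_on with
  | empty => simp
  | insert τ d hτ ih =>
    intro hd
    rw [Finset.union_insert, P.corr_insert (p ∪ d) t τ (Finset.mem_union_left _ h0)
      (Finset.mem_union_left _ ht) (hd τ (Finset.mem_insert_self _ _)).1 f g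
      (hf τ (hd τ (Finset.mem_insert_self _ _)).2) (hg τ (hd τ (Finset.mem_insert_self _ _)).2)]
    exact ih fun r hr => hd r (Finset.mem_insert_of_mem hr)

/-- `⟨x ⊗ h, y ⊗ k⟩ = ⟨h, K(x, y) k⟩` with `K(x, y) = gram x y 1`, computed in the common refinement
of the partitions of `x` and `y`. More generally, `⟨x ⊗ h, a·(y ⊗ k)⟩ = ⟨h, gram x y a k⟩`. -/
def gram {t : ℝ≥0} (x y : Tensor M t) : M →ₗ[ℂ] M := P.corr (x.part.sup y.part).nodes x.val y.val

theorem gram_eq {t : ℝ≥0} (x y : Tensor M t) (q : Finset ℝ≥0) (hx : x.part.nodes ⊆ q)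
    (hy : y.part.nodes ⊆ q) (hq : ∀ r ∈ q, r ≤ t) : P.gram x y = P.corr q x.val y.val := by
  refine (P.corr_mono _ q (x.part.sup y.part).zero_mem (x.part.sup y.part).right_mem
    (Finset.union_subset hx hy) hq _ _ (fun r hr => x.val_eq_one r fun h => hr ?_)
    (fun r hr => y.val_eq_one r fun h => hr ?_)).symm
  · exact Finset.mem_union_left _ (Finset.mem_of_mem_erase h)
  · exact Finset.mem_union_right _ (Finset.mem_of_mem_erase h)

theorem gram_pos {t : ℝ≥0} (s : Finset (Tensor M t)) (A : Tensor M t → Tensor M t → M)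
    (hA : ∀ v : Tensor M t → H, 0 ≤ ∑ x ∈ s, ∑ y ∈ s, ⟪v x, (A x y : H →L[ℂ] H) (v y)⟫_ℂ)
    (v : Tensor M t → H) :
    0 ≤ ∑ x ∈ s, ∑ y ∈ s, ⟪v x, (P.gram x y (A x y) : H →L[ℂ] H) (v y)⟫_ℂ := by
  classical
  set q : Finset ℝ≥0 := s.biUnion fun x => x.part.nodes with hq
  have hsub : ∀ x ∈ s, x.part.nodes ⊆ q := fun x hx =>
    Finset.subset_biUnion_of_mem (fun x : Tensor M t => x.part.nodes) hx
  have hle : ∀ r ∈ q, r ≤ t := by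
    intro r hr
    obtain ⟨x, -, h⟩ := Finset.mem_biUnion.1 hr
    exact x.part.le_right r h
  have := P.chain_pos s (fun x => x.val) ((q.erase 0).sort (· ≤ ·)) 0 A hA v
  convert this using 6 with x hx y hy
  rw [P.gram_eq x y q (hsub x hx) (hsub y hy) hle]
  rfl

theorem const_pos {X : Type u} (s : Finset X) (c : M) (v : X → H) :
    0 ≤ ∑ x ∈ s, ∑ y ∈ s, ⟪v x, ((star c * c : M) : H →L[ℂ] H) (v y)⟫_ℂ := by
  have : ∑ x ∈ s, ∑ y ∈ s, ⟪v x, ((star c * c : M) : H →L[ℂ] H) (v y)⟫_ℂ =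
      ⟪∑ x ∈ s, (c : H →L[ℂ] H) (v x), ∑ x ∈ s, (c : H →L[ℂ] H) (v x)⟫_ℂ := by
    rw [sum_inner]
    simp [inner_sum, ContinuousLinearMap.star_eq_adjoint, ContinuousLinearMap.adjoint_inner_right]
  rw [this, inner_self_eq_norm_sq_to_K]
  positivity

/-- The kernel of the semi-inner product on decomposable tensors over partitions of `[0, t]`. -/
def kernel (t : ℝ≥0) : PosKernel (Tensor M t) H where
  ker x y := (P.gram x y 1 : M)
  nonneg s v := P.gram_pos s (fun _ _ => 1) (fun w => by simpa using const_pos s (1 : M) w) v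

/-- The Hilbert space `H_t = lim H_{p,t}`, where `H_{p,t}` is the Hausdorff completion of the span of
the `T_1 ⊗ ⋯ ⊗ T_n ⊗ h` over the partition `p` of `[0, t]`, and the limit is taken over all `p` with
respect to the isometries inserting factors `I`. -/
abbrev Ht (t : ℝ≥0) : Type u := (P.kernel t).Space

/-- The vector `T_1 ⊗ ⋯ ⊗ T_n ⊗ h` of `H_t`, as a function of `h`. -/
abbrev tens {t : ℝ≥0} (x : Tensor M t) : H →L[ℂ] P.Ht t := (P.kernel t).tens x

/-- A decomposable tensor and its refinements define the same vectors of `H_t`. -/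
theorem tens_refine {t : ℝ≥0} (x y : Tensor M t) (hp : x.part.nodes ⊆ y.part.nodes)
    (hv : x.val = y.val) : P.tens x = P.tens y := by
  have h : ∀ z, P.gram z x = P.gram z y := by
    intro z
    rw [P.gram_eq z y _ Finset.subset_union_left Finset.subset_union_right
      (z.part.sup y.part).le_right, P.gram_eq z x _ Finset.subset_union_left
      (hp.trans Finset.subset_union_right) (z.part.sup y.part).le_right, hv]
  ext k
  refine ext_inner_left ℂ fun u => ?_
  refine (P.kernel t).induction_tens
    (p := fun u => ⟪u, P.tens x k⟫_ℂ = ⟪u, P.tens y k⟫_ℂ)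
    (isClosed_eq (by fun_prop) (by fun_prop)) (fun s v => ?_) u
  have h' : ∀ z, (P.kernel t).ker z x = (P.kernel t).ker z y := fun z => by simp [kernel, h]
  simp only [sum_inner, PosKernel.inner_tens, h']


/-! Actions of `M` and `M'` on `H_t` -/

theorem inner_tens {t : ℝ≥0} (x y : Tensor M t) (h k : H) :
    ⟪P.tens x h, P.tens y k⟫_ℂ = ⟪h, (P.gram x y 1 : H →L[ℂ] H) k⟫_ℂ :=
  (P.kernel t).inner_tens x y h k

theorem lift_bound {t : ℝ≥0} {F : Type v} [NormedAddCommGroup F] [InnerProductSpace ℂ F]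
    (L : Tensor M t → (H →L[ℂ] F)) (c : ℝ) (hc : 0 ≤ c) (D : Tensor M t → Tensor M t → (H →L[ℂ] H))
    (hL : ∀ x y h k, ⟪L x h, L y k⟫_ℂ + ⟪h, D x y k⟫_ℂ =
      ((c ^ 2 : ℝ) : ℂ) * ⟪h, (P.gram x y 1 : H →L[ℂ] H) k⟫_ℂ)
    (hD : ∀ (s : Finset (Tensor M t)) (v : Tensor M t → H),
      0 ≤ ∑ x ∈ s, ∑ y ∈ s, ⟪v x, D x y (v y)⟫_ℂ)
    (s : Finset (Tensor M t)) (v : Tensor M t → H) :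
    ‖∑ x ∈ s, L x (v x)‖ ≤ c * ‖∑ x ∈ s, P.tens x (v x)‖ := by
  refine le_of_sq_le_sq ?_ (by positivity)
  rw [mul_pow, PosKernel.norm_sum_tens, ← inner_self_eq_norm_sq (𝕜 := ℂ), sum_inner]
  have h1 := (Complex.nonneg_iff.1 (hD s v)).1
  have h2 : ∑ x ∈ s, ∑ y ∈ s, ⟪L x (v x), L y (v y)⟫_ℂ +
      ∑ x ∈ s, ∑ y ∈ s, ⟪v x, D x y (v y)⟫_ℂ = ((c ^ 2 : ℝ) : ℂ) *
      ∑ x ∈ s, ∑ y ∈ s, ⟪v x, (P.kernel t).ker x y (v y)⟫_ℂ := by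
    simp only [← Finset.sum_add_distrib, Finset.mul_sum]
    exact Finset.sum_congr rfl fun x _ => Finset.sum_congr rfl fun y _ => hL x y _ _
  have h3 := congrArg Complex.re h2
  rw [Complex.add_re, Complex.re_ofReal_mul] at h3
  simp only [inner_sum, RCLike.re_eq_complex_re]
  linarith

/-- `a·(T_1 ⊗ ⋯ ⊗ T_n) = aT_1 ⊗ T_2 ⊗ ⋯ ⊗ T_n` (for `t > 0`). -/
def _root_.QMarkov.Tensor.act {t : ℝ≥0} (ht : t ≠ 0) (a : M) (x : Tensor M t) : Tensor M t where
  part := x.part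
  val := Function.update x.val 0 (a * x.val 0)
  val_eq_one r hr := by
    have h0 : r ≠ 0 := by
      rintro rfl
      exact hr (Finset.mem_erase.2 ⟨ht.symm, x.part.zero_mem⟩)
    rw [Function.update_of_ne h0]
    exact x.val_eq_one r hr

/-- The operator `h ↦ a·(x ⊗ h)`: for `t > 0`, `a` multiplies the first factor of `x`; for `t = 0`
there are no factors, and `a` acts on `h`. -/
def leftTens {t : ℝ≥0} (a : M) (x : Tensor M t) : H →L[ℂ] P.Ht t :=
  if ht : t = 0 then P.tens x ∘L (a : H →L[ℂ] H) else P.tens (x.act ht a)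

theorem chain_congr (f g f' g' : ℝ≥0 → M) (l : List ℝ≥0) : ∀ (a : ℝ≥0)
    (_ : ∀ r ∈ a :: l, f r = f' r) (_ : ∀ r ∈ a :: l, g r = g' r),
    P.chain f g a l = P.chain f' g' a l := by
  induction l with
  | nil => exact fun _ _ _ => rfl
  | cons b l ih =>
    intro a hf hg
    ext A : 1
    rw [chain_cons, chain_cons, hf a (by simp), hg a (by simp),
      ih b (fun r hr => hf r (List.mem_cons_of_mem _ hr))
        (fun r hr => hg r (List.mem_cons_of_mem _ hr))]

theorem gram_act {t : ℝ≥0} (ht : t ≠ 0) (a b : M) (x y : Tensor M t) :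
    P.gram (x.act ht a) (y.act ht b) 1 = P.gram x y (star a * b) := by
  unfold gram corr
  change P.chain _ _ 0 (((x.part.sup y.part).nodes.erase 0).sort (· ≤ ·)) 1 = _
  have hmem : t ∈ ((x.part.sup y.part).nodes.erase 0).sort (· ≤ ·) := by
    rw [Finset.mem_sort, Finset.mem_erase]
    exact ⟨ht, (x.part.sup y.part).right_mem⟩
  have hne : ∀ r ∈ ((x.part.sup y.part).nodes.erase 0).sort (· ≤ ·), r ≠ 0 := by
    intro r hr
    rw [Finset.mem_sort, Finset.mem_erase] at hr
    exact hr.1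
  generalize ((x.part.sup y.part).nodes.erase 0).sort (· ≤ ·) = l at hmem hne
  cases l with
  | nil => simp at hmem
  | cons c l =>
    rw [chain_cons, chain_cons, P.chain_congr _ _ x.val y.val l c
      (fun r hr => Function.update_of_ne (hne r hr) _ _)
      (fun r hr => Function.update_of_ne (hne r hr) _ _)]
    simp [Tensor.act, mul_assoc]

theorem gram_zero (x y : Tensor M (0 : ℝ≥0)) (A : M) : P.gram x y A = A := by
  unfold gram corr
  have : (x.part.sup y.part).nodes.erase 0 = ∅ := by
    refine Finset.eq_empty_of_forall_notMem fun r hr => ?_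
    rw [Finset.mem_erase] at hr
    exact hr.1 (le_antisymm ((x.part.sup y.part).le_right r hr.2) zero_le)
  rw [this]
  simp [chain]

theorem inner_leftTens {t : ℝ≥0} (a b : M) (x y : Tensor M t) (h k : H) :
    ⟪P.leftTens a x h, P.leftTens b y k⟫_ℂ =
      ⟪h, (P.gram x y (star a * b) : H →L[ℂ] H) k⟫_ℂ := by
  unfold leftTens
  split_ifs with ht
  · subst ht
    rw [ContinuousLinearMap.comp_apply, ContinuousLinearMap.comp_apply, inner_tens, gram_zero,
      gram_zero]
    change _ = ⟪h, (star (a : H →L[ℂ] H)) ((b : H →L[ℂ] H) k)⟫_ℂ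
    rw [ContinuousLinearMap.star_eq_adjoint, ContinuousLinearMap.adjoint_inner_right]
    simp
  · rw [inner_tens, ← P.gram_act ht]

theorem leftTens_one {t : ℝ≥0} (x : Tensor M t) : P.leftTens 1 x = P.tens x := by
  unfold leftTens
  split_ifs with ht
  · ext h
    simp
  · congr 1
    refine Tensor.ext rfl ?_
    simp [Tensor.act]

theorem leftTens_bound {t : ℝ≥0} (a : M) (s : Finset (Tensor M t)) (v : Tensor M t → H) :
    ‖∑ x ∈ s, P.leftTens a x (v x)‖ ≤ ‖a‖ * ‖∑ x ∈ s, P.tens x (v x)‖ := by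
  obtain ⟨c, hc, hcomm⟩ := exists_defect (a : H →L[ℂ] H)
  have hcM : c ∈ M := by
    rw [← M.commutant_commutant, VonNeumannAlgebra.mem_commutant_iff]
    intro m hm
    rw [VonNeumannAlgebra.mem_commutant_iff] at hm
    refine (hcomm m ?_).symm.eq
    have h1 := hm _ a.2
    have h2 := hm _ (star a).2
    change star (a : H →L[ℂ] H) * a * m = m * (star (a : H →L[ℂ] H) * a)
    calc _ = star (a : H →L[ℂ] H) * (a * m) := mul_assoc _ _ _
      _ = (star (a : H →L[ℂ] H) * m) * a := by rw [h1, mul_assoc]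
      _ = _ := by rw [show star (a : H →L[ℂ] H) * m = m * star (a : H →L[ℂ] H) from h2, mul_assoc]
  have hc' : star a * a + star (⟨c, hcM⟩ : M) * ⟨c, hcM⟩ = ((‖a‖ ^ 2 : ℝ) : ℂ) • (1 : M) := by
    apply Subtype.ext
    change star (a : H →L[ℂ] H) * a + star c * c = ((‖(a : H →L[ℂ] H)‖ ^ 2 : ℝ) : ℂ) • 1
    rw [hc]
    exact add_sub_cancel _ _
  generalize (⟨c, hcM⟩ : M) = d at hc'
  refine P.lift_bound (P.leftTens a) ‖a‖ (norm_nonneg _)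
    (fun x y => P.gram x y (star d * d)) (fun x y h k => ?_)
    (fun s v => P.gram_pos s (fun _ _ => star d * d) (const_pos s d) v) s v
  rw [inner_leftTens, ← inner_add_right, ← inner_smul_right]
  congr 1
  have h3 : P.gram x y (star a * a) + P.gram x y (star d * d) =
      ((‖a‖ ^ 2 : ℝ) : ℂ) • P.gram x y 1 := by
    rw [← map_add, hc', map_smul]
  exact congrArg (fun m : M => (m : H →L[ℂ] H) k) h3

/-- The left action of `M` on `H_t`, `a·(T_1 ⊗ ⋯ ⊗ T_n ⊗ h) = aT_1 ⊗ ⋯ ⊗ T_n ⊗ h`, and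
`a·h = ah` if `t = 0`. -/
def leftAct (t : ℝ≥0) (a : M) : P.Ht t →L[ℂ] P.Ht t :=
  (P.kernel t).lift (P.leftTens a) ‖a‖ (P.leftTens_bound a)

theorem leftAct_tens {t : ℝ≥0} (a : M) (x : Tensor M t) (h : H) :
    P.leftAct t a (P.tens x h) = P.leftTens a x h := (P.kernel t).lift_tens _ _ _ x h

theorem norm_leftAct_le {t : ℝ≥0} (a : M) (u : P.Ht t) : ‖P.leftAct t a u‖ ≤ ‖a‖ * ‖u‖ :=
  (P.kernel t).norm_lift_le _ _ _ u

theorem inner_leftAct {t : ℝ≥0} (a : M) (x y : Tensor M t) (h k : H) :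
    ⟪P.tens x h, P.leftAct t a (P.tens y k)⟫_ℂ = ⟪h, (P.gram x y a : H →L[ℂ] H) k⟫_ℂ := by
  rw [leftAct_tens, ← leftTens_one, inner_leftTens]
  simp

theorem adjoint_leftAct {t : ℝ≥0} (a : M) : (P.leftAct t a).adjoint = P.leftAct t (star a) := by
  refine (P.kernel t).ext_tens fun y k => ?_
  refine ext_inner_left ℂ fun u => ?_
  rw [ContinuousLinearMap.adjoint_inner_right]
  refine (P.kernel t).induction_tens
    (p := fun u => ⟪P.leftAct t a u, P.tens y k⟫_ℂ = ⟪u, P.leftAct t (star a) (P.tens y k)⟫_ℂ)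
    (isClosed_eq (by fun_prop) (by fun_prop)) (fun s v => ?_) u
  simp only [map_sum, sum_inner]
  refine Finset.sum_congr rfl fun x _ => ?_
  rw [inner_leftAct, leftAct_tens]
  conv_lhs => rw [← leftTens_one]
  rw [inner_leftTens]
  simp

/-- The bound used for operators of the form `x ⊗ h ↦ L x h` where `L` is built from an operator `X`
such that `X^* X` commutes with `M`. -/
theorem commutant_bound {t : ℝ≥0} {G : Type v} [NormedAddCommGroup G] [InnerProductSpace ℂ G]
    [CompleteSpace G] {F : Type v} [NormedAddCommGroup F] [InnerProductSpace ℂ F]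
    (X : H →L[ℂ] G) (hX : X.adjoint ∘L X ∈ M.commutant) (L : Tensor M t → (H →L[ℂ] F))
    (hL : ∀ x y h k, ⟪L x h, L y k⟫_ℂ = ⟪X h, X ((P.gram x y 1 : H →L[ℂ] H) k)⟫_ℂ)
    (s : Finset (Tensor M t)) (v : Tensor M t → H) :
    ‖∑ x ∈ s, L x (v x)‖ ≤ ‖X‖ * ‖∑ x ∈ s, P.tens x (v x)‖ := by
  obtain ⟨c, hc, hcomm⟩ := exists_defect X
  have hcM : ∀ m ∈ M, Commute c m := by
    intro m hm
    rw [VonNeumannAlgebra.mem_commutant_iff] at hX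
    exact hcomm m (hX m hm).symm
  refine P.lift_bound L ‖X‖ (norm_nonneg _)
    (fun x y => star c * c * (P.gram x y 1 : H →L[ℂ] H)) (fun x y h k => ?_) (fun s v => ?_) s v
  · rw [hL, hc, sub_mul, sub_apply, inner_sub_right]
    have : ⟪X h, X ((P.gram x y 1 : H →L[ℂ] H) k)⟫_ℂ =
        ⟪h, (X.adjoint ∘L X * (P.gram x y 1 : H →L[ℂ] H)) k⟫_ℂ := by
      rw [← ContinuousLinearMap.adjoint_inner_right]
      rfl
    rw [this, add_sub_cancel, smul_mul_assoc, one_mul, smul_apply, inner_smul_right]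
  · refine ((P.kernel t).nonneg s fun x => c (v x)).trans_eq
      (Finset.sum_congr rfl fun x _ => Finset.sum_congr rfl fun y _ => ?_)
    have h2 : c ((P.gram x y 1 : H →L[ℂ] H) (v y)) = (P.gram x y 1 : H →L[ℂ] H) (c (v y)) :=
      DFunLike.congr_fun (hcM _ (P.gram x y 1).2).eq (v y)
    change _ = ⟪v x, star c (c ((P.gram x y 1 : H →L[ℂ] H) (v y)))⟫_ℂ
    rw [ContinuousLinearMap.star_eq_adjoint, ContinuousLinearMap.adjoint_inner_right, h2]
    rfl

theorem rightTens_bound {t : ℝ≥0} (a : M.commutant) (s : Finset (Tensor M t))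
    (v : Tensor M t → H) :
    ‖∑ x ∈ s, (P.tens x ∘L (a : H →L[ℂ] H)) (v x)‖ ≤
      ‖(a : H →L[ℂ] H)‖ * ‖∑ x ∈ s, P.tens x (v x)‖ := by
  refine P.commutant_bound (a : H →L[ℂ] H) (star a * a).2 _ (fun x y h k => ?_) s v
  rw [ContinuousLinearMap.comp_apply, ContinuousLinearMap.comp_apply, inner_tens]
  have := (VonNeumannAlgebra.mem_commutant_iff.1 a.2) _ (P.gram x y 1).2
  exact congrArg (fun z => ⟪(a : H →L[ℂ] H) h, z⟫_ℂ) (DFunLike.congr_fun this k)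

/-- The action of `M'` on `H_t`, `a(T_1 ⊗ ⋯ ⊗ T_n ⊗ h) = T_1 ⊗ ⋯ ⊗ T_n ⊗ ah`. -/
def commutantAct (t : ℝ≥0) (a : M.commutant) : P.Ht t →L[ℂ] P.Ht t :=
  (P.kernel t).lift (fun x => P.tens x ∘L (a : H →L[ℂ] H)) ‖(a : H →L[ℂ] H)‖ (P.rightTens_bound a)

theorem commutantAct_tens {t : ℝ≥0} (a : M.commutant) (x : Tensor M t) (h : H) :
    P.commutantAct t a (P.tens x h) = P.tens x ((a : H →L[ℂ] H) h) :=
  (P.kernel t).lift_tens _ _ _ x h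

theorem leftAct_commutantAct {t : ℝ≥0} (a : M) (b : M.commutant) :
    P.leftAct t a ∘L P.commutantAct t b = P.commutantAct t b ∘L P.leftAct t a := by
  refine (P.kernel t).ext_tens fun x h => ?_
  rw [ContinuousLinearMap.comp_apply, ContinuousLinearMap.comp_apply]
  rw [commutantAct_tens, leftAct_tens, leftAct_tens]
  unfold leftTens
  have := DFunLike.congr_fun ((VonNeumannAlgebra.mem_commutant_iff.1 b.2) _ a.2) h
  split_ifs with ht
  · rw [ContinuousLinearMap.comp_apply, ContinuousLinearMap.comp_apply, commutantAct_tens]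
    exact congrArg _ this
  · rw [commutantAct_tens]

/-! Concatenation of tensors -/

/-- For `x = S_1 ⊗ ⋯ ⊗ S_m` over a partition `p₂` of `[0, s]` and `y = T_1 ⊗ ⋯ ⊗ T_n` over a
partition `p₁` of `[0, t]`, the tensor `S_1 ⊗ ⋯ ⊗ S_m ⊗ T_1 ⊗ ⋯ ⊗ T_n` over `p₂ ∨ (p₁ + s)`. -/
def _root_.QMarkov.Tensor.concat {t s : ℝ≥0} (x : Tensor M s) (y : Tensor M t) :
    Tensor M (t + s) where
  part := x.part.concat y.part
  val r := if r < s then x.val r else y.val (r - s)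
  val_eq_one r hr := by
    split_ifs with h
    · refine x.val_eq_one r fun h' => hr (Finset.mem_erase.2 ⟨?_, ?_⟩)
      · exact (h.trans_le le_add_self).ne
      · exact Finset.mem_union_left _ (Finset.mem_of_mem_erase h')
    · have hrs : r - s + s = r := tsub_add_cancel_of_le (not_lt.1 h)
      refine y.val_eq_one _ fun h' => hr (Finset.mem_erase.2 ⟨?_, ?_⟩)
      · rintro rfl
        exact Finset.ne_of_mem_erase h' (add_tsub_cancel_right _ _)
      · exact Finset.mem_union_right _
          (Finset.mem_image.2 ⟨r - s, Finset.mem_of_mem_erase h', hrs⟩)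

theorem chain_append (f g f₁ g₁ : ℝ≥0 → M) (s : ℝ≥0) (hf : ∀ r < s, f r = f₁ r)
    (hg : ∀ r < s, g r = g₁ r) (l₂ : List ℝ≥0) (l₁ : List ℝ≥0) : ∀ (a : ℝ≥0)
    (_ : (a :: l₁).Pairwise (· < ·)) (_ : ∀ r ∈ a :: l₁, r ≤ s) (_ : s ∈ a :: l₁) (A : M),
    P.chain f g a (l₁ ++ l₂) A = P.chain f g s l₂ (P.chain f₁ g₁ a l₁ A) := by
  induction l₁ with
  | nil =>
    intro a _ _ hs A
    obtain rfl : s = a := by simpa using hs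
    rfl
  | cons b l ih =>
    intro a hl hle hs A
    have hab : a < b := (List.pairwise_cons.1 hl).1 b (by simp)
    have has : a < s := hab.trans_le (hle b (by simp))
    rw [List.cons_append, chain_cons, chain_cons, hf a has, hg a has]
    refine ih b hl.of_cons (fun r hr => hle r (List.mem_cons_of_mem _ hr)) ?_ _
    exact (List.mem_cons.1 hs).resolve_left has.ne'

theorem chain_shift (f g : ℝ≥0 → M) (s : ℝ≥0) (l : List ℝ≥0) : ∀ (a : ℝ≥0) (A : M),
    P.chain f g (a + s) (l.map (· + s)) A =
      P.chain (fun r => f (r + s)) (fun r => g (r + s)) a l A := by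
  induction l with
  | nil => exact fun _ _ => rfl
  | cons b l ih =>
    intro a A
    rw [List.map_cons, chain_cons, chain_cons, ih, add_tsub_add_eq_tsub_right]

theorem sort_concat {t s : ℝ≥0} (p₂ : Partition s) (p₁ : Partition t) :
    ((p₂.concat p₁).nodes.erase 0).sort (· ≤ ·) =
      (p₂.nodes.erase 0).sort (· ≤ ·) ++ ((p₁.nodes.erase 0).sort (· ≤ ·)).map (· + s) := by
  classical
  refine List.Perm.eq_of_pairwise' (r := (· ≤ ·)) (Finset.pairwise_sort _ _) ?_ ?_
  · rw [List.pairwise_append]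
    refine ⟨Finset.pairwise_sort _ _, ?_, ?_⟩
    · rw [List.pairwise_map]
      exact (Finset.pairwise_sort _ _).imp fun h => add_le_add_left h s
    · intro a ha b hb
      obtain ⟨c, -, rfl⟩ := List.mem_map.1 hb
      rw [Finset.mem_sort] at ha
      exact (p₂.le_right a (Finset.mem_of_mem_erase ha)).trans le_add_self
  · rw [List.perm_ext_iff_of_nodup (Finset.sort_nodup _ _)]
    · intro r
      simp only [Finset.mem_sort, Finset.mem_erase, List.mem_append, List.mem_map,
        Partition.concat, Finset.mem_union, Finset.mem_image]
      constructor
      · rintro ⟨h0, h | ⟨x, hx, rfl⟩⟩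
        · exact Or.inl ⟨h0, h⟩
        · by_cases hx0 : x = 0
          · subst hx0
            rw [zero_add] at h0 ⊢
            exact Or.inl ⟨h0, p₂.right_mem⟩
          · exact Or.inr ⟨x, ⟨hx0, hx⟩, rfl⟩
      · rintro (⟨h0, h⟩ | ⟨x, ⟨hx0, hx⟩, rfl⟩)
        · exact ⟨h0, Or.inl h⟩
        · refine ⟨fun h => hx0 ?_, Or.inr ⟨x, hx, rfl⟩⟩
          exact le_antisymm (h ▸ le_self_add) zero_le
    · rw [List.nodup_append]
      refine ⟨Finset.sort_nodup _ _, (Finset.sort_nodup _ _).map (add_left_injective s), ?_⟩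
      rintro a ha b hb rfl
      obtain ⟨c, hc, hcs⟩ := List.mem_map.1 hb
      rw [Finset.mem_sort, Finset.mem_erase] at ha hc
      refine hc.1 (le_antisymm ?_ zero_le)
      have := p₂.le_right a ha.2
      rw [← hcs] at this
      exact add_le_iff_nonpos_left.1 this

theorem gram_concat {t s : ℝ≥0} (x x' : Tensor M s) (y y' : Tensor M t) (A : M) :
    P.gram (x.concat y) (x'.concat y') A = P.gram y y' (P.gram x x' A) := by
  classical
  rw [P.gram_eq (x.concat y) (x'.concat y')
    ((x.part.sup x'.part).concat (y.part.sup y'.part)).nodes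
    (Finset.union_subset_union Finset.subset_union_left
      (Finset.image_subset_image Finset.subset_union_left))
    (Finset.union_subset_union Finset.subset_union_right
      (Finset.image_subset_image Finset.subset_union_right))
    ((x.part.sup x'.part).concat (y.part.sup y'.part)).le_right]
  unfold gram corr
  rw [sort_concat, P.chain_append (x.concat y).val (x'.concat y').val x.val x'.val s (fun r hr => if_pos hr)
    (fun r hr => if_pos hr)]
  · have := P.chain_shift (x.concat y).val (x'.concat y').val s
      (((y.part.sup y'.part).nodes.erase 0).sort (· ≤ ·)) 0
    rw [zero_add] at this
    rw [this]
    congr 2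
    · ext1 r
      simp [Tensor.concat]
    · ext1 r
      simp [Tensor.concat]
  · refine List.pairwise_cons.2 ⟨fun r hr => ?_, Finset.sortedLT_sort _ |>.pairwise⟩
    rw [Finset.mem_sort, Finset.mem_erase] at hr
    exact pos_iff_ne_zero.2 hr.1
  · intro r hr
    rcases List.mem_cons.1 hr with rfl | hr
    · exact zero_le
    · rw [Finset.mem_sort] at hr
      exact (x.part.sup x'.part).le_right r (Finset.mem_of_mem_erase hr)
  · by_cases hs : s = 0
    · simp [hs]
    · refine List.mem_cons_of_mem _ ?_
      rw [Finset.mem_sort, Finset.mem_erase]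
      exact ⟨hs, (x.part.sup x'.part).right_mem⟩

theorem concat_bound {t s : ℝ≥0} (x : Tensor M s) (c : Finset (Tensor M t))
    (v : Tensor M t → H) :
    ‖∑ y ∈ c, P.tens (x.concat y) (v y)‖ ≤
      √‖P.gram x x 1‖ * ‖∑ y ∈ c, P.tens y (v y)‖ := by
  refine le_of_sq_le_sq ?_ (by positivity)
  rw [mul_pow, Real.sq_sqrt (norm_nonneg _), ← inner_self_eq_norm_sq (𝕜 := ℂ)]
  have : ⟪∑ y ∈ c, P.tens (x.concat y) (v y), ∑ y ∈ c, P.tens (x.concat y) (v y)⟫_ℂ =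
      ⟪∑ y ∈ c, P.tens y (v y), P.leftAct t (P.gram x x 1) (∑ y ∈ c, P.tens y (v y))⟫_ℂ := by
    simp only [map_sum, sum_inner, inner_sum, inner_leftAct, inner_tens,
      gram_concat]
  rw [this]
  refine (RCLike.re_le_norm _).trans ((norm_inner_le_norm _ _).trans ?_)
  calc _ ≤ ‖∑ y ∈ c, P.tens y (v y)‖ * (‖P.gram x x 1‖ * ‖∑ y ∈ c, P.tens y (v y)‖) := by
        gcongr
        exact P.norm_leftAct_le _ _
    _ = _ := by ring

/-- For `x = S_1 ⊗ ⋯ ⊗ S_m` over a partition of `[0, s]`, the operator `H_t → H_{t+s}`,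
`u ↦ S_1 ⊗ ⋯ ⊗ S_m ⊗ u`. -/
def concatLeft (t : ℝ≥0) {s : ℝ≥0} (x : Tensor M s) : P.Ht t →L[ℂ] P.Ht (t + s) :=
  (P.kernel t).lift (fun y => P.tens (x.concat y)) (√‖P.gram x x 1‖) (P.concat_bound x)

theorem concatLeft_tens {t s : ℝ≥0} (x : Tensor M s) (y : Tensor M t) (h : H) :
    P.concatLeft t x (P.tens y h) = P.tens (x.concat y) h := (P.kernel t).lift_tens _ _ _ y h

theorem inner_concatLeft {t s : ℝ≥0} (x x' : Tensor M s) (u u' : P.Ht t) :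
    ⟪P.concatLeft t x u, P.concatLeft t x' u'⟫_ℂ = ⟪u, P.leftAct t (P.gram x x' 1) u'⟫_ℂ := by
  refine (P.kernel t).induction_tens
    (p := fun u => ⟪P.concatLeft t x u, P.concatLeft t x' u'⟫_ℂ =
      ⟪u, P.leftAct t (P.gram x x' 1) u'⟫_ℂ)
    (isClosed_eq (by fun_prop) (by fun_prop)) (fun c v => ?_) u
  refine (P.kernel t).induction_tens
    (p := fun u' => ⟪P.concatLeft t x (∑ y ∈ c, P.tens y (v y)), P.concatLeft t x' u'⟫_ℂ =
      ⟪∑ y ∈ c, P.tens y (v y), P.leftAct t (P.gram x x' 1) u'⟫_ℂ)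
    (isClosed_eq (by fun_prop) (by fun_prop)) (fun c' v' => ?_) u'
  simp only [map_sum, sum_inner, inner_sum, inner_leftAct, concatLeft_tens, inner_tens,
    gram_concat]

theorem leftAct_concatLeft {t s : ℝ≥0} (hs : s ≠ 0) (a : M) (x : Tensor M s) :
    P.leftAct (t + s) a ∘L P.concatLeft t x = P.concatLeft t (x.act hs a) := by
  refine (P.kernel t).ext_tens fun y h => ?_
  have hts : t + s ≠ 0 := fun h => hs (le_antisymm (h ▸ le_add_self) zero_le)
  rw [ContinuousLinearMap.comp_apply, concatLeft_tens, concatLeft_tens, leftAct_tens, leftTens,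
    dif_neg hts]
  congr 2
  refine Tensor.ext rfl (funext fun r => ?_)
  by_cases hr : r = 0
  · subst hr
    simp [Tensor.act, Tensor.concat, pos_iff_ne_zero.2 hs]
  · simp [Tensor.act, Tensor.concat, hr]

theorem leftAct_concatLeft_zero {t : ℝ≥0} (a : M) (x : Tensor M (0 : ℝ≥0)) :
    P.leftAct (t + 0) a ∘L P.concatLeft t x = P.concatLeft t x ∘L P.leftAct t a := by
  refine (P.kernel t).ext_tens fun y h => ?_
  rw [ContinuousLinearMap.comp_apply, ContinuousLinearMap.comp_apply, concatLeft_tens,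
    leftAct_tens, leftAct_tens]
  unfold leftTens
  by_cases ht : t = 0
  · rw [dif_pos ht, dif_pos (by rw [ht, add_zero]), ContinuousLinearMap.comp_apply,
      ContinuousLinearMap.comp_apply, concatLeft_tens]
  · rw [dif_neg ht, dif_neg (by rwa [add_zero]), concatLeft_tens]
    congr 2
    refine Tensor.ext rfl (funext fun r => ?_)
    by_cases hr : r = 0
    · subst hr
      simp [Tensor.act, Tensor.concat]
    · simp [Tensor.act, Tensor.concat, hr]

/-! The product system -/

/-- `E(t) = L_M(H, H_t)`, the bounded operators `X : H → H_t` with `X a h = a·X h` for `a ∈ M`. -/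
def E (t : ℝ≥0) : Submodule ℂ (H →L[ℂ] P.Ht t) where
  carrier := {X | ∀ a : M, X ∘L (a : H →L[ℂ] H) = P.leftAct t a ∘L X}
  add_mem' {X Y} hX hY a := by
    rw [ContinuousLinearMap.add_comp, hX a, hY a, ContinuousLinearMap.comp_add]
  zero_mem' a := by simp
  smul_mem' c X hX a := by
    rw [ContinuousLinearMap.smul_comp, hX a, ContinuousLinearMap.comp_smul]

theorem E_apply {t : ℝ≥0} (X : P.E t) (a : M) (h : H) :
    X.1 ((a : H →L[ℂ] H) h) = P.leftAct t a (X.1 h) := DFunLike.congr_fun (X.2 a) h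

theorem adjoint_comp_mem {t : ℝ≥0} (X Y : P.E t) : X.1.adjoint ∘L Y.1 ∈ M.commutant := by
  rw [VonNeumannAlgebra.mem_commutant_iff]
  intro a ha
  ext h
  refine ext_inner_left ℂ fun k => ?_
  change ⟪k, a (X.1.adjoint (Y.1 h))⟫_ℂ = ⟪k, X.1.adjoint (Y.1 (a h))⟫_ℂ
  have h1 := P.E_apply Y ⟨a, ha⟩ h
  have h2 := P.E_apply X (star ⟨a, ha⟩) k
  change Y.1 (a h) = _ at h1
  change X.1 ((star a) k) = _ at h2
  rw [ContinuousLinearMap.adjoint_inner_right, h1, ← ContinuousLinearMap.adjoint_inner_left,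
    ← ContinuousLinearMap.star_eq_adjoint a, ContinuousLinearMap.adjoint_inner_right, h2,
    ← adjoint_leftAct, ContinuousLinearMap.adjoint_inner_left]

theorem idTensOp_bound {t s : ℝ≥0} (X : P.E t) (c : Finset (Tensor M s)) (v : Tensor M s → H) :
    ‖∑ x ∈ c, (P.concatLeft t x ∘L X.1) (v x)‖ ≤ ‖X.1‖ * ‖∑ x ∈ c, P.tens x (v x)‖ := by
  refine P.commutant_bound X.1 (P.adjoint_comp_mem X X) _ (fun x y h k => ?_) c v
  rw [ContinuousLinearMap.comp_apply, ContinuousLinearMap.comp_apply, inner_concatLeft, E_apply]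

/-- For `X ∈ E(t)`, the operator `I_s ⊗ X : H_s → H_{t+s}`,
`S_1 ⊗ ⋯ ⊗ S_m ⊗ h ↦ S_1 ⊗ ⋯ ⊗ S_m ⊗ X h`. -/
def idTensOp {t : ℝ≥0} (s : ℝ≥0) (X : P.E t) : P.Ht s →L[ℂ] P.Ht (t + s) :=
  (P.kernel s).lift (fun x => P.concatLeft t x ∘L X.1) ‖X.1‖ (P.idTensOp_bound X)

theorem idTensOp_tens {t s : ℝ≥0} (X : P.E t) (x : Tensor M s) (h : H) :
    P.idTensOp s X (P.tens x h) = P.concatLeft t x (X.1 h) := (P.kernel s).lift_tens _ _ _ x h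

theorem idTensOp_leftAct {t s : ℝ≥0} (X : P.E t) (a : M) :
    P.idTensOp s X ∘L P.leftAct s a = P.leftAct (t + s) a ∘L P.idTensOp s X := by
  refine (P.kernel s).ext_tens fun x h => ?_
  rw [ContinuousLinearMap.comp_apply, ContinuousLinearMap.comp_apply, idTensOp_tens, leftAct_tens,
    leftTens]
  by_cases hs : s = 0
  · subst hs
    rw [dif_pos rfl, ContinuousLinearMap.comp_apply, idTensOp_tens, E_apply]
    exact (DFunLike.congr_fun (P.leftAct_concatLeft_zero a x) (X.1 h)).symm
  · rw [dif_neg hs, idTensOp_tens]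
    exact (DFunLike.congr_fun (P.leftAct_concatLeft hs a x) (X.1 h)).symm

/-- The tensor `I` over the partition `{0, t}`. -/
def _root_.QMarkov.Tensor.one (M : VonNeumannAlgebra H) (t : ℝ≥0) : Tensor M t where
  part := Partition.trivial t
  val _ := 1
  val_eq_one _ _ := rfl

/-- The isometry `ι_t : H → H_t`, `ι_t h = I ⊗ h` over `{0, t}`; it is `H = H_0` if `t = 0`. -/
def iota (t : ℝ≥0) : H →L[ℂ] P.Ht t := P.tens (Tensor.one M t)

theorem chain_one (l : List ℝ≥0) : ∀ a, P.chain (fun _ => 1) (fun _ => 1) a l 1 = 1 := by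
  induction l with
  | nil => exact fun _ => rfl
  | cons b l ih =>
    intro a
    rw [chain_cons]
    simp [P.map_one, ih]

theorem inner_iota {t : ℝ≥0} (h k : H) : ⟪P.iota t h, P.iota t k⟫_ℂ = ⟪h, k⟫_ℂ := by
  unfold iota
  rw [inner_tens]
  have : P.gram (Tensor.one M t) (Tensor.one M t) 1 = 1 := P.chain_one _ 0
  simp [this]

/-- The product system of the cp semigroup, over `M'`. The correspondence `E(t) = L_M(H, H_t)` has
`a·X = aX`, `X·a = Xa` and `⟨X, Y⟩ = X^* Y`; an element `a` of `M'` is identified with `ι_0 a` in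
`E(0)`; and `X ⊗ Y` with `(I_s ⊗ X) Y` in `E(t + s)`. -/
def productSystem : ProductSystemData.{u, u} M.commutant where
  E t := P.E t
  corr t :=
    { left := fun a X => ⟨P.commutantAct t a ∘L X.1, fun b => by
        rw [ContinuousLinearMap.comp_assoc, X.2 b, ← ContinuousLinearMap.comp_assoc,
          ← leftAct_commutantAct, ContinuousLinearMap.comp_assoc]⟩
      right := fun X a => ⟨X.1 ∘L (a : H →L[ℂ] H), fun b => by
        have h : (a : H →L[ℂ] H) ∘L (b : H →L[ℂ] H) = (b : H →L[ℂ] H) ∘L (a : H →L[ℂ] H) :=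
          ((VonNeumannAlgebra.mem_commutant_iff.1 a.2) _ b.2).symm
        rw [ContinuousLinearMap.comp_assoc, h, ← ContinuousLinearMap.comp_assoc, X.2 b,
          ContinuousLinearMap.comp_assoc]⟩
      ip := fun X Y => ⟨X.1.adjoint ∘L Y.1, P.adjoint_comp_mem X Y⟩ }
  unit a := ⟨P.iota 0 ∘L (a : H →L[ℂ] H), fun b => by
    ext h
    have h1 := DFunLike.congr_fun ((VonNeumannAlgebra.mem_commutant_iff.1 a.2) _ b.2) h
    change P.iota 0 ((a : H →L[ℂ] H) ((b : H →L[ℂ] H) h)) =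
      P.leftAct 0 b (P.iota 0 ((a : H →L[ℂ] H) h))
    rw [iota, leftAct_tens, leftTens, dif_pos rfl]
    exact (congrArg _ h1).symm⟩
  mul t s X Y := ⟨P.idTensOp s X ∘L Y.1, fun a => by
    rw [ContinuousLinearMap.comp_assoc, Y.2 a, ← ContinuousLinearMap.comp_assoc, idTensOp_leftAct,
      ContinuousLinearMap.comp_assoc]⟩

/-- The identity representation, `T_t(X) = ι_t^* X`. -/
def identityRep (t : ℝ≥0) : P.productSystem.E t →ₗ[ℂ] (H →L[ℂ] H) where
  toFun X := (P.iota t).adjoint ∘L X.1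
  map_add' _ _ := ContinuousLinearMap.comp_add _ _ _
  map_smul' _ _ := ContinuousLinearMap.comp_smul _ _ _

/-! The space `E(t) ⊗ H` -/

theorem sum_adjoint_comp {ι : Type u} {G : Type v} [NormedAddCommGroup G] [InnerProductSpace ℂ G]
    [CompleteSpace G] (X : ι → (H →L[ℂ] G)) (s : Finset ι) (v : ι → H) :
    ∑ x ∈ s, ∑ y ∈ s, ⟪v x, ((X x).adjoint ∘L X y) (v y)⟫_ℂ =
      ((‖∑ x ∈ s, X x (v x)‖ ^ 2 : ℝ) : ℂ) := by
  have h : ⟪∑ x ∈ s, X x (v x), ∑ x ∈ s, X x (v x)⟫_ℂ =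
      ((‖∑ x ∈ s, X x (v x)‖ ^ 2 : ℝ) : ℂ) := by
    rw [inner_self_eq_norm_sq_to_K]
    simp
  rw [← h, sum_inner]
  refine Finset.sum_congr rfl fun x _ => ?_
  rw [inner_sum]
  refine Finset.sum_congr rfl fun y _ => ?_
  rw [ContinuousLinearMap.comp_apply, ContinuousLinearMap.adjoint_inner_right]

/-- The kernel of `E(t) ⊗_σ H`, where `σ` is the identity representation of `M'`:
`⟨X ⊗ h, Y ⊗ k⟩ = ⟨h, σ(⟨X, Y⟩) k⟩` with `⟨X, Y⟩ = X^* Y`. -/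
def tensorKernel (t : ℝ≥0) : PosKernel (P.E t) H where
  ker X Y := X.1.adjoint ∘L Y.1
  nonneg s v := by
    rw [sum_adjoint_comp (fun X : P.E t => X.1)]
    exact Complex.zero_le_real.2 (sq_nonneg _)

/-- `E(t) ⊗_σ H` with `⟨X ⊗ h, Y ⊗ k⟩ = ⟨h, σ(⟨X, Y⟩) k⟩`, for the identity representation `σ`. -/
abbrev EH (t : ℝ≥0) : Type u := (P.tensorKernel t).Space

theorem norm_sum_tensorKernel {t : ℝ≥0} (s : Finset (P.E t))
    (v : P.E t → H) :
    ‖∑ X ∈ s, (P.tensorKernel t).tens X (v X)‖ = ‖∑ X ∈ s, X.1 (v X)‖ := by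
  rw [← sq_eq_sq₀ (norm_nonneg _) (norm_nonneg _), PosKernel.norm_sum_tens]
  exact congrArg Complex.re (sum_adjoint_comp (fun X : P.E t => X.1) s v)

theorem Ttilde_bound {t : ℝ≥0} (s : Finset (P.E t))
    (v : P.E t → H) :
    ‖∑ X ∈ s, P.identityRep t X (v X)‖ ≤ 1 * ‖∑ X ∈ s, (P.tensorKernel t).tens X (v X)‖ := by
  rw [norm_sum_tensorKernel]
  have h1 : ∑ X ∈ s, P.identityRep t X (v X) = (P.iota t).adjoint (∑ X ∈ s, X.1 (v X)) := by
    rw [map_sum]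
    rfl
  rw [h1]
  refine ((P.iota t).adjoint.le_opNorm _).trans ?_
  gcongr
  rw [LinearIsometryEquiv.norm_map]
  refine ContinuousLinearMap.opNorm_le_bound _ zero_le_one fun h => ?_
  refine le_of_sq_le_sq ?_ (by positivity)
  rw [one_mul, ← inner_self_eq_norm_sq (𝕜 := ℂ), inner_iota, inner_self_eq_norm_sq]

/-- The operator `T̃_t : E(t) ⊗_σ H → H` with `T̃_t(X ⊗ h) = T_t(X) h`. -/
def Ttilde (t : ℝ≥0) : P.EH t →L[ℂ] H :=
  (P.tensorKernel t).lift (fun X => P.identityRep t X) 1 P.Ttilde_bound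

theorem Ttilde_tens {t : ℝ≥0} (X : P.E t) (h : H) :
    P.Ttilde t ((P.tensorKernel t).tens X h) = P.identityRep t X h :=
  (P.tensorKernel t).lift_tens _ _ _ X h

theorem idTens_bound {t : ℝ≥0} (S : M) (s : Finset (P.E t))
    (v : P.E t → H) :
    ‖∑ X ∈ s, ((P.tensorKernel t).tens X ∘L (S : H →L[ℂ] H)) (v X)‖ ≤
      ‖S‖ * ‖∑ X ∈ s, (P.tensorKernel t).tens X (v X)‖ := by
  rw [norm_sum_tensorKernel]
  have h1 := P.norm_sum_tensorKernel s fun X => (S : H →L[ℂ] H) (v X)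
  have h2 : ∑ X ∈ s, X.1 ((S : H →L[ℂ] H) (v X)) = P.leftAct t S (∑ X ∈ s, X.1 (v X)) := by
    rw [map_sum]
    exact Finset.sum_congr rfl fun X _ => P.E_apply X S (v X)
  rw [h2] at h1
  exact h1.trans_le (P.norm_leftAct_le S _)

/-- For `S ∈ M`, the operator `I_{E(t)} ⊗ S` on `E(t) ⊗_σ H`, `X ⊗ h ↦ X ⊗ S h`. -/
def idTens (t : ℝ≥0) (S : M) : P.EH t →L[ℂ] P.EH t :=
  (P.tensorKernel t).lift (fun X => (P.tensorKernel t).tens X ∘L (S : H →L[ℂ] H)) ‖S‖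
    (P.idTens_bound S)

theorem idTens_tens {t : ℝ≥0} (S : M) (X : P.E t) (h : H) :
    P.idTens t S ((P.tensorKernel t).tens X h) = (P.tensorKernel t).tens X ((S : H →L[ℂ] H) h) :=
  (P.tensorKernel t).lift_tens _ _ _ X h

end CPSemigroup

end Construction

end QMarkov

end

/-! Everything rests on one fact: the vectors `X h` with `X ∈ E(t)` and `h ∈ H` are total in `H_t`
(`mem_of_forall_E`). The algebra `M` acts on `H_t`, and by normality of the maps `P_t` the number
`‖a·(x ⊗ h)‖²` is a σ-weakly continuous functional evaluated at `a^* a`. Such a functional is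
dominated by `‖(a ⊗ 1) ζ‖²` for some `ζ ∈ ℓ²(ℕ, H)` (`exists_dominating`). Hence `(a ⊗ 1) ζ ↦ a·(x ⊗
h)` extends to a bounded `M`-linear operator `W : ℓ²(ℕ, H) → H_t` (`exists_intertwiner`). Its
coordinates lie in `E(t)`, and `x ⊗ h = W ζ` is a sum of vectors `X_n ζ_n`.

Totality makes `X ⊗ h ↦ X h` a unitary from `E(t) ⊗ H` onto `H_t` that carries `I ⊗ S` to the action
of `S` (`evalOp`). In this picture `T̃_t` is `ι_t^*`, so coisometry is `ι_t^* ι_t = 1` and the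
dilation formula is `ι_t^* S ι_t = P_t(S)`.

Self-duality: a bounded module map `Φ` should be `X ↦ Y^* X`, where `Y^*` sends `X h` to `Φ(X) h`.
What is needed is `‖∑ Φ(X_i) g_i‖ ≤ c ‖∑ X_i g_i‖` (`norm_sum_moduleMap_le`), which is obtained by
normalising the row `(X_i)` with `(X^* X + ε)^{-1/2}`, a matrix over `M'`.

Normality of the left action of `M'`: the vectors `v` with `‖b v‖ = ‖(b ⊗ 1) ζ‖` for some `ζ` and
all `b ∈ M'` form a closed subspace, contain all elementary tensors, and have σ-weakly continuous
matrix coefficients.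

Product system: `(I ⊗ X)^* (I ⊗ Y)` is the action of `X^* Y ∈ M'`, which gives the inner product
formula. Cutting tensors at `s` and using totality twice shows that the products generate `E(t +
s)`. Multiplicativity of `T` is the identity `ι_{t+s}^* (I_s ⊗ X) = ι_t^* X ι_s^*`.

Continuity of `T_t`: a σ-weak functional of `ι_t^* X` is a norm-convergent sum of functionals `⟨u, X
k⟩` with arbitrary `u ∈ H_t`, whereas the σ-topology only offers `u = Y h` with `Y ∈ E(t)`.
Functionals on the closed span of the `⟨u, X k⟩` are evaluations at elements of `E(t)`
(`exists_eval`). Hahn–Banach and successive approximation then rewrite every element of that span as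
an absolutely convergent series of terms `⟨Y h, X k⟩` (`exists_vecAtoms_series`). -/

noncomputable section

namespace QMarkov

/-! ### Amplifications `a ⊗ 1` on `ℓ²(ℕ, H)`. -/

section Amplification

variable {H : Type u} [NormedAddCommGroup H]

/-- The Hilbert space `ℓ²(ℕ, H)`. -/
abbrev Seq (H : Type u) [NormedAddCommGroup H] : Type u := lp (fun _ : ℕ => H) 2

theorem Seq.hasSum_sq (z : Seq H) : HasSum (fun n => ‖z n‖ ^ 2) (‖z‖ ^ 2) := by
  simpa using lp.hasSum_norm (p := 2) (by simp) z

theorem memℓp_two {z : ℕ → H} (hz : Summable fun n => ‖z n‖ ^ 2) : Memℓp z 2 :=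
  memℓp_gen (by simpa using hz)

/-- A square-summable sequence as an element of `ℓ²(ℕ, H)`. -/
def Seq.mk (z : ℕ → H) (hz : Summable fun n => ‖z n‖ ^ 2) : Seq H := ⟨z, memℓp_two hz⟩

@[simp]
theorem Seq.mk_apply (z : ℕ → H) (hz : Summable fun n => ‖z n‖ ^ 2) (n : ℕ) :
    Seq.mk z hz n = z n := rfl

variable [InnerProductSpace ℂ H] {K : Type v} [NormedAddCommGroup K] [InnerProductSpace ℂ K]

theorem summable_sq_map (a : H →L[ℂ] K) (z : Seq H) : Summable fun n => ‖a (z n)‖ ^ 2 := by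
  refine Summable.of_nonneg_of_le (fun n => by positivity) (fun n => ?_)
    (z.hasSum_sq.summable.mul_left (‖a‖ ^ 2))
  rw [← mul_pow]
  gcongr
  exact a.le_opNorm _

/-- The amplification `a ⊗ 1` on `ℓ²(ℕ, H)`. -/
def ampl : (H →L[ℂ] K) →ₗ[ℂ] (Seq H →L[ℂ] Seq K) where
  toFun a := LinearMap.mkContinuous
    { toFun := fun z => Seq.mk (fun n => a (z n)) (summable_sq_map a z)
      map_add' := fun z w => by ext n; simp
      map_smul' := fun c z => by ext n; simp } ‖a‖ fun z => by
    refine le_of_sq_le_sq ?_ (by positivity)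
    rw [mul_pow]
    refine hasSum_le (fun n => ?_) (Seq.hasSum_sq _) (z.hasSum_sq.mul_left _)
    rw [← mul_pow]
    gcongr
    exact a.le_opNorm _
  map_add' a b := by ext z n; simp
  map_smul' c a := by ext z n; simp

@[simp]
theorem ampl_apply (a : H →L[ℂ] K) (z : Seq H) (n : ℕ) : ampl a z n = a (z n) := rfl

theorem ampl_comp {L : Type*} [NormedAddCommGroup L] [InnerProductSpace ℂ L]
    (a : K →L[ℂ] L) (b : H →L[ℂ] K) : ampl (a ∘L b) = ampl a ∘L ampl b := by
  ext z n; simp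

theorem ampl_one : ampl (1 : H →L[ℂ] H) = 1 := by
  ext z n; simp

theorem ampl_adjoint [CompleteSpace H] [CompleteSpace K] (a : H →L[ℂ] K) :
    (ampl a).adjoint = ampl a.adjoint := by
  refine ((ContinuousLinearMap.eq_adjoint_iff _ _).2 fun z w => ?_).symm
  rw [lp.inner_eq_tsum, lp.inner_eq_tsum]
  exact tsum_congr fun n => a.adjoint_inner_left _ _

theorem hasSum_ampl_sq (a : H →L[ℂ] K) (z : Seq H) :
    HasSum (fun n => ‖a (z n)‖ ^ 2) (‖ampl a z‖ ^ 2) := (ampl a z).hasSum_sq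

/-- A square-summable countable family in `ℓ²(ℕ, H)` can be merged into one sequence. -/
theorem exists_merge {κ : Type*} [Countable κ] (z : κ → Seq H)
    (hz : Summable fun k => ‖z k‖ ^ 2) :
    ∃ w : Seq H, ∀ a : H →L[ℂ] H, HasSum (fun k => ‖ampl a (z k)‖ ^ 2) (‖ampl a w‖ ^ 2) := by
  obtain ⟨e, he⟩ := exists_injective_nat (κ × ℕ)
  -- The index set may be finite or empty, so only an injection into `ℕ` is available; the remaining
  -- entries are `0` and do not affect the sums.
  set w : ℕ → H := Function.extend e (fun p => z p.1 p.2) 0 with hw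
  have hwe : ∀ p, w (e p) = z p.1 p.2 := fun p => he.extend_apply _ _ p
  have hw0 : ∀ n, n ∉ Set.range e → w n = 0 := fun n hn => Function.extend_apply' _ _ _ hn
  have hprod : Summable fun p : κ × ℕ => ‖z p.1 p.2‖ ^ 2 := by
    rw [summable_prod_of_nonneg fun p => by positivity]
    exact ⟨fun k => (z k).hasSum_sq.summable, by simpa only [(z _).hasSum_sq.tsum_eq] using hz⟩
  have hws : Summable fun n => ‖w n‖ ^ 2 := by
    rw [← he.summable_iff fun n hn => by simp [hw0 n hn]]
    exact hprod.congr fun p => by simp [hwe]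
  refine ⟨Seq.mk w hws, fun a => ?_⟩
  have h1 : HasSum (fun p : κ × ℕ => ‖a (z p.1 p.2)‖ ^ 2) (‖ampl a (Seq.mk w hws)‖ ^ 2) := by
    have := (he.hasSum_iff (f := fun n => ‖a (w n)‖ ^ 2) fun n hn => by simp [hw0 n hn]).2
      (hasSum_ampl_sq a (Seq.mk w hws))
    simpa [Function.comp_def, hwe] using this
  exact h1.prod_fiberwise fun k => hasSum_ampl_sq a (z k)

/-- Interleaving two sequences turns a bound by two amplified vectors into a bound by one,
simultaneously for all `a`. -/
theorem exists_merge_two (z₁ z₂ : Seq H) : ∃ w : Seq H, ∀ a : H →L[ℂ] H,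
    ‖ampl a w‖ ^ 2 = ‖ampl a z₁‖ ^ 2 + ‖ampl a z₂‖ ^ 2 := by
  obtain ⟨w, hw⟩ := exists_merge (fun b : Bool => cond b z₁ z₂) (Summable.of_finite)
  refine ⟨w, fun a => ?_⟩
  rw [← (hw a).tsum_eq, tsum_bool]
  simp [add_comm]

end Amplification

/-! ### Representations and intertwiners -/

section Rep

variable {N : Type*} [Ring N] [StarRing N] [Module ℂ N]
  {K : Type*} [NormedAddCommGroup K] [InnerProductSpace ℂ K] [CompleteSpace K]
  {K₁ : Type*} [NormedAddCommGroup K₁] [InnerProductSpace ℂ K₁] [CompleteSpace K₁]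

/-- Unital `*`-representations on Hilbert spaces. -/
structure IsStarRep (π : N →ₗ[ℂ] (K →L[ℂ] K)) : Prop where
  map_one : π 1 = 1
  map_mul : ∀ a b, π (a * b) = π a ∘L π b
  map_star : ∀ a, π (star a) = (π a).adjoint

theorem IsStarRep.amplify {π : N →ₗ[ℂ] (K →L[ℂ] K)} (h : IsStarRep π) :
    IsStarRep (ampl ∘ₗ π) where
  map_one := by simp [h.map_one, ampl_one]
  map_mul a b := by simp [h.map_mul, ampl_comp]
  map_star a := by simp [h.map_star, ampl_adjoint]

/-- If `b u` is dominated by `b ζ` for all `b`, then `b ζ ↦ b u` extends to an intertwiner. -/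
theorem IsStarRep.exists_intertwiner {π₁ : N →ₗ[ℂ] (K₁ →L[ℂ] K₁)} {π : N →ₗ[ℂ] (K →L[ℂ] K)}
    (h₁ : IsStarRep π₁) (h : IsStarRep π) (ζ : K₁) (u : K) (hu : ∀ b, ‖π b u‖ ≤ ‖π₁ b ζ‖) :
    ∃ W : K₁ →L[ℂ] K, (∀ b, W ∘L π₁ b = π b ∘L W) ∧ W ζ = u := by
  set e : N →ₗ[ℂ] K₁ := (ContinuousLinearMap.apply ℂ K₁ ζ).toLinearMap ∘ₗ π₁ with he
  set f : N →ₗ[ℂ] K := (ContinuousLinearMap.apply ℂ K u).toLinearMap ∘ₗ π with hf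
  have hea : ∀ b, e b = π₁ b ζ := fun b => rfl
  have hfa : ∀ b, f b = π b u := fun b => rfl
  set S : Submodule ℂ K₁ := (LinearMap.range e).topologicalClosure with hS
  have hmem : ∀ b, e b ∈ S := fun b => Submodule.le_topologicalClosure _ ⟨b, rfl⟩
  have : CompleteSpace S := (Submodule.isClosed_topologicalClosure _).completeSpace_coe
  set e' : N →ₗ[ℂ] S := e.codRestrict S hmem with he'
  have hd : DenseRange e' := by
    intro x
    rw [closure_subtype]
    have : (Subtype.val '' Set.range e') = (LinearMap.range e : Set K₁) := by
      ext y
      simp [e']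
    rw [this]
    exact x.2
  -- The domination hypothesis gives both well-definedness of `b ζ ↦ b u` and its boundedness, with
  -- constant `1`.
  have hn : ∃ C, ∀ x, ‖f x‖ ≤ C * ‖e' x‖ := ⟨1, fun x => by rw [one_mul]; exact hu x⟩
  set g : S →L[ℂ] K := f.extendOfNorm e' with hg
  have hge : ∀ b, g (e' b) = f b := LinearMap.extendOfNorm_eq hd hn
  have hinv : ∀ b, ∀ x ∈ S, π₁ b x ∈ S := by
    intro b x hx
    have : (LinearMap.range e).topologicalClosure ≤ S.comap (π₁ b).toLinearMap := by
      refine Submodule.topologicalClosure_minimal _ ?_ ?_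
      · rintro _ ⟨c, rfl⟩
        change π₁ b (π₁ c ζ) ∈ S
        rw [← ContinuousLinearMap.comp_apply, ← h₁.map_mul]
        exact hmem _
      · exact (Submodule.isClosed_topologicalClosure _).preimage (π₁ b).continuous
    exact this hx
  -- Since `π₁` preserves adjoints, the cyclic subspace `S` is reducing. So the extension by `0` on
  -- its orthogonal complement still intertwines.
  have hinv' : ∀ b, ∀ x ∈ Sᗮ, π₁ b x ∈ Sᗮ := by
    intro b x hx
    rw [Submodule.mem_orthogonal] at hx ⊢
    intro y hy
    rw [← ContinuousLinearMap.adjoint_inner_left, ← h₁.map_star]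
    exact hx _ (hinv _ y hy)
  have hgb : ∀ b (x : S), g ⟨π₁ b x, hinv b x x.2⟩ = π b (g x) := by
    intro b x
    have hc : Continuous fun x : S => (⟨π₁ b x, hinv b x x.2⟩ : S) := by fun_prop
    refine hd.induction_on (p := fun x : S => g ⟨π₁ b x, hinv b x x.2⟩ = π b (g x)) x
      (isClosed_eq (g.continuous.comp hc) (by fun_prop)) fun c => ?_
    rw [hge]
    have : (⟨π₁ b (e' c), hinv b (e' c) (e' c).2⟩ : S) = e' (b * c) := by
      apply Subtype.ext
      change π₁ b (π₁ c ζ) = π₁ (b * c) ζ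
      rw [h₁.map_mul]; rfl
    rw [this, hge, hfa, hfa, h.map_mul]; rfl
  refine ⟨g ∘L S.orthogonalProjectionOnto, fun b => ?_, ?_⟩
  · ext x
    obtain ⟨y, hy, z, hz, rfl⟩ := S.exists_add_mem_mem_orthogonal x
    simp only [ContinuousLinearMap.comp_apply, map_add,
      Submodule.orthogonalProjectionOnto_apply_of_mem_orthogonal (hinv' b z hz),
      Submodule.orthogonalProjectionOnto_apply_of_mem_orthogonal hz]
    have e1 := Submodule.orthogonalProjectionOnto_mem_subspace_eq_self (K := S) ⟨y, hy⟩
    have e2 := Submodule.orthogonalProjectionOnto_mem_subspace_eq_self (K := S) ⟨π₁ b y, hinv b y hy⟩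
    simp only at e1 e2
    rw [e1, e2]
    simp [hgb b ⟨y, hy⟩]
  · have h1 : ζ = (e' 1 : K₁) := by
      change ζ = π₁ 1 ζ
      simp [h₁.map_one]
    rw [ContinuousLinearMap.comp_apply]
    have : S.orthogonalProjectionOnto ζ = e' 1 := by
      conv_lhs => rw [h1]
      exact Submodule.orthogonalProjectionOnto_mem_subspace_eq_self _
    rw [this, hge, hfa, h.map_one]
    rfl

end Rep

section AbsSqrt

variable {K₁ : Type*} [NormedAddCommGroup K₁] [InnerProductSpace ℂ K₁] [CompleteSpace K₁]

/-- The absolute value `(W^* W)^{1/2}` of an operator. -/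
theorem exists_abs {K : Type*} [NormedAddCommGroup K] [InnerProductSpace ℂ K] [CompleteSpace K]
    (W : K₁ →L[ℂ] K) : ∃ T : K₁ →L[ℂ] K₁, (∀ x, ‖T x‖ = ‖W x‖) ∧
      ∀ B, Commute (W.adjoint ∘L W) B → Commute T B := by
  have hA : 0 ≤ W.adjoint ∘L W := by
    rw [ContinuousLinearMap.nonneg_iff_isPositive]
    exact ContinuousLinearMap.isPositive_adjoint_comp_self W
  refine ⟨CFC.sqrt (W.adjoint ∘L W), fun x => ?_, fun B h => h.cfcₙ_nnreal _⟩
  have h1 : (CFC.sqrt (W.adjoint ∘L W)).adjoint = CFC.sqrt (W.adjoint ∘L W) :=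
    (CFC.sqrt_nonneg (W.adjoint ∘L W)).isSelfAdjoint.star_eq
  have h2 : W.adjoint (W x) = CFC.sqrt (W.adjoint ∘L W) (CFC.sqrt (W.adjoint ∘L W) x) :=
    (DFunLike.congr_fun (CFC.sqrt_mul_sqrt_self (W.adjoint ∘L W) hA) x).symm
  rw [← sq_eq_sq₀ (norm_nonneg _) (norm_nonneg _), ← inner_self_eq_norm_sq (𝕜 := ℂ),
    ← inner_self_eq_norm_sq (𝕜 := ℂ), ← ContinuousLinearMap.adjoint_inner_right W, h2]
  conv_rhs => rw [← ContinuousLinearMap.adjoint_inner_left, h1]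

end AbsSqrt

/-! ### Normal vectors of a representation of a von Neumann algebra -/

section NormalVector

variable {H : Type u} [NormedAddCommGroup H] [InnerProductSpace ℂ H] [CompleteSpace H]
  {K : Type*} [NormedAddCommGroup K] [InnerProductSpace ℂ K] [CompleteSpace K]

/-- The identity representation of a von Neumann algebra. -/
def coeRep (N : VonNeumannAlgebra H) : N →ₗ[ℂ] (H →L[ℂ] H) where
  toFun a := a
  map_add' _ _ := rfl
  map_smul' _ _ := rfl

theorem isStarRep_coeRep (N : VonNeumannAlgebra H) : IsStarRep (coeRep N) where
  map_one := rfl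
  map_mul _ _ := rfl
  map_star _ := rfl

variable {N : VonNeumannAlgebra H} {π : N →ₗ[ℂ] (K →L[ℂ] K)}

theorem IsStarRep.exists_intertwiner_of_seq (h : IsStarRep π) (ζ : Seq H) (u : K)
    (hu : ∀ b : N, ‖π b u‖ ≤ ‖ampl (b : H →L[ℂ] H) ζ‖) :
    ∃ W : Seq H →L[ℂ] K, (∀ b : N, W ∘L ampl (b : H →L[ℂ] H) = π b ∘L W) ∧ W ζ = u :=
  (isStarRep_coeRep N).amplify.exists_intertwiner h ζ u hu

/-- `u` is a normal vector of `π` if `‖π(b) u‖ = ‖(b ⊗ 1) ζ‖` for some `ζ ∈ ℓ²(ℕ, H)`. -/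
def IsNormalVector (π : N →ₗ[ℂ] (K →L[ℂ] K)) (u : K) : Prop :=
  ∃ ζ : Seq H, ∀ b : N, ‖π b u‖ = ‖ampl (b : H →L[ℂ] H) ζ‖

/-- Let `W` be the intertwiner with `W ζ = u`. Its absolute value `T` commutes with every `b ⊗ 1`,
so `‖π(b) u‖ = ‖W (b ⊗ 1) ζ‖ = ‖(b ⊗ 1) T ζ‖`. Thus an inequality can be upgraded to an equality by
replacing `ζ` with `T ζ`. -/
theorem IsNormalVector.of_le (h : IsStarRep π) {u : K} (ζ : Seq H)
    (hu : ∀ b : N, ‖π b u‖ ≤ ‖ampl (b : H →L[ℂ] H) ζ‖) : IsNormalVector π u := by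
  obtain ⟨W, hW, rfl⟩ := h.exists_intertwiner_of_seq ζ u hu
  obtain ⟨T, hT, hTc⟩ := exists_abs W
  have hW' : ∀ b : N, ampl (b : H →L[ℂ] H) ∘L W.adjoint = W.adjoint ∘L π b := by
    intro b
    have := congrArg ContinuousLinearMap.adjoint (hW (star b))
    rw [ContinuousLinearMap.adjoint_comp, ContinuousLinearMap.adjoint_comp, h.map_star,
      ContinuousLinearMap.adjoint_adjoint, ampl_adjoint] at this
    rw [← this]
    congr 2
    exact (ContinuousLinearMap.adjoint_adjoint (b : H →L[ℂ] H)).symm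
  have hcomm : ∀ b : N, Commute T (ampl (b : H →L[ℂ] H)) := by
    intro b
    refine hTc _ ?_
    change (W.adjoint ∘L W) ∘L ampl (b : H →L[ℂ] H) = ampl (b : H →L[ℂ] H) ∘L (W.adjoint ∘L W)
    rw [ContinuousLinearMap.comp_assoc, hW, ← ContinuousLinearMap.comp_assoc, ← hW',
      ContinuousLinearMap.comp_assoc]
  refine ⟨T ζ, fun b => ?_⟩
  have h1 : ampl (b : H →L[ℂ] H) (T ζ) = T (ampl (b : H →L[ℂ] H) ζ) :=
    (DFunLike.congr_fun (hcomm b).eq ζ).symm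
  have h2 : π b (W ζ) = W (ampl (b : H →L[ℂ] H) ζ) := (DFunLike.congr_fun (hW b) ζ).symm
  rw [h1, h2, hT]

/-- Rapidly convergent series of normal vectors are normal. -/
theorem IsNormalVector.of_hasSum (h : IsStarRep π) {u : K} {w : ℕ → K}
    (hw : ∀ k, IsNormalVector π (w k)) (hs : Summable fun k => 2 ^ k * ‖w k‖ ^ 2)
    (hu : HasSum w u) : IsNormalVector π u := by
  choose ζ hζ using hw
  have hn : ∀ k, ‖w k‖ = ‖ζ k‖ := by
    intro k
    have := hζ k 1
    rw [h.map_one] at this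
    rw [show ((1 : N) : H →L[ℂ] H) = 1 from rfl, ampl_one] at this
    simpa using this
  -- The weights come from Cauchy–Schwarz: `‖∑ π(b) w_k‖² ≤ (∑ 2^{-k}) (∑ 2^k ‖π(b) w_k‖²)`, and `∑
  -- 2^{-k} = 2`. The dominating vector is therefore built from the `ζ_k` scaled by the square root
  -- of `2 * 2^k`.
  have hpow : ∀ k : ℕ, (√2 * √(2 ^ k)) ^ 2 = (2 * 2 ^ k : ℝ) := fun k => by
    rw [mul_pow, Real.sq_sqrt (by positivity), Real.sq_sqrt (by positivity)]
  obtain ⟨z, hz⟩ := exists_merge (fun k => ((√2 * √(2 ^ k) : ℝ) : ℂ) • ζ k) (by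
    refine (hs.mul_left 2).congr fun k => ?_
    rw [norm_smul, mul_pow, Complex.norm_real, Real.norm_of_nonneg (by positivity), hpow, hn,
      mul_assoc])
  refine IsNormalVector.of_le h z fun b => ?_
  have hz' := hz b
  have hterm : ∀ k, ‖ampl (b : H →L[ℂ] H) (((√2 * √(2 ^ k) : ℝ) : ℂ) • ζ k)‖ ^ 2 =
      2 * (2 ^ k * ‖π b (w k)‖ ^ 2) := by
    intro k
    rw [map_smul, norm_smul, mul_pow, Complex.norm_real, Real.norm_of_nonneg (by positivity), hpow,
      hζ, mul_assoc]
  simp only [hterm] at hz'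
  refine le_of_sq_le_sq ?_ (norm_nonneg _)
  have hlim := ((π b).continuous.tendsto u).comp hu.tendsto_sum_nat
  refine le_of_tendsto (hlim.norm.pow 2) (Filter.Eventually.of_forall fun n => ?_)
  refine le_trans ?_ (sum_le_hasSum (Finset.range n) (fun k _ => by positivity) hz')
  simp only [Function.comp_apply, map_sum]
  have hcs := Finset.sum_mul_sq_le_sq_mul_sq (Finset.range n) (fun k => (√(2 ^ k) : ℝ)⁻¹)
    (fun k => √(2 ^ k) * ‖π b (w k)‖)
  have e1 : ∀ k : ℕ, (√(2 ^ k) : ℝ)⁻¹ * (√(2 ^ k) * ‖π b (w k)‖) = ‖π b (w k)‖ := fun k => by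
    have : (√(2 ^ k) : ℝ) ≠ 0 := by positivity
    field_simp
  have e2 : ∀ k : ℕ, ((√(2 ^ k) : ℝ)⁻¹) ^ 2 = (1 / 2) ^ k := fun k => by
    rw [inv_pow, Real.sq_sqrt (by positivity)]
    simp
  have e3 : ∀ k : ℕ, (√(2 ^ k) * ‖π b (w k)‖) ^ 2 = 2 ^ k * ‖π b (w k)‖ ^ 2 := fun k => by
    rw [mul_pow, Real.sq_sqrt (by positivity)]
  simp only [e1, e2, e3] at hcs
  calc ‖∑ k ∈ Finset.range n, π b (w k)‖ ^ 2
      ≤ (∑ k ∈ Finset.range n, ‖π b (w k)‖) ^ 2 := by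
        gcongr
        exact norm_sum_le _ _
    _ ≤ _ := hcs
    _ ≤ 2 * ∑ k ∈ Finset.range n, 2 ^ k * ‖π b (w k)‖ ^ 2 := by
        gcongr
        exact (Summable.sum_le_tsum _ (fun k _ => by positivity) summable_geometric_two).trans_eq
          tsum_geometric_two
    _ = _ := Finset.mul_sum _ _ _

/-- The normal vectors of a representation form a subspace. -/
def normalVectors (h : IsStarRep π) : Submodule ℂ K where
  carrier := {u | IsNormalVector π u}
  zero_mem' := ⟨0, fun b => by simp⟩
  smul_mem' := by
    rintro c u ⟨ζ, hζ⟩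
    refine ⟨c • ζ, fun b => ?_⟩
    rw [map_smul, map_smul, norm_smul, norm_smul, hζ]
  add_mem' := by
    rintro u v ⟨ζ, hζ⟩ ⟨ξ, hξ⟩
    -- The factors `√2` absorb the constant in `‖x + y‖² ≤ 2 ‖x‖² + 2 ‖y‖²`.
    obtain ⟨w, hw⟩ := exists_merge_two (((√2 : ℝ) : ℂ) • ζ) (((√2 : ℝ) : ℂ) • ξ)
    refine IsNormalVector.of_le h w fun b => ?_
    refine le_of_sq_le_sq ?_ (norm_nonneg _)
    rw [hw, map_smul, map_smul, norm_smul, norm_smul, ← hζ, ← hξ, mul_pow, mul_pow,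
      Complex.norm_real, Real.norm_of_nonneg (by positivity), Real.sq_sqrt (by positivity), map_add]
    have := norm_add_le (π b u) (π b v)
    nlinarith [sq_nonneg (‖π b u‖ - ‖π b v‖), norm_nonneg (π b u + π b v)]

theorem mem_normalVectors (h : IsStarRep π) {u : K} :
    u ∈ normalVectors h ↔ IsNormalVector π u := Iff.rfl

/-- A limit of normal vectors is a normal vector plus a telescoping series of normal vectors with
terms of size `2 * 2^{-k}`. This decay beats the weights `2^k` required by
`IsNormalVector.of_hasSum`. -/
theorem isClosed_normalVectors (h : IsStarRep π) : IsClosed (normalVectors h : Set K) := by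
  refine isClosed_of_closure_subset fun u hu => ?_
  have hex : ∀ k : ℕ, ∃ v ∈ normalVectors h, ‖u - v‖ < (1 / 2) ^ k := by
    intro k
    obtain ⟨v, hv, hd⟩ := Metric.mem_closure_iff.1 hu ((1 / 2) ^ k) (by positivity)
    exact ⟨v, hv, by rwa [← dist_eq_norm]⟩
  choose v hv hd using hex
  have hlim : Filter.Tendsto v Filter.atTop (nhds u) := by
    rw [tendsto_iff_norm_sub_tendsto_zero]
    refine squeeze_zero (fun _ => norm_nonneg _) (fun k => ?_)
      (tendsto_pow_atTop_nhds_zero_of_lt_one (by norm_num : (0:ℝ) ≤ 1 / 2) (by norm_num))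
    rw [norm_sub_rev]
    exact (hd k).le
  have hbd : ∀ k, ‖v (k + 1) - v k‖ ≤ 2 * (1 / 2) ^ k := by
    intro k
    have : v (k + 1) - v k = (u - v k) - (u - v (k + 1)) := by abel
    rw [this]
    refine (norm_sub_le _ _).trans ?_
    have h1 := hd k
    have h2 := hd (k + 1)
    rw [pow_succ] at h2
    have : (0 : ℝ) < (1 / 2) ^ k := by positivity
    linarith
  have hsum : HasSum (fun k => v (k + 1) - v k) (u - v 0) := by
    have hs : Summable fun k => v (k + 1) - v k :=
      Summable.of_norm_bounded (summable_geometric_two.mul_left 2) hbd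
    refine (hs.hasSum_iff_tendsto_nat).2 ?_
    simp only [Finset.sum_range_sub]
    exact hlim.sub_const _
  have : IsNormalVector π (u - v 0) := by
    refine IsNormalVector.of_hasSum h
      (fun k => (normalVectors h).sub_mem (hv (k + 1)) (hv k)) ?_ hsum
    refine Summable.of_nonneg_of_le (fun k => by positivity) (fun k => ?_)
      (summable_geometric_two.mul_left 4)
    calc (2 : ℝ) ^ k * ‖v (k + 1) - v k‖ ^ 2 ≤ 2 ^ k * (2 * (1 / 2) ^ k) ^ 2 := by
          gcongr
          exact hbd k
      _ = 4 * ((2 * (1 / 2)) ^ k * (1 / 2) ^ k) := by rw [mul_pow (2 : ℝ) (1 / 2) k]; ring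
      _ = 4 * (1 / 2) ^ k := by norm_num
  have h2 := (normalVectors h).add_mem this (hv 0)
  rwa [sub_add_cancel] at h2

/-- Matrix coefficients of normal vectors are `σ`-weakly continuous. -/
theorem IsNormalVector.continuous_inner (h : IsStarRep π) {v : K} (hv : IsNormalVector π v)
    (u : K) : @Continuous _ _ (sigmaWeakOn N) inferInstance fun b : N => ⟪u, π b v⟫_ℂ := by
  obtain ⟨ζ, hζ⟩ := hv
  obtain ⟨W, hW, rfl⟩ := h.exists_intertwiner_of_seq ζ v fun b => (hζ b).le
  have key : (fun b : N => ⟪u, π b (W ζ)⟫_ℂ) =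
      (fun x : H →L[ℂ] H => ∑' n, ⟪(W.adjoint u) n, x (ζ n)⟫_ℂ) ∘
        fun b : N => (b : H →L[ℂ] H) := by
    ext b
    have h2 : π b (W ζ) = W (ampl (b : H →L[ℂ] H) ζ) := (DFunLike.congr_fun (hW b) ζ).symm
    rw [h2, ← ContinuousLinearMap.adjoint_inner_left, lp.inner_eq_tsum]
    rfl
  rw [key]
  let _ := sigmaWeakOn N
  let _ := sigmaWeak H
  refine Continuous.comp (f := fun b : N => (b : H →L[ℂ] H)) ?_ continuous_induced_dom
  exact continuous_iInf_dom (i := ⟨(fun n => (W.adjoint u) n, fun n => ζ n),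
    (W.adjoint u).hasSum_sq.summable, ζ.hasSum_sq.summable⟩) continuous_induced_dom

theorem isNormalInto_iff {G : Type v} [NormedAddCommGroup G] [InnerProductSpace ℂ G]
    {φ : N → (G →L[ℂ] G)} : IsNormalInto N φ ↔ ∀ h k : ℕ → G, (Summable fun n => ‖h n‖ ^ 2) →
      (Summable fun n => ‖k n‖ ^ 2) →
      @Continuous _ _ (sigmaWeakOn N) inferInstance fun a => ∑' n, ⟪h n, φ a (k n)⟫_ℂ := by
  have : IsNormalInto N φ ↔ _ := continuous_iInf_rng (t₁ := sigmaWeakOn N)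
  rw [this]
  exact ⟨fun H h k hh hk => continuous_induced_rng.1 (H ⟨(h, k), hh, hk⟩),
    fun H p => continuous_induced_rng.2 (H _ _ p.2.1 p.2.2)⟩

/-- The positive part of a `σ`-weakly continuous functional is dominated by a vector of
`ℓ²(ℕ, H)`. -/
theorem exists_dominating (φ : N →ₗ[ℂ] ℂ)
    (hφ : @Continuous _ _ (sigmaWeakOn N) inferInstance φ) :
    ∃ ζ : Seq H, ∀ a : N, ‖φ (star a * a)‖ ≤ ‖ampl (a : H →L[ℂ] H) ζ‖ ^ 2 := by
  let _ := sigmaWeakOn N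
  set ι := {p : (ℕ → H) × (ℕ → H) //
      (Summable fun n => ‖p.1 n‖ ^ 2) ∧ Summable fun n => ‖p.2 n‖ ^ 2}
  set f : ι → N → ℂ := fun p a => ∑' n, ⟪p.1.1 n, (a : H →L[ℂ] H) (p.1.2 n)⟫_ℂ with hf
  have hnhds : nhds (0 : N) = ⨅ p : ι, (nhds (f p 0)).comap (f p) := by
    rw [@nhds_induced _ _ (sigmaWeak H) (fun a : N => (a : H →L[ℂ] H)) 0, nhds_iInf,
      Filter.comap_iInf]
    refine iInf_congr fun p => ?_
    rw [nhds_induced, Filter.comap_comap]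
    rfl
  have hf0 : ∀ p, f p 0 = 0 := fun p => by simp [hf]
  have hfs : ∀ p (c : ℂ) (a : N), f p (c • a) = c * f p a := by
    intro p c a
    simp only [hf]
    rw [← tsum_mul_left]
    refine tsum_congr fun n => ?_
    rw [← inner_smul_right]
    rfl
  have hball : φ ⁻¹' (Metric.ball 0 1) ∈ nhds (0 : N) :=
    hφ.continuousAt.preimage_mem_nhds (by rw [map_zero]; exact Metric.ball_mem_nhds _ one_pos)
  rw [hnhds, Filter.mem_iInf'] at hball
  obtain ⟨I, hI, V, hV, -, hV', -⟩ := hball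
  have hε : ∀ p, ∃ ε > 0, ∀ a : N, ‖f p a‖ < ε → a ∈ V p := by
    intro p
    obtain ⟨U, hU, hUV⟩ := hV p
    rw [hf0] at hU
    obtain ⟨ε, hε, hb⟩ := Metric.mem_nhds_iff.1 hU
    exact ⟨ε, hε, fun a ha => hUV (hb (by simpa using ha))⟩
  choose ε hε hεV using hε
  -- Continuity at `0` involves only finitely many of the functionals `f p`, because the topology is
  -- an initial one.
  have hsub : ∀ a : N, (∀ p ∈ hI.toFinset, ‖f p a‖ < ε p) → ‖φ a‖ < 1 := by
    intro a ha
    have : a ∈ φ ⁻¹' (Metric.ball 0 1) := by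
      rw [hV', Set.mem_iInter₂]
      exact fun p hp => hεV p a (ha p (hI.mem_toFinset.2 hp))
    simpa using this
  generalize hI.toFinset = J at hsub
  have hbound : ∀ a : N, ‖φ a‖ ≤ ∑ p ∈ J, (ε p)⁻¹ * ‖f p a‖ := by
    intro a
    have hnn : ∀ p, 0 ≤ (ε p)⁻¹ * ‖f p a‖ := fun p =>
      mul_nonneg (inv_nonneg.2 (hε p).le) (norm_nonneg _)
    -- Homogeneity: for `r` above the right-hand side, `r⁻¹ • a` lies in the basic neighbourhood on
    -- which `‖φ‖ < 1`.
    refine le_of_forall_gt_imp_ge_of_dense fun r hr => ?_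
    have hr0 : 0 < r := (Finset.sum_nonneg fun p _ => hnn p).trans_lt hr
    have := hsub (((r⁻¹ : ℝ) : ℂ) • a) fun p hp => by
      rw [hfs, norm_mul, Complex.norm_real, Real.norm_of_nonneg (by positivity)]
      have h1 := (Finset.single_le_sum (fun p _ => hnn p) hp).trans_lt hr
      rw [inv_mul_lt_iff₀ (hε p)] at h1
      rw [inv_mul_lt_iff₀ hr0, mul_comm]
      exact h1
    rw [map_smul, norm_smul, Complex.norm_real, Real.norm_of_nonneg (by positivity),
      inv_mul_lt_iff₀ hr0, mul_one] at this
    exact this.le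
  -- On `a^* a` the functional given by the sequences `h`, `k` equals `⟨(a ⊗ 1) h, (a ⊗ 1) k⟩`,
  -- which is at most `‖(a ⊗ 1) h‖² + ‖(a ⊗ 1) k‖²` in modulus. The constant `(ε p)⁻¹` is absorbed
  -- as a square root into both vectors.
  have hone : ∀ p, ∃ ζ : Seq H, ∀ a : N,
      (ε p)⁻¹ * ‖f p (star a * a)‖ ≤ ‖ampl (a : H →L[ℂ] H) ζ‖ ^ 2 := by
    rintro ⟨⟨h, k⟩, hh, hk⟩
    set p : ι := ⟨⟨h, k⟩, hh, hk⟩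
    obtain ⟨w, hw⟩ := exists_merge_two (((√((ε p)⁻¹) : ℝ) : ℂ) • Seq.mk h hh)
      (((√((ε p)⁻¹) : ℝ) : ℂ) • Seq.mk k hk)
    refine ⟨w, fun a => ?_⟩
    have hεp := inv_pos.2 (hε p)
    rw [hw, map_smul, map_smul, norm_smul, norm_smul, mul_pow, mul_pow, Complex.norm_real,
      Real.norm_of_nonneg (by positivity), Real.sq_sqrt hεp.le, ← mul_add]
    gcongr
    have e : f p (star a * a) = ⟪ampl (a : H →L[ℂ] H) (Seq.mk h hh),
        ampl (a : H →L[ℂ] H) (Seq.mk k hk)⟫_ℂ := by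
      rw [lp.inner_eq_tsum]
      refine tsum_congr fun n => ?_
      rw [ampl_apply, ampl_apply, ← ContinuousLinearMap.adjoint_inner_right]
      rfl
    rw [e]
    refine (norm_inner_le_norm _ _).trans ?_
    nlinarith [sq_nonneg (‖ampl (a : H →L[ℂ] H) (Seq.mk h hh)‖ -
      ‖ampl (a : H →L[ℂ] H) (Seq.mk k hk)‖), sq_nonneg (‖ampl (a : H →L[ℂ] H) (Seq.mk h hh)‖),
      sq_nonneg (‖ampl (a : H →L[ℂ] H) (Seq.mk k hk)‖)]
  choose ζ hζ using hone
  obtain ⟨w, hw⟩ := exists_merge (fun p : J => ζ p) Summable.of_finite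
  refine ⟨w, fun a => (hbound _).trans ?_⟩
  rw [← (hw a).tsum_eq, tsum_fintype, ← Finset.sum_coe_sort J]
  exact Finset.sum_le_sum fun p _ => hζ p a

end NormalVector

/-! ### Coordinate embeddings into `ℓ²(ℕ, H)`. -/

section Single

variable {H : Type u} [NormedAddCommGroup H] [InnerProductSpace ℂ H]

/-- The `n`-th coordinate embedding `H → ℓ²(ℕ, H)`. -/
abbrev Seq.single (n : ℕ) : H →L[ℂ] Seq H :=
  lp.singleContinuousLinearMap ℂ (fun _ : ℕ => H) 2 n

theorem ampl_single {K : Type v} [NormedAddCommGroup K] [InnerProductSpace ℂ K]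
    (a : H →L[ℂ] K) (n : ℕ) (h : H) : ampl a (Seq.single n h) = Seq.single n (a h) := by
  ext m
  rw [ampl_apply, lp.singleContinuousLinearMap_apply, lp.singleContinuousLinearMap_apply]
  by_cases hm : n = m
  · subst hm
    rw [lp.single_apply_self, lp.single_apply_self]
  · rw [lp.single_apply_ne _ _ _ (Ne.symm hm), lp.single_apply_ne _ _ _ (Ne.symm hm), map_zero]

theorem norm_single (n : ℕ) (h : H) : ‖Seq.single n h‖ = ‖h‖ := by
  rw [lp.singleContinuousLinearMap_apply]
  exact lp.norm_single (E := fun _ : ℕ => H) two_pos n h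

theorem Seq.hasSum_single (z : Seq H) : HasSum (fun n => Seq.single n (z n)) z :=
  lp.hasSum_single (by simp) z

end Single

/-! ### σ-weak continuity of `a ↦ f^* a g`. -/

section Continuity

variable {H : Type u} [NormedAddCommGroup H] [InnerProductSpace ℂ H] [CompleteSpace H]

theorem isNormalInto_coe (N : VonNeumannAlgebra H) :
    IsNormalInto N fun a => (a : H →L[ℂ] H) := by
  let _ := sigmaWeak H
  exact continuous_induced_dom

theorem isNormalInto_star_mul_mul (N : VonNeumannAlgebra H) (f g : N) :
    IsNormalInto N fun a => ((star f * (a * g) : N) : H →L[ℂ] H) := by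
  refine isNormalInto_iff.2 fun h k hh hk => ?_
  have := isNormalInto_iff.1 (isNormalInto_coe N) (fun n => (f : H →L[ℂ] H) (h n))
    (fun n => (g : H →L[ℂ] H) (k n)) (summable_sq_map (f : H →L[ℂ] H) (Seq.mk h hh))
    (summable_sq_map (g : H →L[ℂ] H) (Seq.mk k hk))
  convert this using 4 with a n
  exact (f : H →L[ℂ] H).adjoint_inner_right _ _

end Continuity

namespace CPSemigroup

variable {H : Type u} [NormedAddCommGroup H] [InnerProductSpace ℂ H] [CompleteSpace H]
  {M : VonNeumannAlgebra H} (P : CPSemigroup M)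

/-! ### Total sets in `H_t` -/

theorem mem_of_forall_tens {t : ℝ≥0} {S : Submodule ℂ (P.Ht t)} (hS : IsClosed (S : Set (P.Ht t)))
    (h : ∀ x k, P.tens x k ∈ S) (u : P.Ht t) : u ∈ S :=
  (P.kernel t).induction_tens (p := fun u => u ∈ S) hS
    (fun _ v => S.sum_mem fun x _ => h x (v x)) u

theorem ext_inner_tens {t : ℝ≥0} {u v : P.Ht t}
    (h : ∀ x k, ⟪P.tens x k, u⟫_ℂ = ⟪P.tens x k, v⟫_ℂ) : u = v := by
  refine ext_inner_left ℂ fun w => ?_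
  refine (P.kernel t).induction_tens (p := fun w => ⟪w, u⟫_ℂ = ⟪w, v⟫_ℂ)
    (isClosed_eq (by fun_prop) (by fun_prop)) (fun _ f => ?_) w
  rw [sum_inner, sum_inner]
  exact Finset.sum_congr rfl fun x _ => h x _

/-! ### The representations of `M` and `M'` on `H_t` -/

theorem inner_leftAct_leftAct {t : ℝ≥0} (a b : M) (x y : Tensor M t) (h k : H) :
    ⟪P.tens x h, P.leftAct t a (P.leftAct t b (P.tens y k))⟫_ℂ =
      ⟪h, (P.gram x y (a * b) : H →L[ℂ] H) k⟫_ℂ := by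
  rw [← ContinuousLinearMap.adjoint_inner_left, adjoint_leftAct, leftAct_tens, leftAct_tens,
    inner_leftTens, star_star]

/-- The representation of `M` on `H_t`. -/
def leftRep (t : ℝ≥0) : M →ₗ[ℂ] (P.Ht t →L[ℂ] P.Ht t) where
  toFun := P.leftAct t
  map_add' a b := by
    refine (P.kernel t).ext_tens fun y k => P.ext_inner_tens fun x h => ?_
    rw [add_apply, inner_add_right, inner_leftAct, inner_leftAct, inner_leftAct,
      map_add, ← inner_add_right]
    rfl
  map_smul' c a := by
    refine (P.kernel t).ext_tens fun y k => P.ext_inner_tens fun x h => ?_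
    rw [smul_apply, inner_smul_right, inner_leftAct, RingHom.id_apply,
      inner_leftAct, map_smul, ← inner_smul_right]
    rfl

theorem isStarRep_leftRep (t : ℝ≥0) : IsStarRep (P.leftRep t) where
  map_one := (P.kernel t).ext_tens fun x h => by
    change P.leftAct t 1 (P.tens x h) = P.tens x h
    rw [leftAct_tens, leftTens_one]
  map_mul a b := (P.kernel t).ext_tens fun y k => P.ext_inner_tens fun x h => by
    change ⟪P.tens x h, P.leftAct t (a * b) (P.tens y k)⟫_ℂ =
      ⟪P.tens x h, P.leftAct t a (P.leftAct t b (P.tens y k))⟫_ℂ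
    rw [inner_leftAct_leftAct, inner_leftAct]
  map_star a := (P.adjoint_leftAct a).symm

theorem adjoint_commutantAct {t : ℝ≥0} (b : M.commutant) :
    (P.commutantAct t b).adjoint = P.commutantAct t (star b) := by
  refine (P.kernel t).ext_tens fun y k => P.ext_inner_tens fun x h => ?_
  rw [ContinuousLinearMap.adjoint_inner_right]
  change ⟪P.commutantAct t b (P.tens x h), P.tens y k⟫_ℂ =
    ⟪P.tens x h, P.commutantAct t (star b) (P.tens y k)⟫_ℂ
  rw [commutantAct_tens, commutantAct_tens, inner_tens, inner_tens]
  have h1 := DFunLike.congr_fun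
    ((VonNeumannAlgebra.mem_commutant_iff.1 (star b).2) _ (P.gram x y 1).2) k
  exact ((b : H →L[ℂ] H).adjoint_inner_right h _).symm.trans
    (congrArg (fun z => ⟪h, z⟫_ℂ) h1.symm)

/-- The representation of `M'` on `H_t`. -/
def commutantRep (t : ℝ≥0) : M.commutant →ₗ[ℂ] (P.Ht t →L[ℂ] P.Ht t) where
  toFun := P.commutantAct t
  map_add' a b := (P.kernel t).ext_tens fun x h => by
    change P.commutantAct t (a + b) (P.tens x h) =
      P.commutantAct t a (P.tens x h) + P.commutantAct t b (P.tens x h)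
    rw [commutantAct_tens, commutantAct_tens, commutantAct_tens, ← map_add]
    rfl
  map_smul' c a := (P.kernel t).ext_tens fun x h => by
    change P.commutantAct t (c • a) (P.tens x h) = c • P.commutantAct t a (P.tens x h)
    rw [commutantAct_tens, commutantAct_tens, ← map_smul]
    rfl

theorem isStarRep_commutantRep (t : ℝ≥0) : IsStarRep (P.commutantRep t) where
  map_one := (P.kernel t).ext_tens fun x h => by
    change P.commutantAct t 1 (P.tens x h) = P.tens x h
    rw [commutantAct_tens]
    rfl
  map_mul a b := (P.kernel t).ext_tens fun x h => by
    change P.commutantAct t (a * b) (P.tens x h) =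
      P.commutantAct t a (P.commutantAct t b (P.tens x h))
    rw [commutantAct_tens, commutantAct_tens, commutantAct_tens]
    rfl
  map_star a := (P.adjoint_commutantAct a).symm

/-! ### Normality -/

/-- The only place where normality of the maps `P_t` enters: a chain is a composition of the maps
`P_r` with two-sided multiplications. -/
theorem isNormalInto_chain (f g : ℝ≥0 → M) (l : List ℝ≥0) : ∀ a : ℝ≥0,
    IsNormalInto M fun A => (P.chain f g a l A : H →L[ℂ] H) := by
  induction l with
  | nil => exact fun _ => isNormalInto_coe M
  | cons b l ih =>
    intro a
    let _ := sigmaWeakOn M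
    let _ := sigmaWeak H
    have h1 : @Continuous _ _ (sigmaWeakOn M) (sigmaWeakOn M) fun A : M => star (f a) * (A * g a) :=
      continuous_induced_rng.2 (isNormalInto_star_mul_mul M (f a) (g a))
    have h2 : @Continuous _ _ (sigmaWeakOn M) (sigmaWeakOn M) (P.toFun (b - a)) :=
      continuous_induced_rng.2 (P.normal (b - a))
    have h3 : @Continuous _ _ (sigmaWeakOn M) (sigmaWeakOn M)
        fun A : M => P.toFun (b - a) (star (f a) * (A * g a)) :=
      @Continuous.comp _ _ _ (sigmaWeakOn M) (sigmaWeakOn M) (sigmaWeakOn M) _ _ h2 h1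
    exact @Continuous.comp _ _ _ (sigmaWeakOn M) (sigmaWeakOn M) (sigmaWeak H) _
      (fun A => (P.chain f g b l A : H →L[ℂ] H)) (ih b) h3

/-- `‖a·(x ⊗ h)‖²` is the value at `a^* a` of the functional `⟨h, gram x x (·) h⟩`, to which
`exists_dominating` applies. -/
theorem exists_dominating_tens {t : ℝ≥0} (x : Tensor M t) (h : H) :
    ∃ ζ : Seq H, ∀ a : M, ‖P.leftRep t a (P.tens x h)‖ ≤ ‖ampl (a : H →L[ℂ] H) ζ‖ := by
  let φ : M →ₗ[ℂ] ℂ :=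
    { toFun := fun a => ⟪h, (P.gram x x a : H →L[ℂ] H) h⟫_ℂ
      map_add' := fun a b => by rw [map_add, ← inner_add_right]; rfl
      map_smul' := fun c a => by
        rw [map_smul, RingHom.id_apply, smul_eq_mul, ← inner_smul_right]; rfl }
  have hφ : @Continuous _ _ (sigmaWeakOn M) inferInstance φ := by
    -- A single vector functional is treated as a σ-weak one by means of a sequence supported at
    -- `0`.
    have hs : Summable fun n : ℕ => ‖(Seq.single 0 h : Seq H) n‖ ^ 2 :=
      (Seq.hasSum_sq _).summable
    have := isNormalInto_iff.1 (P.isNormalInto_chain x.val x.val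
      (((x.part.sup x.part).nodes.erase 0).sort (· ≤ ·)) 0) _ _ hs hs
    convert this using 2 with a
    have h1 := lp.inner_eq_tsum (𝕜 := ℂ) (Seq.single 0 h)
      (ampl (P.gram x x a : H →L[ℂ] H) (Seq.single 0 h))
    refine Eq.trans ?_ h1
    rw [ampl_single, lp.singleContinuousLinearMap_apply, lp.inner_single_left,
      lp.singleContinuousLinearMap_apply, lp.single_apply_self]
    rfl
  obtain ⟨ζ, hζ⟩ := exists_dominating φ hφ
  refine ⟨ζ, fun a => le_of_sq_le_sq ((le_of_eq ?_).trans (hζ a)) (norm_nonneg _)⟩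
  have h1 : ⟪P.leftTens a x h, P.leftTens a x h⟫_ℂ = φ (star a * a) := P.inner_leftTens a a x x h h
  rw [← h1, inner_self_eq_norm_sq_to_K]
  change ‖P.leftAct t a (P.tens x h)‖ ^ 2 = _
  rw [leftAct_tens]
  simp

/-- The vectors `X h` with `X ∈ E(t)` are total in `H_t`. -/
theorem mem_of_forall_E {t : ℝ≥0} {S : Submodule ℂ (P.Ht t)} (hS : IsClosed (S : Set (P.Ht t)))
    (h : ∀ (X : P.E t) k, X.1 k ∈ S) (u : P.Ht t) : u ∈ S := by
  refine P.mem_of_forall_tens hS (fun x k => ?_) u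
  obtain ⟨ζ, hζ⟩ := P.exists_dominating_tens x k
  obtain ⟨W, hW, hu⟩ := (P.isStarRep_leftRep t).exists_intertwiner_of_seq ζ _ hζ
  rw [← hu]
  -- `x ⊗ k = W ζ` is the sum of the vectors `W e_n ζ_n`, where `e_n` denotes the coordinate
  -- embeddings; each `W e_n` is `M`-linear, hence in `E(t)`.
  have hsum := (Seq.hasSum_single ζ).map W W.continuous
  refine hS.mem_of_tendsto hsum (Filter.Eventually.of_forall fun s => S.sum_mem fun n _ => ?_)
  refine h ⟨W ∘L Seq.single n, fun a => ?_⟩ (ζ n)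
  ext k
  change W (Seq.single n ((a : H →L[ℂ] H) k)) = P.leftRep t a (W (Seq.single n k))
  rw [← ampl_single]
  exact DFunLike.congr_fun (hW a) _

/-- All vectors of `ℓ²(ℕ, H_t)` are normal for the action of `M'`. -/
theorem isNormalVector_ampl_commutantRep {t : ℝ≥0} (z : Seq (P.Ht t)) :
    IsNormalVector (ampl ∘ₗ P.commutantRep t) z := by
  have hr := (P.isStarRep_commutantRep t).amplify
  have hcl := isClosed_normalVectors hr
  rw [← mem_normalVectors hr]
  refine hcl.mem_of_tendsto (Seq.hasSum_single z) (Filter.Eventually.of_forall fun s =>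
    Submodule.sum_mem _ fun n _ => ?_)
  refine P.mem_of_forall_tens (S := (normalVectors hr).comap (Seq.single n).toLinearMap)
    (hcl.preimage (Seq.single n).continuous) (fun x k => ?_) (z n)
  -- `M'` acts on the last factor, so `‖b·(x ⊗ k)‖ = ‖x ⊗ b k‖` is at most the norm of the operator
  -- `x ⊗ ·` times `‖b k‖`.
  refine IsNormalVector.of_le hr (((‖P.tens x‖ : ℝ) : ℂ) • Seq.single 0 k) fun b => ?_
  change ‖ampl (P.commutantAct t b) (Seq.single n (P.tens x k))‖ ≤ _
  rw [ampl_single, norm_single, map_smul, norm_smul, ampl_single, norm_single, commutantAct_tens,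
    Complex.norm_real]
  refine ((P.tens x).le_opNorm _).trans_eq ?_
  congr 1
  exact (norm_norm _).symm

/-- A whole σ-weak functional, with its two sequences, is one matrix coefficient of the amplified
representation at `(X ⊗ 1) h` and `(Y ⊗ 1) k`. This is why normality of vectors is established in
`ℓ²(ℕ, H_t)` and not just in `H_t`. -/
theorem isNormalInto_adjoint_commutantAct {t : ℝ≥0} (X Y : H →L[ℂ] P.Ht t) :
    IsNormalInto M.commutant fun a => X.adjoint ∘L P.commutantAct t a ∘L Y := by
  refine isNormalInto_iff.2 fun h k hh hk => ?_
  have := (P.isNormalVector_ampl_commutantRep (ampl Y (Seq.mk k hk))).continuous_inner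
    (P.isStarRep_commutantRep t).amplify (ampl X (Seq.mk h hh))
  convert this using 2 with a
  rw [lp.inner_eq_tsum]
  exact tsum_congr fun n => X.adjoint_inner_right _ _

end CPSemigroup

/-! ### Cutting a tensor over `[0, t + s]` at the time `s`. -/

namespace Tensor

variable {H : Type u} [NormedAddCommGroup H] [InnerProductSpace ℂ H] [CompleteSpace H]
  {M : VonNeumannAlgebra H} {t s : ℝ≥0}

/-- The restriction of a tensor over a partition of `[0, t + s]` to `[0, s]`. -/
def head (z : Tensor M (t + s)) : Tensor M s where
  part :=
    -- The cutting point `s` need not be a node of the given partition.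
    { nodes := insert s (z.part.nodes.filter (· ≤ s))
      zero_mem := Finset.mem_insert_of_mem (Finset.mem_filter.2 ⟨z.part.zero_mem, zero_le⟩)
      right_mem := Finset.mem_insert_self _ _
      le_right := fun r hr => by
        rcases Finset.mem_insert.1 hr with rfl | hr
        · exact le_rfl
        · exact (Finset.mem_filter.1 hr).2 }
  -- Factors are stored at left endpoints, so the factor at `s` belongs to the tail.
  val r := if r < s then z.val r else 1
  val_eq_one r hr := by
    split_ifs with h
    · refine z.val_eq_one r fun h' => hr (Finset.mem_erase.2 ⟨h.ne, ?_⟩)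
      exact Finset.mem_insert_of_mem (Finset.mem_filter.2 ⟨Finset.mem_of_mem_erase h', h.le⟩)
    · rfl

/-- The restriction of a tensor over a partition of `[0, t + s]` to `[s, t + s]`, shifted by `s`. -/
def tail (z : Tensor M (t + s)) : Tensor M t where
  part :=
    { nodes := insert 0 ((z.part.nodes.filter (s ≤ ·)).image (· - s))
      zero_mem := Finset.mem_insert_self _ _
      right_mem := Finset.mem_insert_of_mem (Finset.mem_image.2 ⟨t + s,
        Finset.mem_filter.2 ⟨z.part.right_mem, le_add_self⟩, add_tsub_cancel_right t s⟩)
      le_right := fun r hr => by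
        rcases Finset.mem_insert.1 hr with rfl | hr
        · exact zero_le
        · obtain ⟨q, hq, rfl⟩ := Finset.mem_image.1 hr
          exact tsub_le_iff_right.2 (z.part.le_right q (Finset.mem_filter.1 hq).1) }
  val r := z.val (r + s)
  val_eq_one r hr := by
    refine z.val_eq_one _ fun h' => hr (Finset.mem_erase.2 ⟨?_, ?_⟩)
    · rintro rfl
      exact Finset.ne_of_mem_erase h' rfl
    · exact Finset.mem_insert_of_mem (Finset.mem_image.2 ⟨r + s,
        Finset.mem_filter.2 ⟨Finset.mem_of_mem_erase h', le_add_self⟩, add_tsub_cancel_right r s⟩)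

theorem concat_head_tail_val (z : Tensor M (t + s)) : (z.head.concat z.tail).val = z.val := by
  ext1 r
  by_cases h : r < s
  · simp [concat, head, h]
  · simp [concat, tail, h, tsub_add_cancel_of_le (not_lt.1 h)]

/-- Cutting may add the node `s`, so the reassembled tensor is in general only a refinement. By
`tens_refine` it still defines the same vectors. -/
theorem nodes_subset_concat_head_tail (z : Tensor M (t + s)) :
    z.part.nodes ⊆ (z.head.concat z.tail).part.nodes := by
  intro r hr
  change r ∈ z.head.part.nodes ∪ z.tail.part.nodes.image (· + s)
  rcases le_total r s with h | h
  · exact Finset.mem_union_left _ (Finset.mem_insert_of_mem (Finset.mem_filter.2 ⟨hr, h⟩))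
  · refine Finset.mem_union_right _ (Finset.mem_image.2 ⟨r - s, ?_, tsub_add_cancel_of_le h⟩)
    exact Finset.mem_insert_of_mem (Finset.mem_image.2 ⟨r, Finset.mem_filter.2 ⟨hr, h⟩, rfl⟩)

end Tensor

/-! ### Algebra and totality of the operators `I_s ⊗ X`. -/

namespace CPSemigroup

variable {H : Type u} [NormedAddCommGroup H] [InnerProductSpace ℂ H] [CompleteSpace H]
  {M : VonNeumannAlgebra H} (P : CPSemigroup M)

theorem concatLeft_head_tail {t s : ℝ≥0} (z : Tensor M (t + s)) (h : H) :
    P.concatLeft t z.head (P.tens z.tail h) = P.tens z h := by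
  rw [concatLeft_tens, P.tens_refine z _ z.nodes_subset_concat_head_tail
    z.concat_head_tail_val.symm]

theorem commute_coe (a : M) (b : M.commutant) (h : H) :
    (a : H →L[ℂ] H) ((b : H →L[ℂ] H) h) = (b : H →L[ℂ] H) ((a : H →L[ℂ] H) h) :=
  DFunLike.congr_fun (VonNeumannAlgebra.mem_commutant_iff.1 b.2 _ a.2) h

/-- The `M'`-valued inner product `X^* Y` on `E(t)`. -/
def ip {t : ℝ≥0} (X Y : P.E t) : M.commutant := ⟨X.1.adjoint ∘L Y.1, P.adjoint_comp_mem X Y⟩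

theorem inner_E_apply {t : ℝ≥0} (X Y : P.E t) (h k : H) :
    ⟪X.1 h, Y.1 k⟫_ℂ = ⟪h, (P.ip X Y : H →L[ℂ] H) k⟫_ℂ :=
  (X.1.adjoint_inner_right h _).symm

theorem commutantAct_concatLeft {t s : ℝ≥0} (b : M.commutant) (x : Tensor M s) (u : P.Ht t) :
    P.commutantAct (t + s) b (P.concatLeft t x u) =
      P.concatLeft t x (P.commutantAct t b u) := by
  have : P.commutantAct (t + s) b ∘L P.concatLeft t x =
      P.concatLeft t x ∘L P.commutantAct t b := by
    refine (P.kernel t).ext_tens fun y h => ?_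
    simp only [ContinuousLinearMap.comp_apply]
    rw [concatLeft_tens, commutantAct_tens, commutantAct_tens, concatLeft_tens]
  exact DFunLike.congr_fun this u

/-- The operator form of the balancing relation `X·b ⊗ η = X ⊗ b·η`. The element `X·b` enters as a
separate `Y` with an equation, which leaves its membership proof in `E(t)` unspecified. -/
theorem idTensOp_comp_commutantAct {t s : ℝ≥0} (X : P.E t) (b : M.commutant)
    (Y : P.E t) (hY : Y.1 = X.1 ∘L (b : H →L[ℂ] H)) :
    P.idTensOp s X ∘L P.commutantAct s b = P.idTensOp s Y := by
  refine (P.kernel s).ext_tens fun x h => ?_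
  rw [ContinuousLinearMap.comp_apply, commutantAct_tens, idTensOp_tens, idTensOp_tens, hY]
  rfl

theorem commutantAct_comp_idTensOp {t s : ℝ≥0} (X : P.E t) (b : M.commutant)
    (Y : P.E t) (hY : Y.1 = P.commutantAct t b ∘L X.1) :
    P.commutantAct (t + s) b ∘L P.idTensOp s X = P.idTensOp s Y := by
  refine (P.kernel s).ext_tens fun x h => ?_
  rw [ContinuousLinearMap.comp_apply, idTensOp_tens, idTensOp_tens, hY, commutantAct_concatLeft]
  rfl

theorem idTensOp_add {t s : ℝ≥0} (X Y : P.E t) :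
    P.idTensOp s (X + Y) = P.idTensOp s X + P.idTensOp s Y := by
  refine (P.kernel s).ext_tens fun x h => ?_
  rw [add_apply, idTensOp_tens, idTensOp_tens, idTensOp_tens, ← map_add]
  rfl

theorem idTensOp_smul {t s : ℝ≥0} (c : ℂ) (X : P.E t) :
    P.idTensOp s (c • X) = c • P.idTensOp s X := by
  refine (P.kernel s).ext_tens fun x h => ?_
  rw [smul_apply, idTensOp_tens, idTensOp_tens, ← map_smul]
  rfl

/-- `⟨x ⊗ X h, y ⊗ Y k⟩ = ⟨X h, gram(x, y)·Y k⟩`. As `Y` is `M`-linear, `gram(x, y) ∈ M` moves to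
`k`, and then it commutes with `X^* Y ∈ M'`. All inner products in `E(t + s)` follow from this. -/
theorem adjoint_idTensOp_comp {t s : ℝ≥0} (X Y : P.E t) :
    (P.idTensOp s X).adjoint ∘L P.idTensOp s Y = P.commutantAct s (P.ip X Y) := by
  refine (P.kernel s).ext_tens fun y k => P.ext_inner_tens fun x h => ?_
  rw [ContinuousLinearMap.comp_apply, ContinuousLinearMap.adjoint_inner_right, idTensOp_tens,
    idTensOp_tens, inner_concatLeft, commutantAct_tens, inner_tens, ← E_apply, inner_E_apply,
    commute_coe]

/-- The vectors `(I_s ⊗ X) Y h` are total in `H_{t+s}`. -/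
theorem mem_of_forall_idTensOp {t s : ℝ≥0} {S : Submodule ℂ (P.Ht (t + s))}
    (hS : IsClosed (S : Set (P.Ht (t + s))))
    (h : ∀ (X : P.E t) (Y : P.E s) k, P.idTensOp s X (Y.1 k) ∈ S) (u : P.Ht (t + s)) : u ∈ S := by
  have h1 : ∀ (X : P.E t) (w : P.Ht s), P.idTensOp s X w ∈ S := fun X =>
    P.mem_of_forall_E (S := S.comap (P.idTensOp s X).toLinearMap)
      (hS.preimage (P.idTensOp s X).continuous) fun Y k => h X Y k
  -- `(I_s ⊗ X)(x ⊗ k)` is also `x ⊗ X k`, and the vectors `X k` are total in `H_t`. So `S` contains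
  -- all `x ⊗ w`, in particular every tensor cut into head and tail.
  have h2 : ∀ (x : Tensor M s) (w : P.Ht t), P.concatLeft t x w ∈ S := fun x =>
    P.mem_of_forall_E (S := S.comap (P.concatLeft t x).toLinearMap)
      (hS.preimage (P.concatLeft t x).continuous) fun X k => by
        have := h1 X (P.tens x k)
        rwa [idTensOp_tens] at this
  refine P.mem_of_forall_tens hS (fun z k => ?_) u
  rw [← concatLeft_head_tail]
  exact h2 _ _

/-! ### The isometries `ι_t` -/

theorem adjoint_iota_comp_iota (t : ℝ≥0) : (P.iota t).adjoint ∘L P.iota t = 1 := by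
  ext h
  refine ext_inner_left ℂ fun k => ?_
  rw [ContinuousLinearMap.comp_apply, ContinuousLinearMap.adjoint_inner_right, inner_iota]
  rfl

theorem norm_iota_le (t : ℝ≥0) : ‖P.iota t‖ ≤ 1 := by
  refine ContinuousLinearMap.opNorm_le_bound _ zero_le_one fun h => ?_
  refine le_of_sq_le_sq ?_ (by positivity)
  rw [one_mul, ← inner_self_eq_norm_sq (𝕜 := ℂ), inner_iota, inner_self_eq_norm_sq]

theorem adjoint_iota_tens {t : ℝ≥0} (x : Tensor M t) (h : H) :
    (P.iota t).adjoint (P.tens x h) = (P.gram (Tensor.one M t) x 1 : H →L[ℂ] H) h := by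
  refine ext_inner_left ℂ fun k => ?_
  rw [ContinuousLinearMap.adjoint_inner_right, iota, inner_tens]

theorem commutantAct_iota {t : ℝ≥0} (b : M.commutant) (h : H) :
    P.commutantAct t b (P.iota t h) = P.iota t ((b : H →L[ℂ] H) h) := P.commutantAct_tens _ _ _

theorem adjoint_iota_commutantAct {t : ℝ≥0} (b : M.commutant) :
    (P.iota t).adjoint ∘L P.commutantAct t b = (b : H →L[ℂ] H) ∘L (P.iota t).adjoint := by
  ext u
  refine ext_inner_left ℂ fun h => ?_
  simp only [ContinuousLinearMap.comp_apply]
  rw [ContinuousLinearMap.adjoint_inner_right, ← ContinuousLinearMap.adjoint_inner_left,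
    adjoint_commutantAct, commutantAct_iota, ← ContinuousLinearMap.adjoint_inner_right]
  exact (b : H →L[ℂ] H).adjoint_inner_left _ _

/-- `I ⊗ I`, cut at `s`, refines the tensor `I` over `{0, t + s}`. -/
theorem concatLeft_iota {t s : ℝ≥0} (h : H) :
    P.concatLeft t (Tensor.one M s) (P.iota t h) = P.iota (t + s) h := by
  unfold iota
  rw [concatLeft_tens]
  refine (DFunLike.congr_fun (P.tens_refine (Tensor.one M (t + s)) _ ?_ ?_) h).symm
  · intro r hr
    change r ∈ ({0, t + s} : Finset ℝ≥0) at hr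
    rw [Finset.mem_insert, Finset.mem_singleton] at hr
    rcases hr with rfl | rfl
    · exact Partition.zero_mem _
    · exact Partition.right_mem _
  · ext1 r
    simp [Tensor.one, Tensor.concat]

/-- Multiplicativity of `T` before `Y` is applied. Pairing `x ⊗ X h` with `ι_{t+s} k = I ⊗ ι_t k`
leaves `gram(I, x)` acting on `X h`; it passes through `X`, and `gram(I, x) h = ι_s^*(x ⊗ h)`. -/
theorem adjoint_iota_comp_idTensOp {t s : ℝ≥0} (X : P.E t) :
    (P.iota (t + s)).adjoint ∘L P.idTensOp s X =
      (P.iota t).adjoint ∘L X.1 ∘L (P.iota s).adjoint := by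
  refine (P.kernel s).ext_tens fun x h => ?_
  refine ext_inner_left ℂ fun k => ?_
  simp only [ContinuousLinearMap.comp_apply]
  rw [ContinuousLinearMap.adjoint_inner_right, ContinuousLinearMap.adjoint_inner_right,
    idTensOp_tens, ← concatLeft_iota, inner_concatLeft, adjoint_iota_tens, E_apply]

theorem gram_one_one (t : ℝ≥0) (a : M) :
    P.gram (Tensor.one M t) (Tensor.one M t) a = P.toFun t a := by
  unfold gram corr
  have hn : ((Tensor.one M t).part.sup (Tensor.one M t).part).nodes = {0, t} := by
    simp [Partition.sup, Tensor.one, Partition.trivial]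
  rw [hn]
  -- For `t = 0` the partition `{0, t}` collapses to one point and the chain is empty; the claim is
  -- then `P_0 = id`.
  by_cases ht : t = 0
  · subst ht
    simp [chain, P.zero]
  · have : ({0, t} : Finset ℝ≥0).erase 0 = {t} := by
      rw [Finset.erase_insert]
      simpa using Ne.symm ht
    rw [this, Finset.sort_singleton, chain_cons]
    simp [chain, Tensor.one]

theorem adjoint_iota_leftAct_iota (t : ℝ≥0) (a : M) :
    (P.iota t).adjoint ∘L P.leftAct t a ∘L P.iota t = (P.toFun t a : H →L[ℂ] H) := by
  ext h
  refine ext_inner_left ℂ fun k => ?_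
  simp only [ContinuousLinearMap.comp_apply]
  rw [ContinuousLinearMap.adjoint_inner_right, iota, inner_leftAct, gram_one_one]

/-- Over `[0, 0]` there are no factors, so all tensors define the same operator. Hence `ι_0` has
full range and is unitary. -/
theorem tens_zero (x : Tensor M 0) : P.tens x = P.iota 0 := by
  ext h
  refine P.ext_inner_tens fun y k => ?_
  rw [iota, inner_tens, inner_tens, gram_zero, gram_zero]

theorem iota_comp_adjoint_zero : P.iota 0 ∘L (P.iota 0).adjoint = 1 := by
  refine (P.kernel 0).ext_tens fun x h => ?_
  change P.iota 0 ((P.iota 0).adjoint (P.tens x h)) = P.tens x h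
  rw [tens_zero]
  exact congrArg (P.iota 0) (DFunLike.congr_fun (P.adjoint_iota_comp_iota 0) h)

theorem iota_zero_mem : P.iota 0 ∈ P.E 0 := by
  intro a
  ext h
  change _ = P.leftAct 0 a (P.tens _ h)
  rw [leftAct_tens, leftTens, dif_pos rfl]
  rfl

end CPSemigroup

/-- The operator `X^* X + ε` has an invertible square root `S`. -/
theorem exists_isUnit_sqrt {G : Type*} [NormedAddCommGroup G] [InnerProductSpace ℂ G]
    [CompleteSpace G] {K : Type*} [NormedAddCommGroup K] [InnerProductSpace ℂ K] [CompleteSpace K]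
    (X : G →L[ℂ] K) {ε : ℝ} (hε : 0 < ε) :
    ∃ S : G →L[ℂ] G, IsUnit S ∧ (∀ g, ‖S g‖ ^ 2 = ‖X g‖ ^ 2 + ε * ‖g‖ ^ 2) ∧
      ∀ B, Commute (X.adjoint ∘L X) B → Commute S B := by
  set A : G →L[ℂ] G := X.adjoint ∘L X + (ε : ℂ) • (1 : G →L[ℂ] G) with hA
  have h0 : 0 ≤ X.adjoint ∘L X := by
    rw [ContinuousLinearMap.nonneg_iff_isPositive]
    exact ContinuousLinearMap.isPositive_adjoint_comp_self X
  have h1 : (ε : ℂ) • (1 : G →L[ℂ] G) ≤ A := le_add_of_nonneg_left h0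
  have hε0 : (0 : G →L[ℂ] G) ≤ (ε : ℂ) • (1 : G →L[ℂ] G) :=
    smul_nonneg (by exact_mod_cast hε.le) zero_le_one
  have hpos : 0 ≤ A := hε0.trans h1
  have hu : IsUnit ((ε : ℂ) • (1 : G →L[ℂ] G)) := by
    rw [← Algebra.algebraMap_eq_smul_one]
    exact (IsUnit.mk0 (ε : ℂ) (by exact_mod_cast hε.ne')).map (algebraMap ℂ (G →L[ℂ] G))
  -- `A ≥ ε` makes `A` invertible; the root is invertible because its square is.
  have hAu : IsUnit A := CStarAlgebra.isUnit_of_le _ h1 (hu.isStrictlyPositive hε0)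
  have hS := CFC.sqrt_mul_sqrt_self A hpos
  refine ⟨CFC.sqrt A, ?_, fun g => ?_, fun B hB => ?_⟩
  · rw [← isUnit_pow_iff two_ne_zero, pow_two, hS]
    exact hAu
  · have h2 : (CFC.sqrt A).adjoint = CFC.sqrt A := (CFC.sqrt_nonneg A).isSelfAdjoint.star_eq
    have h3 : CFC.sqrt A (CFC.sqrt A g) = A g := DFunLike.congr_fun hS g
    rw [← inner_self_eq_norm_sq (𝕜 := ℂ), ← ContinuousLinearMap.adjoint_inner_right, h2, h3, hA,
      add_apply, inner_add_right, ContinuousLinearMap.comp_apply,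
      ContinuousLinearMap.adjoint_inner_right, smul_apply, inner_smul_right, map_add,
      inner_self_eq_norm_sq]
    congr 1
    rw [← inner_self_eq_norm_sq (𝕜 := ℂ)]
    exact Complex.re_ofReal_mul _ _
  · have : Commute A B := hB.add_left ((Commute.one_left B).smul_left _)
    exact this.cfcₙ_nnreal _

/-! ### Finite columns `H^ι` and diagonal operators. -/

section Column

variable {H : Type u} [NormedAddCommGroup H] [InnerProductSpace ℂ H] {ι : Type v} [Fintype ι]

/-- The Hilbert space `H^ι` for a finite index set `ι`. -/
abbrev Col (ι : Type v) [Fintype ι] (H : Type u) [NormedAddCommGroup H] : Type max v u :=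
  PiLp 2 fun _ : ι => H

/-- The coordinate embeddings `H → H^ι`. -/
def Col.single [DecidableEq ι] (i : ι) : H →L[ℂ] Col ι H :=
  (PiLp.continuousLinearEquiv 2 ℂ (fun _ : ι => H)).symm.toContinuousLinearMap ∘L
    ContinuousLinearMap.single ℂ (fun _ : ι => H) i

theorem Col.single_apply_apply [DecidableEq ι] (i j : ι) (h : H) :
    (Col.single i h : Col ι H) j = (Pi.single i h : ι → H) j := rfl

theorem Col.sum_single [DecidableEq ι] (g : Col ι H) : ∑ i, Col.single i (g i) = g := by
  ext j
  rw [WithLp.ofLp_sum, Finset.sum_apply]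
  simp [Col.single_apply_apply]

/-- The diagonal operator `diag(a, …, a)` on `H^ι`. -/
def Col.diag (a : H →L[ℂ] H) : Col ι H →L[ℂ] Col ι H :=
  (PiLp.continuousLinearEquiv 2 ℂ (fun _ : ι => H)).symm.toContinuousLinearMap ∘L
    ContinuousLinearMap.pi fun i => a ∘L PiLp.proj 2 (fun _ : ι => H) i

@[simp]
theorem Col.diag_apply (a : H →L[ℂ] H) (g : Col ι H) (i : ι) : Col.diag a g i = a (g i) := rfl

theorem Col.diag_single [DecidableEq ι] (a : H →L[ℂ] H) (i : ι) (h : H) :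
    Col.diag a (Col.single i h : Col ι H) = Col.single i (a h) := by
  ext j
  rw [Col.diag_apply, Col.single_apply_apply, Col.single_apply_apply]
  by_cases hij : j = i
  · subst hij; simp
  · simp [hij]

theorem Col.inner_diag [CompleteSpace H] (a : H →L[ℂ] H) (g g' : Col ι H) :
    ⟪g, Col.diag a g'⟫_ℂ = ⟪Col.diag (star a) g, g'⟫_ℂ := by
  rw [PiLp.inner_apply, PiLp.inner_apply]
  exact Finset.sum_congr rfl fun i _ => (a.adjoint_inner_left _ _).symm

end Column

/-! ### Row operators over `E(t)` and bounded module maps into `M'`. -/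

namespace CPSemigroup

variable {H : Type u} [NormedAddCommGroup H] [InnerProductSpace ℂ H] [CompleteSpace H]
  {M : VonNeumannAlgebra H} (P : CPSemigroup M)

/-- The right action of `M'` on `E(t)`. -/
def rightMul {t : ℝ≥0} (X : P.E t) (b : M.commutant) : P.E t :=
  P.productSystem.corr t |>.right X b

theorem rightMul_apply {t : ℝ≥0} (X : P.E t) (b : M.commutant) (h : H) :
    (P.rightMul X b).1 h = X.1 ((b : H →L[ℂ] H) h) := rfl

variable {ι : Type v} [Fintype ι] {t : ℝ≥0}

/-- The row operator `H^ι → H_t` with entries in `E(t)`. -/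
def row (X : ι → P.E t) : Col ι H →L[ℂ] P.Ht t :=
  ∑ i, (X i).1 ∘L PiLp.proj 2 (fun _ : ι => H) i

theorem row_apply (X : ι → P.E t) (g : Col ι H) : P.row X g = ∑ i, (X i).1 (g i) := by
  simp [row]

theorem row_diag (X : ι → P.E t) (a : M) (g : Col ι H) :
    P.row X (Col.diag (a : H →L[ℂ] H) g) = P.leftAct t a (P.row X g) := by
  rw [row_apply, row_apply, map_sum]
  exact Finset.sum_congr rfl fun i _ => P.E_apply _ _ _

/-- A row over `E(t)` intertwines `diag(a)` with the action of `a`, and likewise for `a^*`. So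
functions of its modulus commute with `diag(a)` and have matrix entries in `M'`. -/
theorem commute_row_diag (X : ι → P.E t) (a : M) :
    Commute ((P.row X).adjoint ∘L P.row X) (Col.diag (a : H →L[ℂ] H)) := by
  ext1 g
  refine ext_inner_left ℂ fun g' => ?_
  change ⟪g', (P.row X).adjoint (P.row X (Col.diag (a : H →L[ℂ] H) g))⟫_ℂ =
    ⟪g', Col.diag (a : H →L[ℂ] H) ((P.row X).adjoint (P.row X g))⟫_ℂ
  have h1 := P.row_diag X (star a) g'
  rw [Col.inner_diag, ContinuousLinearMap.adjoint_inner_right,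
    ContinuousLinearMap.adjoint_inner_right, row_diag, ← ContinuousLinearMap.adjoint_inner_left,
    adjoint_leftAct, ← h1]
  rfl

/-- Bounded module maps on `E(t)` are row contractive up to the bound. -/
theorem norm_sum_le_of_row_le (Φ : P.E t →ₗ[ℂ] M.commutant)
    (hΦ : ∀ X b, Φ (P.rightMul X b) = Φ X * b) {c : ℝ} (hc : ∀ X, ‖Φ X‖ ≤ c * ‖X.1‖) (hc0 : 0 ≤ c)
    (Y : ι → P.E t) (hY : ∀ g, ‖P.row Y g‖ ≤ ‖g‖)
    (g : Col ι H) : ‖∑ i, (Φ (Y i) : H →L[ℂ] H) (g i)‖ ≤ c * ‖g‖ := by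
  -- Test element: with `r` the column of the `Φ(Y_i)^*`, it satisfies both `V = Y r` and `Φ(V) = ∑
  -- Φ(Y_i) Φ(Y_i)^* = r^* r`.
  set V : P.E t := ∑ i, P.rightMul (Y i) (star (Φ (Y i))) with hV
  set r : H → Col ι H := fun h => WithLp.toLp 2 fun i => ((star (Φ (Y i)) : M.commutant) : H →L[ℂ] H) h
    with hr
  have hVr : ∀ h, V.1 h = P.row Y (r h) := by
    intro h
    rw [row_apply, hV, Submodule.coe_sum, sum_apply]
    rfl
  have hΦV : ∀ h, ‖r h‖ ^ 2 = (⟪h, (Φ V : H →L[ℂ] H) h⟫_ℂ).re := by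
    intro h
    have e : (Φ V : H →L[ℂ] H) h =
        ∑ i, (Φ (Y i) : H →L[ℂ] H) (((star (Φ (Y i)) : M.commutant) : H →L[ℂ] H) h) := by
      have e1 : Φ V = ∑ i, Φ (Y i) * star (Φ (Y i)) := by
        rw [hV, map_sum]
        exact Finset.sum_congr rfl fun i _ => hΦ _ _
      have e2 := congrArg (fun b : M.commutant => coeRep M.commutant b h) e1
      simp only [map_sum, sum_apply] at e2
      exact e2
    rw [e, PiLp.norm_sq_eq_of_L2, inner_sum, Complex.re_sum]
    refine Finset.sum_congr rfl fun i _ => ?_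
    rw [← inner_self_eq_norm_sq (𝕜 := ℂ)]
    exact congrArg Complex.re ((Φ (Y i) : H →L[ℂ] H).adjoint_inner_left _ _)
  have hrV : ∀ h, ‖r h‖ ^ 2 ≤ c * ‖V.1‖ * ‖h‖ ^ 2 := by
    intro h
    rw [hΦV]
    calc _ ≤ ‖⟪h, (Φ V : H →L[ℂ] H) h⟫_ℂ‖ := Complex.re_le_norm _
      _ ≤ ‖h‖ * ‖(Φ V : H →L[ℂ] H) h‖ := norm_inner_le_norm _ _
      _ ≤ ‖h‖ * (c * ‖V.1‖ * ‖h‖) := by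
        gcongr
        refine ((Φ V : H →L[ℂ] H).le_opNorm h).trans ?_
        gcongr
        exact hc V
      _ = _ := by ring
  -- `Y` is a contraction, so `‖V‖² ≤ ‖r‖² = ‖Φ(V)‖ ≤ c ‖V‖`. After dividing by `‖V‖`, this feeds
  -- back into `‖r‖² ≤ c ‖V‖ ≤ c²`.
  have hVc : ‖V.1‖ ≤ c := by
    have h1 : ‖V.1‖ ≤ √(c * ‖V.1‖) := by
      refine ContinuousLinearMap.opNorm_le_bound _ (Real.sqrt_nonneg _) fun h => ?_
      refine le_of_sq_le_sq ?_ (by positivity)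
      rw [mul_pow, Real.sq_sqrt (by positivity)]
      refine le_trans ?_ (hrV h)
      rw [hVr]
      gcongr
      exact hY _
    have h2 := Real.le_sqrt' (y := c * ‖V.1‖) (x := ‖V.1‖)
    rcases (norm_nonneg V.1).eq_or_lt with h0 | h0
    · rw [← h0]; exact hc0
    · have h3 := (h2 h0).1 h1
      nlinarith
  have hrc : ∀ h, ‖r h‖ ≤ c * ‖h‖ := by
    intro h
    refine le_of_sq_le_sq ((hrV h).trans ?_) (by positivity)
    rw [mul_pow, pow_two c]
    gcongr
  -- `u = r^* g`, so the bound `c` for `r` passes to its adjoint.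
  set u := ∑ i, (Φ (Y i) : H →L[ℂ] H) (g i) with hu
  have h1 : ⟪u, u⟫_ℂ = ⟪r u, g⟫_ℂ := by
    conv_lhs => rw [hu]
    rw [← hu, inner_sum, PiLp.inner_apply]
    exact Finset.sum_congr rfl fun i _ => ((Φ (Y i) : H →L[ℂ] H).adjoint_inner_left _ _).symm
  have h2 : ‖u‖ ^ 2 ≤ c * ‖u‖ * ‖g‖ := by
    rw [← inner_self_eq_norm_sq (𝕜 := ℂ), h1]
    calc _ ≤ ‖⟪r u, g⟫_ℂ‖ := RCLike.re_le_norm _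
      _ ≤ ‖r u‖ * ‖g‖ := norm_inner_le_norm _ _
      _ ≤ _ := by gcongr; exact hrc u
  rcases (norm_nonneg u).eq_or_lt with h0 | h0
  · rw [← h0]; positivity
  · nlinarith

/-- The general row is reduced to a contractive one: with `S = (X^* X + ε)^{1/2}`, the row `Y = X
S⁻¹` is contractive and lies over `E(t)`, and `∑ Φ(X_i) g_i = ∑ Φ(Y_j) (S g)_j` by `M'`-linearity of
`Φ`. As `‖S g‖² = ‖X g‖² + ε ‖g‖²`, letting `ε → 0` gives the claim. The inequality says that `X ⊗ h
↦ Φ(X) h` is bounded on `E(t) ⊗ H`. -/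
theorem norm_sum_moduleMap_le (Φ : P.E t →ₗ[ℂ] M.commutant)
    (hΦ : ∀ X b, Φ (P.rightMul X b) = Φ X * b) {c : ℝ} (hc : ∀ X, ‖Φ X‖ ≤ c * ‖X.1‖) (hc0 : 0 ≤ c)
    (X : ι → P.E t) (g : Col ι H) :
    ‖∑ i, (Φ (X i) : H →L[ℂ] H) (g i)‖ ≤ c * ‖P.row X g‖ := by
  classical
  have key : ∀ ε : ℝ, 0 < ε →
      ‖∑ i, (Φ (X i) : H →L[ℂ] H) (g i)‖ ^ 2 ≤ c ^ 2 * (‖P.row X g‖ ^ 2 + ε * ‖g‖ ^ 2) := by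
    intro ε hε
    obtain ⟨S, ⟨S, rfl⟩, hn, hcomm⟩ := exists_isUnit_sqrt (P.row X) hε
    set B : Col ι H →L[ℂ] Col ι H := ↑S⁻¹ with hB
    have hSB : ∀ g, (S : Col ι H →L[ℂ] Col ι H) (B g) = g := fun g =>
      DFunLike.congr_fun S.mul_inv g
    have hBS : ∀ g, B ((S : Col ι H →L[ℂ] Col ι H) g) = g := fun g =>
      DFunLike.congr_fun S.inv_mul g
    have hBd : ∀ a : M, Commute B (Col.diag (a : H →L[ℂ] H)) := fun a =>
      (hcomm _ (P.commute_row_diag X a)).units_inv_left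
    -- The matrix entries of `S⁻¹`; they lie in `M'` because `S⁻¹` commutes with all `diag(a)`.
    let b : ι → ι → M.commutant := fun i j =>
      ⟨PiLp.proj 2 (fun _ : ι => H) i ∘L B ∘L Col.single j, by
        rw [VonNeumannAlgebra.mem_commutant_iff]
        intro a ha
        ext h
        have := DFunLike.congr_fun (hBd ⟨a, ha⟩).eq (Col.single j h)
        change B (Col.diag a (Col.single j h)) = Col.diag a (B (Col.single j h)) at this
        rw [Col.diag_single] at this
        exact congrArg (fun g : Col ι H => g i) this.symm⟩
    let Y : ι → P.E t := fun j => ∑ i, P.rightMul (X i) (b i j)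
    have hb : ∀ g i, ∑ j, (b i j : H →L[ℂ] H) (g j) = B g i := by
      intro g i
      conv_rhs => rw [← Col.sum_single g, map_sum]
      rw [WithLp.ofLp_sum, Finset.sum_apply]
      rfl
    have hYrow : ∀ g, P.row Y g = P.row X (B g) := by
      intro g
      rw [row_apply, row_apply]
      simp only [Y, Submodule.coe_sum, sum_apply, rightMul_apply]
      rw [Finset.sum_comm]
      simp only [← map_sum, hb]
    have hΦY : ∀ g : Col ι H,
        ∑ j, (Φ (Y j) : H →L[ℂ] H) (g j) = ∑ i, (Φ (X i) : H →L[ℂ] H) (B g i) := by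
      intro g
      have e : ∀ j, (Φ (Y j) : H →L[ℂ] H) (g j) =
          ∑ i, (Φ (X i) : H →L[ℂ] H) ((b i j : H →L[ℂ] H) (g j)) := by
        intro j
        have e1 : Φ (Y j) = ∑ i, Φ (X i) * b i j := by
          rw [map_sum]
          exact Finset.sum_congr rfl fun i _ => hΦ _ _
        have e2 := congrArg (fun b : M.commutant => coeRep M.commutant b (g j)) e1
        simp only [map_sum, sum_apply] at e2
        exact e2
      simp only [e]
      rw [Finset.sum_comm]
      simp only [← map_sum, hb]
    have h1 := P.norm_sum_le_of_row_le Φ hΦ hc hc0 Y (fun g => ?_)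
      ((S : Col ι H →L[ℂ] Col ι H) g)
    · rw [hΦY, hBS] at h1
      rw [← hn, ← mul_pow]
      gcongr
    · rw [hYrow]
      refine le_of_sq_le_sq ?_ (norm_nonneg _)
      have h2 := hn (B g)
      rw [hSB] at h2
      rw [h2]
      exact le_add_of_nonneg_right (by positivity)
  refine le_of_sq_le_sq ?_ (by positivity)
  rw [mul_pow]
  have hlim : Filter.Tendsto (fun ε : ℝ => c ^ 2 * (‖P.row X g‖ ^ 2 + ε * ‖g‖ ^ 2))
      (nhdsWithin 0 (Set.Ioi 0)) (nhds (c ^ 2 * (‖P.row X g‖ ^ 2 + 0 * ‖g‖ ^ 2))) := by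
    refine Filter.Tendsto.mono_left (Continuous.tendsto ?_ _) nhdsWithin_le_nhds
    fun_prop
  rw [zero_mul, add_zero] at hlim
  exact ge_of_tendsto hlim (Filter.eventually_of_mem self_mem_nhdsWithin fun ε hε => key ε hε)

end CPSemigroup

/-! ### Norms and completeness in spaces of operators. -/

section Operators

variable {H : Type u} [NormedAddCommGroup H] [InnerProductSpace ℂ H]
  {K : Type v} [NormedAddCommGroup K] [InnerProductSpace ℂ K] [CompleteSpace K]

theorem sqrt_norm_adjoint_comp_self [CompleteSpace H] (X : H →L[ℂ] K) : √‖X.adjoint ∘L X‖ = ‖X‖ := by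
  rw [X.norm_adjoint_comp_self, Real.sqrt_mul_self (norm_nonneg _)]

theorem exists_limit_of_isClosed {S : Submodule ℂ (H →L[ℂ] K)}
    (hS : IsClosed (S : Set (H →L[ℂ] K))) (x : ℕ → S)
    (hx : ∀ ε > 0, ∃ n₀, ∀ m ≥ n₀, ∀ n ≥ n₀, ‖(x m).1 - (x n).1‖ < ε) :
    ∃ X : S, ∀ ε > 0, ∃ n₀, ∀ n ≥ n₀, ‖(x n).1 - X.1‖ < ε := by
  have hc : CauchySeq fun n => (x n).1 := by
    refine Metric.cauchySeq_iff.2 fun ε hε => ?_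
    simpa only [dist_eq_norm] using hx ε hε
  obtain ⟨X, hX⟩ := cauchySeq_tendsto_of_complete hc
  refine ⟨⟨X, hS.mem_of_tendsto hX (Filter.Eventually.of_forall fun n => (x n).2)⟩,
    fun ε hε => ?_⟩
  simpa only [dist_eq_norm] using Metric.tendsto_atTop.1 hX ε hε

end Operators

namespace CPSemigroup

variable {H : Type u} [NormedAddCommGroup H] [InnerProductSpace ℂ H] [CompleteSpace H]
  {M : VonNeumannAlgebra H} (P : CPSemigroup M) {t : ℝ≥0}

theorem ext_E {F : Type v} [NormedAddCommGroup F] [NormedSpace ℂ F] {A B : P.Ht t →L[ℂ] F}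
    (h : ∀ (X : P.E t) k, A (X.1 k) = B (X.1 k)) : A = B := by
  ext1 u
  exact P.mem_of_forall_E (S := LinearMap.eqLocus A.toLinearMap B.toLinearMap)
    (isClosed_eq A.continuous B.continuous) h u

/-! ### The identification of `E(t) ⊗ H` with `H_t` -/

/-- The unitary operator `E(t) ⊗ H → H_t`, `X ⊗ h ↦ X h`. -/
def evalOp (t : ℝ≥0) : P.EH t →L[ℂ] P.Ht t :=
  (P.tensorKernel t).lift (fun X => X.1) 1 fun s v => by rw [one_mul, norm_sum_tensorKernel]

theorem evalOp_tens (X : P.E t) (h : H) :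
    P.evalOp t ((P.tensorKernel t).tens X h) = X.1 h := (P.tensorKernel t).lift_tens _ _ _ X h

theorem norm_evalOp (u : P.EH t) : ‖P.evalOp t u‖ = ‖u‖ := by
  refine (P.tensorKernel t).induction_tens (p := fun u => ‖P.evalOp t u‖ = ‖u‖)
    (isClosed_eq (by fun_prop) (by fun_prop)) (fun s v => ?_) u
  rw [norm_sum_tensorKernel, map_sum]
  simp only [evalOp_tens]

theorem adjoint_evalOp_comp : (P.evalOp t).adjoint ∘L P.evalOp t = 1 :=
  (ContinuousLinearMap.norm_map_iff_adjoint_comp_self _).1 P.norm_evalOp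

theorem adjoint_evalOp_apply (X : P.E t) (h : H) :
    (P.evalOp t).adjoint (X.1 h) = (P.tensorKernel t).tens X h := by
  rw [← evalOp_tens]
  exact DFunLike.congr_fun P.adjoint_evalOp_comp _

theorem evalOp_comp_adjoint : P.evalOp t ∘L (P.evalOp t).adjoint = 1 := by
  refine P.ext_E fun X h => ?_
  rw [ContinuousLinearMap.comp_apply, adjoint_evalOp_apply, evalOp_tens]
  rfl

/-- Under the unitary `evalOp`, `T̃_t` becomes `ι_t^*`; coisometry and the dilation formula become
statements about `ι_t` alone. -/
theorem Ttilde_eq : P.Ttilde t = (P.iota t).adjoint ∘L P.evalOp t := by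
  refine (P.tensorKernel t).ext_tens fun X h => ?_
  rw [Ttilde_tens, ContinuousLinearMap.comp_apply, evalOp_tens]
  rfl

theorem evalOp_comp_idTens (S : M) :
    P.evalOp t ∘L P.idTens t S = P.leftAct t S ∘L P.evalOp t := by
  refine (P.tensorKernel t).ext_tens fun X h => ?_
  simp only [ContinuousLinearMap.comp_apply]
  rw [idTens_tens, evalOp_tens, evalOp_tens, E_apply]

theorem Ttilde_comp_idTens_comp_adjoint (S : M) :
    P.Ttilde t ∘L P.idTens t S ∘L (P.Ttilde t).adjoint = (P.toFun t S : H →L[ℂ] H) := by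
  rw [Ttilde_eq, ContinuousLinearMap.adjoint_comp, ContinuousLinearMap.adjoint_adjoint,
    ← adjoint_iota_leftAct_iota]
  calc _ = (P.iota t).adjoint ∘L (P.evalOp t ∘L P.idTens t S) ∘L (P.evalOp t).adjoint ∘L P.iota t :=
        rfl
    _ = (P.iota t).adjoint ∘L P.leftAct t S ∘L (P.evalOp t ∘L (P.evalOp t).adjoint) ∘L P.iota t := by
        rw [evalOp_comp_idTens]; rfl
    _ = _ := by rw [evalOp_comp_adjoint]; rfl

theorem Ttilde_comp_adjoint : P.Ttilde t ∘L (P.Ttilde t).adjoint = 1 := by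
  rw [Ttilde_eq, ContinuousLinearMap.adjoint_comp, ContinuousLinearMap.adjoint_adjoint,
    ← adjoint_iota_comp_iota]
  calc _ = (P.iota t).adjoint ∘L (P.evalOp t ∘L (P.evalOp t).adjoint) ∘L P.iota t := rfl
    _ = _ := by rw [evalOp_comp_adjoint]; rfl

/-! ### Self-duality -/

/-- `X ⊗ h ↦ Φ(X) h` is bounded by `norm_sum_moduleMap_le`. Carried over to `H_t` it is an operator
`Z` with `Z X = Φ(X)`. By totality `Z` intertwines the actions of `M`, since the values of `Φ` lie
in `M'`. The implementing element is `Z^*`. -/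
theorem exists_eq_ip (Φ : P.E t →ₗ[ℂ] M.commutant) (hΦ : ∀ X b, Φ (P.rightMul X b) = Φ X * b)
    {c : ℝ} (hc : ∀ X, ‖Φ X‖ ≤ c * ‖X.1‖) (hc0 : 0 ≤ c) : ∃ Y, ∀ X, Φ X = P.ip Y X := by
  let R : P.EH t →L[ℂ] H := (P.tensorKernel t).lift (fun X => (Φ X : H →L[ℂ] H)) c fun s v => by
    rw [norm_sum_tensorKernel]
    have := P.norm_sum_moduleMap_le Φ hΦ hc hc0 (fun X : s => X.1) (WithLp.toLp 2 fun X => v X)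
    rw [row_apply] at this
    rw [← Finset.sum_coe_sort s, ← Finset.sum_coe_sort s]
    exact this
  obtain ⟨Z, hZX⟩ : ∃ Z : P.Ht t →L[ℂ] H, ∀ X : P.E t, ∀ h,
      Z (X.1 h) = (Φ X : H →L[ℂ] H) h := ⟨R ∘L (P.evalOp t).adjoint, fun X h => by
    rw [ContinuousLinearMap.comp_apply, adjoint_evalOp_apply]
    exact (P.tensorKernel t).lift_tens _ _ _ X h⟩
  have hZa : ∀ a : M, Z ∘L P.leftAct t a = (a : H →L[ℂ] H) ∘L Z := fun a => by
    refine P.ext_E fun X h => ?_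
    rw [ContinuousLinearMap.comp_apply, ContinuousLinearMap.comp_apply, ← E_apply, hZX, hZX,
      commute_coe]
  refine ⟨⟨Z.adjoint, fun a => ?_⟩, fun X => Subtype.ext ?_⟩
  · have := congrArg ContinuousLinearMap.adjoint (hZa (star a))
    rw [ContinuousLinearMap.adjoint_comp, ContinuousLinearMap.adjoint_comp, adjoint_leftAct,
      star_star] at this
    rw [this]
    congr 1
    exact (ContinuousLinearMap.adjoint_adjoint (a : H →L[ℂ] H)).symm
  · change _ = Z.adjoint.adjoint ∘L X.1
    rw [ContinuousLinearMap.adjoint_adjoint]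
    ext h
    exact (hZX X h).symm

/-! ### The correspondences `E(t)` -/

theorem corr_norm (X : P.E t) : (P.productSystem.corr t).norm X = ‖X.1‖ := by
  exact sqrt_norm_adjoint_comp_self X.1

theorem isClosed_E : IsClosed (P.E t : Set (H →L[ℂ] P.Ht t)) := by
  have : (P.E t : Set (H →L[ℂ] P.Ht t)) =
      ⋂ a : M, {X | X ∘L (a : H →L[ℂ] H) = P.leftAct t a ∘L X} := by
    ext X
    simp [E]
  rw [this]
  exact isClosed_iInter fun a => isClosed_eq (by fun_prop) (by fun_prop)

theorem isWStarCorrespondence (t : ℝ≥0) :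
    IsWStarCorrespondence (E := P.E t) (P.productSystem.corr t) where
  right_one _ := rfl
  right_mul _ _ _ := rfl
  right_add X a b := Subtype.ext (ContinuousLinearMap.ext fun h => map_add X.1 _ _)
  add_right _ _ _ := rfl
  right_smul c X a := Subtype.ext (ContinuousLinearMap.ext fun h => map_smul X.1 _ _)
  smul_right _ _ _ := rfl
  ip_add X Y Z := Subtype.ext (ContinuousLinearMap.comp_add _ _ _)
  ip_smul c X Y := Subtype.ext (ContinuousLinearMap.comp_smul _ _ _)
  ip_right _ _ _ := rfl
  star_ip X Y := Subtype.ext <| by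
    change (X.1.adjoint ∘L Y.1).adjoint = Y.1.adjoint ∘L X.1
    rw [ContinuousLinearMap.adjoint_comp, ContinuousLinearMap.adjoint_adjoint]
  ip_nonneg X := ContinuousLinearMap.isPositive_adjoint_comp_self X.1
  ip_definite X hX := Subtype.ext <| by
    exact ContinuousLinearMap.adjoint_comp_self_eq_zero_iff.1 (congrArg Subtype.val hX)
  complete x hx := by
    obtain ⟨X, hX⟩ := exists_limit_of_isClosed P.isClosed_E x fun ε hε => by
      obtain ⟨n₀, hn⟩ := hx ε hε
      exact ⟨n₀, fun m hm n hn' => (P.corr_norm (x m - x n)).symm.trans_lt (hn m hm n hn')⟩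
    refine ⟨X, fun ε hε => ?_⟩
    obtain ⟨n₀, hn⟩ := hX ε hε
    exact ⟨n₀, fun n hn' => (P.corr_norm (x n - X)).trans_lt (hn n hn')⟩
  left_one X := Subtype.ext <| by
    change P.commutantRep t 1 ∘L X.1 = X.1
    rw [(P.isStarRep_commutantRep t).map_one]
    rfl
  left_mul a b X := Subtype.ext <| by
    change P.commutantRep t (a * b) ∘L X.1 = P.commutantRep t a ∘L P.commutantRep t b ∘L X.1
    rw [(P.isStarRep_commutantRep t).map_mul]
    rfl
  left_add a b X := Subtype.ext <| by
    change P.commutantRep t (a + b) ∘L X.1 = P.commutantRep t a ∘L X.1 + P.commutantRep t b ∘L X.1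
    rw [map_add, ContinuousLinearMap.add_comp]
  add_left a X Y := Subtype.ext (ContinuousLinearMap.comp_add _ _ _)
  left_smul c a X := Subtype.ext <| by
    change P.commutantRep t (c • a) ∘L X.1 = c • P.commutantRep t a ∘L X.1
    rw [map_smul, ContinuousLinearMap.smul_comp]
  smul_left c a X := Subtype.ext (ContinuousLinearMap.comp_smul _ _ _)
  left_right _ _ _ := rfl
  ip_left a X Y := Subtype.ext <| by
    change (P.commutantAct t a ∘L X.1).adjoint ∘L Y.1 =
      X.1.adjoint ∘L P.commutantAct t (star a) ∘L Y.1
    rw [ContinuousLinearMap.adjoint_comp, adjoint_commutantAct, ContinuousLinearMap.comp_assoc]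
  left_normal X Y := P.isNormalInto_adjoint_commutantAct X.1 Y.1
  self_dual := by
    rintro Φ hΦ ⟨c, hc⟩
    -- The bound in the definition of self-duality carries no sign condition.
    refine P.exists_eq_ip Φ hΦ (c := max c 0) (fun X => ?_) (le_max_right _ _)
    have h1 : ‖Φ X‖ ≤ c * ‖X.1‖ := (hc X).trans_eq (congrArg (c * ·) (P.corr_norm X))
    exact h1.trans (mul_le_mul_of_nonneg_right (le_max_left _ _) X.1.opNorm_nonneg)

/-! ### The product system -/

/-- The product `X ⊗ Y = (I_s ⊗ X) Y` of `X ∈ E(t)` and `Y ∈ E(s)`. -/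
def tmul {s : ℝ≥0} (X : P.E t) (Y : P.E s) : P.E (t + s) := P.productSystem.mul t s X Y

theorem tmul_coe {s : ℝ≥0} (X : P.E t) (Y : P.E s) :
    (P.tmul X Y).1 = P.idTensOp s X ∘L Y.1 := rfl

/-- The left action of `M'` on `E(t)`. -/
def leftMul (b : M.commutant) (X : P.E t) : P.E t := (P.productSystem.corr t).left b X

theorem add_tmul {s : ℝ≥0} (X X' : P.E t) (Y : P.E s) :
    P.tmul (X + X') Y = P.tmul X Y + P.tmul X' Y := Subtype.ext <| by
  rw [tmul_coe, idTensOp_add, ContinuousLinearMap.add_comp]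
  rfl

theorem smul_tmul {s : ℝ≥0} (c : ℂ) (X : P.E t) (Y : P.E s) :
    P.tmul (c • X) Y = c • P.tmul X Y := Subtype.ext <| by
  rw [tmul_coe, idTensOp_smul, ContinuousLinearMap.smul_comp]
  rfl

theorem rightMul_tmul {s : ℝ≥0} (X : P.E t) (b : M.commutant) (Y : P.E s) :
    P.tmul (P.rightMul X b) Y = P.tmul X (P.leftMul b Y) := Subtype.ext <| by
  rw [tmul_coe, ← P.idTensOp_comp_commutantAct X b (P.rightMul X b) rfl,
    ContinuousLinearMap.comp_assoc]
  rfl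

theorem leftMul_tmul {s : ℝ≥0} (b : M.commutant) (X : P.E t) (Y : P.E s) :
    P.tmul (P.leftMul b X) Y = P.leftMul b (P.tmul X Y) := Subtype.ext <| by
  rw [tmul_coe, ← P.commutantAct_comp_idTensOp X b (P.leftMul b X) rfl,
    ContinuousLinearMap.comp_assoc]
  rfl

theorem ip_tmul {s : ℝ≥0} (X X' : P.E t) (Y Y' : P.E s) :
    P.ip (P.tmul X Y) (P.tmul X' Y') = P.ip Y (P.leftMul (P.ip X X') Y') := Subtype.ext <| by
  change (P.idTensOp s X ∘L Y.1).adjoint ∘L P.idTensOp s X' ∘L Y'.1 =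
    Y.1.adjoint ∘L P.commutantAct s (P.ip X X') ∘L Y'.1
  rw [ContinuousLinearMap.adjoint_comp, ← adjoint_idTensOp_comp]
  rfl

/-- The hypothesis makes each `Z h` orthogonal to all `(I_s ⊗ X) Y l`, which are total in `H_{t+s}`.
-/
theorem eq_zero_of_ip_tmul {s : ℝ≥0} (Z : P.E (t + s))
    (hZ : ∀ (X : P.E t) (Y : P.E s), P.ip (P.tmul X Y) Z = 0) : Z = 0 := Subtype.ext <| by
  have h1 : ∀ k h, ⟪k, Z.1 h⟫_ℂ = 0 := by
    intro k h
    refine Submodule.mem_orthogonal_singleton_iff_inner_left.1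
      (P.mem_of_forall_idTensOp (S := (ℂ ∙ Z.1 h)ᗮ) (Submodule.isClosed_orthogonal _)
      (fun X Y l => Submodule.mem_orthogonal_singleton_iff_inner_left.2 ?_) k)
    have h2 := P.inner_E_apply (P.tmul X Y) Z l h
    rw [hZ] at h2
    exact h2.trans (inner_zero_right _)
  exact ContinuousLinearMap.ext fun h => inner_self_eq_zero.1 (h1 _ h)

theorem unit_bijective : Function.Bijective P.productSystem.unit := by
  constructor
  · intro a b hab
    have h1 : P.iota 0 ∘L (a : H →L[ℂ] H) = P.iota 0 ∘L (b : H →L[ℂ] H) :=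
      congrArg Subtype.val hab
    have h2 := congrArg (fun A => (P.iota 0).adjoint ∘L A) h1
    simp only [← ContinuousLinearMap.comp_assoc, adjoint_iota_comp_iota] at h2
    exact Subtype.ext h2
  · intro (X : P.E 0)
    -- The preimage is `ι_0^* X ∈ M'`, and `ι_0 ι_0^* = 1`.
    refine ⟨P.ip ⟨P.iota 0, P.iota_zero_mem⟩ X, Subtype.ext ?_⟩
    change P.iota 0 ∘L (P.iota 0).adjoint ∘L X.1 = X.1
    rw [← ContinuousLinearMap.comp_assoc, iota_comp_adjoint_zero]
    rfl

theorem isDiscreteProductSystem : IsDiscreteProductSystem P.productSystem where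
  correspondence := P.isWStarCorrespondence
  unit_bijective := P.unit_bijective
  unit_add a b := Subtype.ext (ContinuousLinearMap.comp_add _ _ _)
  unit_smul c a := Subtype.ext (ContinuousLinearMap.comp_smul _ _ _)
  unit_left a b := Subtype.ext <| ContinuousLinearMap.ext fun h =>
    (P.commutantAct_iota a ((b : H →L[ℂ] H) h)).symm
  unit_right _ _ := rfl
  unit_ip a b := Subtype.ext <| by
    change (P.iota 0 ∘L (a : H →L[ℂ] H)).adjoint ∘L P.iota 0 ∘L (b : H →L[ℂ] H) =
      (a : H →L[ℂ] H).adjoint ∘L (b : H →L[ℂ] H)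
    rw [ContinuousLinearMap.adjoint_comp, ContinuousLinearMap.comp_assoc,
      ← ContinuousLinearMap.comp_assoc (P.iota 0).adjoint, adjoint_iota_comp_iota]
    rfl
  add_mul _ _ := P.add_tmul
  mul_add t s X Y Y' := Subtype.ext (ContinuousLinearMap.comp_add _ _ _)
  smul_mul _ _ := P.smul_tmul
  mul_smul t s c X Y := Subtype.ext (ContinuousLinearMap.comp_smul _ _ _)
  mul_balanced _ _ := P.rightMul_tmul
  mul_left _ _ := P.leftMul_tmul
  mul_right _ _ _ _ _ := rfl
  mul_ip _ _ X Y X' Y' := P.ip_tmul X X' Y Y'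
  mul_generates _ _ := P.eq_zero_of_ip_tmul

end CPSemigroup

/-! ### Absolutely convergent series by successive approximation. -/

section Banach

/-- If the unit ball of a subspace `S` is contained in the closed convex hull of a bounded subset `A`
of `S`, then every element of `S` is an absolutely convergent series of multiples of elements
of `A`. -/
theorem exists_hasSum_of_subset_closure_convexHull {F : Type*} [NormedAddCommGroup F]
    [NormedSpace ℝ F] (S : Submodule ℝ F) {A : Set F} (hAS : A ⊆ S)
    (h : ∀ f ∈ S, ‖f‖ ≤ 1 → f ∈ closure (convexHull ℝ A)) (hA : ∀ a ∈ A, ‖a‖ ≤ 1)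
    [CompleteSpace F] {f : F} (hf : f ∈ S) :
    ∃ (w : ℕ → ℝ) (a : ℕ → F), (∀ n, 0 ≤ w n) ∧ Summable w ∧ (∀ n, a n ∈ insert 0 A) ∧
      HasSum (fun n => w n • a n) f := by
  -- One approximation step: a combination of total weight `‖g‖` halves the remainder, which stays
  -- in `S` because `A ⊆ S`.
  have step : ∀ g : S, ∃ (ι : Type) (_ : Fintype ι) (w : ι → ℝ) (a : ι → F),
      (∀ i, 0 ≤ w i) ∧ ∑ i, w i = ‖(g : F)‖ ∧ (∀ i, a i ∈ A) ∧
      ‖(g : F) - ∑ i, w i • a i‖ ≤ ‖(g : F)‖ / 2 := by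
    intro g
    rcases eq_or_ne (g : F) 0 with h0 | h0
    · exact ⟨PEmpty, inferInstance, PEmpty.elim, PEmpty.elim, fun i => i.elim, by simp [h0],
        fun i => i.elim, by simp [h0]⟩
    have hg : 0 < ‖(g : F)‖ := norm_pos_iff.2 h0
    have h1 := h (‖(g : F)‖⁻¹ • (g : F)) (S.smul_mem _ g.2) (by
      rw [norm_smul, norm_inv, norm_norm, inv_mul_cancel₀ hg.ne'])
    obtain ⟨b, hb, hd⟩ := Metric.mem_closure_iff.1 h1 (1 / 2) (by norm_num)
    obtain ⟨ι, hι, w, z, hw, hw1, hz, rfl⟩ := mem_convexHull_iff_exists_fintype.1 hb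
    refine ⟨ι, hι, fun i => ‖(g : F)‖ * w i, z, fun i => mul_nonneg hg.le (hw i), ?_, hz, ?_⟩
    · rw [← Finset.mul_sum, hw1, mul_one]
    · have e : (g : F) - ∑ i, (‖(g : F)‖ * w i) • z i =
          ‖(g : F)‖ • (‖(g : F)‖⁻¹ • (g : F) - ∑ i, w i • z i) := by
        rw [smul_sub, smul_inv_smul₀ hg.ne', Finset.smul_sum]
        simp only [mul_smul]
      rw [e, norm_smul, norm_norm]
      rw [dist_eq_norm] at hd
      nlinarith
  choose ι hι w a hw hw1 ha hd using step
  let next : S → S := fun g => ⟨(g : F) - ∑ i, w g i • a g i,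
    S.sub_mem g.2 (S.sum_mem fun i _ => S.smul_mem _ (hAS (ha g i)))⟩
  let g : ℕ → S := fun n => next^[n] ⟨f, hf⟩
  have hg0 : g 0 = ⟨f, hf⟩ := rfl
  have hgs : ∀ n, (g (n + 1) : F) = g n - ∑ i, w (g n) i • a (g n) i := fun n => by
    simp only [g, Function.iterate_succ_apply']
    rfl
  have hgn : ∀ n, ‖(g n : F)‖ ≤ ‖f‖ * (1 / 2) ^ n := by
    intro n
    induction n with
    | zero => simp [hg0]
    | succ n ih =>
      rw [hgs]
      refine (hd _).trans ?_
      rw [pow_succ]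
      linarith
  let κ := Σ n, ι (g n)
  -- The weights used at step `n` add up to `‖g n‖ ≤ ‖f‖ 2^{-n}`, so the whole double family is
  -- summable.
  have hsum : Summable fun p : κ => w (g p.1) p.2 := by
    rw [summable_sigma_of_nonneg fun p => hw _ _]
    refine ⟨fun n => Summable.of_finite, ?_⟩
    simp only [tsum_fintype, hw1]
    exact Summable.of_nonneg_of_le (fun n => norm_nonneg _) hgn
      (summable_geometric_two.mul_left _)
  have hterm : ∀ p : κ, ‖w (g p.1) p.2 • a (g p.1) p.2‖ ≤ w (g p.1) p.2 := fun p => by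
    rw [norm_smul, Real.norm_of_nonneg (hw _ _)]
    exact mul_le_of_le_one_right (hw _ _) (hA _ (ha _ _))
  have hs : Summable fun p : κ => w (g p.1) p.2 • a (g p.1) p.2 :=
    Summable.of_norm_bounded hsum hterm
  have htotal : HasSum (fun p : κ => w (g p.1) p.2 • a (g p.1) p.2) f := by
    have h1 := hs.hasSum.sigma fun n => hasSum_fintype (fun i => w (g n) i • a (g n) i)
    have h2 : HasSum (fun n => ∑ i, w (g n) i • a (g n) i) f := by
      have e : ∀ n, ∑ i, w (g n) i • a (g n) i = (g n : F) - g (n + 1) := fun n => by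
        rw [hgs]; abel
      rw [h1.summable.hasSum_iff_tendsto_nat]
      simp only [e, Finset.sum_range_sub']
      have hlim : Filter.Tendsto (fun n => (g n : F)) Filter.atTop (nhds 0) := by
        refine squeeze_zero_norm hgn ?_
        simpa using (tendsto_pow_atTop_nhds_zero_of_lt_one (by norm_num : (0:ℝ) ≤ 1 / 2)
          (by norm_num)).const_mul ‖f‖
      simpa [hg0] using hlim.const_sub (g 0 : F)
    rw [← h1.unique h2]
    exact hs.hasSum
  -- Reindexing by `ℕ` along an injection leaves unused positions filled with `0`; this is why `0`
  -- is adjoined to `A` in the conclusion.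
  obtain ⟨e, he⟩ := exists_injective_nat κ
  refine ⟨Function.extend e (fun p => w (g p.1) p.2) 0,
    Function.extend e (fun p => a (g p.1) p.2) 0, fun n => ?_, ?_, fun n => ?_, ?_⟩
  · by_cases hn : ∃ p, e p = n
    · obtain ⟨p, rfl⟩ := hn
      rw [he.extend_apply]
      exact hw _ _
    · rw [Function.extend_apply' _ _ _ hn]
      exact le_rfl
  · rw [← he.summable_iff fun n hn => by
      rw [Function.extend_apply' _ _ _ hn, Pi.zero_apply]]
    exact hsum.congr fun p => by simp [he.extend_apply]
  · by_cases hn : ∃ p, e p = n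
    · obtain ⟨p, rfl⟩ := hn
      rw [he.extend_apply]
      exact Or.inr (ha _ _)
    · rw [Function.extend_apply' _ _ _ hn]
      exact Or.inl rfl
  · rw [← he.hasSum_iff fun n hn => by
      rw [Function.extend_apply' _ _ _ hn, Pi.zero_apply, zero_smul]]
    convert htotal using 2 with p
    simp [he.extend_apply]

end Banach

/-! ### Vector functionals on spaces of intertwiners -/

section VectorFunctional

variable {H : Type u} [NormedAddCommGroup H] [InnerProductSpace ℂ H]
  {K : Type v} [NormedAddCommGroup K] [InnerProductSpace ℂ K]
  {E : Type*} [NormedAddCommGroup E] [NormedSpace ℂ E] (ev : E →ₗᵢ[ℂ] (H →L[ℂ] K))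

/-- The functionals `X ↦ ⟨u, X k⟩`. -/
def vecFunctional (u : K) : H →L[ℂ] (E →L[ℂ] ℂ) :=
  LinearMap.mkContinuous₂ (LinearMap.mk₂ ℂ (fun (k : H) (X : E) => ⟪u, ev X k⟫_ℂ)
    (fun k k' X => by rw [map_add, inner_add_right])
    (fun c k X => by rw [map_smul, inner_smul_right, smul_eq_mul])
    (fun k X X' => by rw [map_add, add_apply, inner_add_right])
    (fun c k X => by rw [map_smul, smul_apply, inner_smul_right, smul_eq_mul])) ‖u‖ fun k X => by
  refine (norm_inner_le_norm u (ev X k)).trans ?_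
  rw [mul_assoc, mul_comm ‖k‖]
  gcongr
  rw [← ev.norm_map X]
  exact (ev X).le_opNorm k

theorem vecFunctional_apply (u : K) (k : H) (X : E) : vecFunctional ev u k X = ⟪u, ev X k⟫_ℂ := rfl

theorem norm_vecFunctional_le (u : K) : ‖vecFunctional ev u‖ ≤ ‖u‖ :=
  LinearMap.mkContinuous₂_norm_le _ (norm_nonneg u) _

theorem norm_vecFunctional_apply_le (u : K) (k : H) : ‖vecFunctional ev u k‖ ≤ ‖u‖ * ‖k‖ :=
  ((vecFunctional ev u).le_opNorm k).trans (by gcongr; exact norm_vecFunctional_le ev u)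

/-- The closed span of the functionals `X ↦ ⟨u, X k⟩`, a predual of `E`. -/
def vecPredual : Submodule ℂ (E →L[ℂ] ℂ) :=
  (Submodule.span ℂ {f | ∃ u k, f = vecFunctional ev u k}).topologicalClosure

theorem vecFunctional_mem (u : K) (k : H) : vecFunctional ev u k ∈ vecPredual ev :=
  Submodule.le_topologicalClosure _ (Submodule.subset_span ⟨u, k, rfl⟩)

theorem isClosed_vecPredual : IsClosed (vecPredual ev : Set (E →L[ℂ] ℂ)) :=
  Submodule.isClosed_topologicalClosure _

variable {ev} [CompleteSpace H] [CompleteSpace K] {N : Type*} {R : N → (H →L[ℂ] H)}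
  {L : N → (K →L[ℂ] K)}

/-- Functionals on the predual of a space of intertwiners are evaluations. -/
theorem exists_eval (hE : ∀ X, X ∈ Set.range ev ↔ ∀ a, X ∘L R a = L a ∘L X) (Ψ : (E →L[ℂ] ℂ) →L[ℂ] ℂ) :
    ∃ Z : E, ∀ f ∈ vecPredual ev, Ψ f = f Z := by
  -- For fixed `u`, the functional `k ↦ Ψ(⟨u, · k⟩)` is represented by a vector `T u` (Riesz). Two
  -- conjugate-linear dependences on `u` cancel, so `T` is linear.
  let T : K →L[ℂ] H := LinearMap.mkContinuous
    { toFun := fun u => (InnerProductSpace.toDual ℂ H).symm (Ψ ∘L vecFunctional ev u)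
      map_add' := fun u v => ext_inner_right ℂ fun k => by
        rw [inner_add_left, InnerProductSpace.toDual_symm_apply,
          InnerProductSpace.toDual_symm_apply, InnerProductSpace.toDual_symm_apply]
        simp only [ContinuousLinearMap.comp_apply]
        rw [← map_add]
        congr 1
        ext X
        exact inner_add_left _ _ _
      map_smul' := fun c u => ext_inner_right ℂ fun k => by
        rw [RingHom.id_apply, inner_smul_left, InnerProductSpace.toDual_symm_apply,
          InnerProductSpace.toDual_symm_apply]
        simp only [ContinuousLinearMap.comp_apply]
        rw [← smul_eq_mul, ← map_smul]
        congr 1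
        ext X
        exact inner_smul_left _ _ _ } ‖Ψ‖ fun u => by
    change ‖(InnerProductSpace.toDual ℂ H).symm (Ψ ∘L vecFunctional ev u)‖ ≤ _
    rw [LinearIsometryEquiv.norm_map]
    refine (ContinuousLinearMap.opNorm_comp_le _ _).trans ?_
    gcongr
    exact norm_vecFunctional_le ev u
  have hT : ∀ u k, ⟪u, T.adjoint k⟫_ℂ = Ψ (vecFunctional ev u k) := fun u k => by
    rw [ContinuousLinearMap.adjoint_inner_right]
    exact InnerProductSpace.toDual_symm_apply
  -- On `E` the functionals for `(u, R a k)` and `((L a)^* u, k)` coincide, so `T^*` is again an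
  -- intertwiner and hence belongs to `E`.
  obtain ⟨Z, hZ⟩ : T.adjoint ∈ Set.range ev := by
    rw [hE]
    intro a
    ext k
    refine ext_inner_left ℂ fun u => ?_
    rw [ContinuousLinearMap.comp_apply, ContinuousLinearMap.comp_apply,
      ← ContinuousLinearMap.adjoint_inner_left (L a), hT, hT]
    congr 1
    ext X
    rw [vecFunctional_apply, vecFunctional_apply, ContinuousLinearMap.adjoint_inner_left]
    exact congrArg (fun z => ⟪u, z⟫_ℂ) (DFunLike.congr_fun ((hE (ev X)).1 ⟨X, rfl⟩ a) k)
  refine ⟨Z, fun f hf => ?_⟩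
  have hle : vecPredual ev ≤ LinearMap.eqLocus Ψ.toLinearMap
      (ContinuousLinearMap.apply ℂ ℂ Z).toLinearMap := by
    refine Submodule.topologicalClosure_minimal _ (Submodule.span_le.2 ?_)
      (isClosed_eq Ψ.continuous (ContinuousLinearMap.continuous _))
    rintro _ ⟨u, k, rfl⟩
    change Ψ _ = ⟪u, ev Z k⟫_ℂ
    rw [hZ, hT]
  exact hle hf

/-- The functionals `X ↦ ⟨Y h, X k⟩` with `‖Y‖, ‖h‖, ‖k‖ ≤ 1`. -/
def vecAtoms (ev : E →ₗᵢ[ℂ] (H →L[ℂ] K)) : Set (E →L[ℂ] ℂ) :=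
  {f | ∃ (Y : E) (h k : H), ‖ev Y‖ ≤ 1 ∧ ‖h‖ ≤ 1 ∧ ‖k‖ ≤ 1 ∧ f = vecFunctional ev (ev Y h) k}

/-- Otherwise Hahn–Banach gives `Ψ` and `r` with `Re Ψ ≤ r` on the atoms and `Re Ψ(f) > r`. On the
predual `Ψ` is evaluation at some `Z`, and the atoms already norm `Z`, so `‖Z‖ ≤ r`. Then `Re Ψ(f) ≤
‖f‖ ‖Z‖ ≤ r`, a contradiction. -/
theorem mem_closure_convexHull_vecAtoms (hE : ∀ X, X ∈ Set.range ev ↔ ∀ a, X ∘L R a = L a ∘L X)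
    {f : E →L[ℂ] ℂ} (hf : f ∈ vecPredual ev) (hf1 : ‖f‖ ≤ 1) :
    f ∈ closure (convexHull ℝ (vecAtoms ev)) := by
  by_contra hnot
  obtain ⟨Ψ, r, hΨ, hr⟩ := RCLike.geometric_hahn_banach_closed_point (𝕜 := ℂ)
    (convex_convexHull ℝ (vecAtoms ev)).closure isClosed_closure hnot
  obtain ⟨Z, hZ⟩ := exists_eval hE Ψ
  have hatom : ∀ (Y : E) (h k : H), ‖ev Y‖ ≤ 1 → ‖h‖ ≤ 1 → ‖k‖ ≤ 1 →
      (⟪ev Y h, ev Z k⟫_ℂ).re ≤ r := by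
    intro Y h k hY hh hk
    have := hΨ _ (subset_closure (subset_convexHull ℝ _ ⟨Y, h, k, hY, hh, hk, rfl⟩))
    rw [hZ _ (vecFunctional_mem ev _ _), vecFunctional_apply] at this
    exact this.le
  have hr0 : 0 ≤ r := by simpa using hatom 0 0 0 (by simp) (by simp) (by simp)
  have hZr : ‖ev Z‖ ≤ r := by
    rcases (norm_nonneg (ev Z)).eq_or_lt with h0 | h0
    · rwa [← h0]
    have h1 : ∀ h : H, ‖h‖ ≤ 1 → ‖ev Z h‖ ≤ √(r * ‖ev Z‖) := by
      intro h hh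
      refine le_of_sq_le_sq ?_ (Real.sqrt_nonneg _)
      rw [Real.sq_sqrt (by positivity)]
      -- The atom with `Y = Z / ‖Z‖` and equal vectors yields `‖Z h‖² ≤ r ‖Z‖`, hence `‖Z‖ ≤ r`.
      have h2 := hatom (((‖ev Z‖⁻¹ : ℝ) : ℂ) • Z) h h (by
        rw [map_smul, norm_smul, Complex.norm_real, norm_inv, norm_norm,
          inv_mul_cancel₀ h0.ne']) hh hh
      rw [map_smul, smul_apply, inner_smul_left, Complex.conj_ofReal,
        Complex.re_ofReal_mul, inv_mul_le_iff₀ h0] at h2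
      rw [← inner_self_eq_norm_sq (𝕜 := ℂ), mul_comm r]
      exact h2
    have h3 : ‖ev Z‖ ≤ √(r * ‖ev Z‖) := by
      refine (ev Z).opNorm_le_of_unit_norm (𝕜 := ℂ) (Real.sqrt_nonneg _) fun x hx => h1 x hx.le
    have h4 := (Real.le_sqrt' h0).1 h3
    nlinarith
  have h5 : RCLike.re (Ψ f) ≤ r := by
    rw [hZ f hf]
    calc _ ≤ ‖f Z‖ := RCLike.re_le_norm _
      _ ≤ ‖f‖ * ‖Z‖ := f.le_opNorm Z
      _ ≤ 1 * r := by gcongr; exact (ev.norm_map Z).symm.trans_le hZr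
      _ = r := one_mul r
  exact absurd hr (not_lt.2 h5)

/-- This trades arbitrary vectors `u ∈ K` for vectors of the form `Y h` with `Y ∈ E`, the only ones
visible to an operator-valued inner product on `E`. -/
theorem exists_vecAtoms_series (hE : ∀ X, X ∈ Set.range ev ↔ ∀ a, X ∘L R a = L a ∘L X)
    {f : E →L[ℂ] ℂ} (hf : f ∈ vecPredual ev) :
    ∃ (w : ℕ → ℝ) (Y : ℕ → E) (h k : ℕ → H), (∀ n, 0 ≤ w n) ∧ Summable w ∧
      (∀ n, ‖ev (Y n)‖ ≤ 1) ∧ (∀ n, ‖h n‖ ≤ 1) ∧ (∀ n, ‖k n‖ ≤ 1) ∧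
      ∀ X, HasSum (fun n => (w n : ℂ) * ⟪ev (Y n) (h n), ev X (k n)⟫_ℂ) (f X) := by
  obtain ⟨w, a, hw, hws, ha, hsum⟩ := exists_hasSum_of_subset_closure_convexHull
    ((vecPredual ev).restrictScalars ℝ) (A := vecAtoms ev)
    (by rintro _ ⟨Y, h, k, -, -, -, rfl⟩; exact vecFunctional_mem ev _ _)
    (fun f hf hf1 => mem_closure_convexHull_vecAtoms hE hf hf1) (by
      rintro _ ⟨Y, h, k, hY, hh, hk, rfl⟩
      refine (norm_vecFunctional_apply_le ev _ _).trans ?_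
      have h1 : ‖ev Y h‖ ≤ 1 := ((ev Y).le_opNorm h).trans (mul_le_one₀ hY (norm_nonneg _) hh)
      exact mul_le_one₀ h1 (norm_nonneg _) hk) hf
  have ha' : ∀ n, ∃ (Y : E) (h k : H), ‖ev Y‖ ≤ 1 ∧ ‖h‖ ≤ 1 ∧ ‖k‖ ≤ 1 ∧
      a n = vecFunctional ev (ev Y h) k := by
    intro n
    rcases ha n with h0 | h0
    · exact ⟨0, 0, 0, by simp, by simp, by simp, by rw [h0, map_zero]⟩
    · exact h0
  choose Y h k hY hh hk hak using ha'
  refine ⟨w, Y, h, k, hw, hws, hY, hh, hk, fun X => ?_⟩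
  have := hsum.map (ContinuousLinearMap.apply ℂ ℂ X) (ContinuousLinearMap.continuous _)
  convert this using 2 with n
  · simp only [Function.comp_apply, hak]
    rfl
  · rfl

end VectorFunctional

/-! ### Norms of operator matrices. -/

section Matrix

variable {H : Type u} [NormedAddCommGroup H] [InnerProductSpace ℂ H] [CompleteSpace H]
  {K : Type v} [NormedAddCommGroup K] [InnerProductSpace ℂ K] [CompleteSpace K]

theorem matrixOp_apply {n : ℕ} {G : Type u} {G' : Type v} [NormedAddCommGroup G]
    [InnerProductSpace ℂ G] [NormedAddCommGroup G'] [InnerProductSpace ℂ G']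
    (a : Fin n → Fin n → (G →L[ℂ] G')) (g : PiLp 2 fun _ : Fin n => G) (i : Fin n) :
    matrixOp a g i = ∑ j, a i j (g j) := by
  change (∑ j, a i j ∘L PiLp.proj 2 (fun _ : Fin n => G) j) g = _
  rw [sum_apply]
  rfl

/-- Applying the contraction `V` in each row cannot increase norms, and `‖[X] g‖² = ⟨g, [X]^* [X]
g⟩`. -/
theorem norm_matrixOp_comp_sq_le {n : ℕ} (V : K →L[ℂ] H) (hV : ‖V‖ ≤ 1)
    (X : Fin n → Fin n → (H →L[ℂ] K)) :
    ‖matrixOp fun i j => V ∘L X i j‖ ^ 2 ≤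
      ‖matrixOp fun i j => ∑ k, (X k i).adjoint ∘L X k j‖ := by
  set B := matrixOp fun i j => ∑ k, (X k i).adjoint ∘L X k j with hB
  suffices h : ‖matrixOp fun i j => V ∘L X i j‖ ≤ √‖B‖ by
    calc _ ≤ √‖B‖ ^ 2 := by gcongr
      _ = _ := Real.sq_sqrt (norm_nonneg _)
  refine ContinuousLinearMap.opNorm_le_bound _ (Real.sqrt_nonneg _) fun g => ?_
  refine le_of_sq_le_sq ?_ (by positivity)
  rw [mul_pow, Real.sq_sqrt (norm_nonneg _)]
  have h1 : ∀ i, ‖(matrixOp fun i j => V ∘L X i j) g i‖ ^ 2 ≤ ‖∑ j, X i j (g j)‖ ^ 2 := by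
    intro i
    have : (matrixOp fun i j => V ∘L X i j) g i = V (∑ j, X i j (g j)) := by
      rw [matrixOp_apply, map_sum]
      rfl
    rw [this]
    gcongr
    exact (V.le_opNorm _).trans (mul_le_of_le_one_left (norm_nonneg _) hV)
  have h2 : ∑ i, ‖∑ j, X i j (g j)‖ ^ 2 = (⟪g, B g⟫_ℂ).re := by
    rw [PiLp.inner_apply]
    have e : ∀ j, ⟪g j, B g j⟫_ℂ = ∑ k, ⟪X k j (g j), ∑ l, X k l (g l)⟫_ℂ := by
      intro j
      rw [hB, matrixOp_apply]
      simp only [sum_apply, inner_sum, ContinuousLinearMap.comp_apply,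
        ContinuousLinearMap.adjoint_inner_right]
      exact Finset.sum_comm
    simp only [e]
    rw [Finset.sum_comm, Complex.re_sum]
    refine Finset.sum_congr rfl fun k _ => ?_
    rw [← sum_inner, ← inner_self_eq_norm_sq (𝕜 := ℂ)]
    rfl
  rw [PiLp.norm_sq_eq_of_L2]
  calc _ ≤ ∑ i, ‖∑ j, X i j (g j)‖ ^ 2 := Finset.sum_le_sum fun i _ => h1 i
    _ = (⟪g, B g⟫_ℂ).re := h2
    _ ≤ ‖⟪g, B g⟫_ℂ‖ := Complex.re_le_norm _
    _ ≤ ‖g‖ * ‖B g‖ := norm_inner_le_norm _ _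
    _ ≤ ‖g‖ * (‖B‖ * ‖g‖) := by gcongr; exact B.le_opNorm g
    _ = _ := by ring

end Matrix

/-! ### Vector functionals on a von Neumann algebra. -/

section VectorFunctionals

variable {H : Type u} [NormedAddCommGroup H] [InnerProductSpace ℂ H] [CompleteSpace H]

/-- The functional `b ↦ ⟨h, b k⟩` on a von Neumann algebra. -/
def coeffFunctional (N : VonNeumannAlgebra H) (h k : H) : N →L[ℂ] ℂ :=
  LinearMap.mkContinuous
    { toFun := fun b => ⟪h, (b : H →L[ℂ] H) k⟫_ℂ
      map_add' := fun _ _ => inner_add_right _ _ _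
      map_smul' := fun _ _ => inner_smul_right _ _ _ } (‖h‖ * ‖k‖) fun b => by
    refine (norm_inner_le_norm h ((b : H →L[ℂ] H) k)).trans ?_
    rw [mul_assoc, mul_comm ‖k‖]
    gcongr
    exact (b : H →L[ℂ] H).le_opNorm k

theorem norm_coeffFunctional_le (N : VonNeumannAlgebra H) (h k : H) :
    ‖coeffFunctional N h k‖ ≤ ‖h‖ * ‖k‖ :=
  LinearMap.mkContinuous_norm_le _ (by positivity) _

theorem isNormalFunctional_coeffFunctional (N : VonNeumannAlgebra H) (h k : H) :
    IsNormalFunctional N (coeffFunctional N h k) :=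
  IsNormalVector.continuous_inner (π := coeRep N) (isStarRep_coeRep N)
    ⟨Seq.single 0 k, fun b => by rw [ampl_single, norm_single]; rfl⟩ h

end VectorFunctionals

/-! ### Continuity, complete contractivity and covariance of the identity representation. -/

namespace CPSemigroup

variable {H : Type u} [NormedAddCommGroup H] [InnerProductSpace ℂ H] [CompleteSpace H]
  {M : VonNeumannAlgebra H} (P : CPSemigroup M)

/-- The space `E(t)` with the operator norm. -/
def NormedE (t : ℝ≥0) : Type u := P.E t

instance (t : ℝ≥0) : AddCommGroup (P.NormedE t) := inferInstanceAs (AddCommGroup (P.E t))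

instance (t : ℝ≥0) : Module ℂ (P.NormedE t) := inferInstanceAs (Module ℂ (P.E t))

instance (t : ℝ≥0) : NormedAddCommGroup (P.NormedE t) :=
  NormedAddCommGroup.induced (P.NormedE t) (H →L[ℂ] P.Ht t) (P.E t).subtype Subtype.val_injective

instance (t : ℝ≥0) : NormedSpace ℂ (P.NormedE t) :=
  NormedSpace.induced ℂ (P.NormedE t) (H →L[ℂ] P.Ht t) (P.E t).subtype

/-- The inclusion of `E(t)` into the bounded operators. -/
def inclE (t : ℝ≥0) : P.NormedE t →ₗᵢ[ℂ] (H →L[ℂ] P.Ht t) where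
  toLinearMap := (P.E t).subtype
  norm_map' _ := rfl

/-- Since `⟨Y h, X k⟩ = ⟨h, ⟨Y, X⟩ k⟩`, the series of atoms is literally one of the functionals
defining the σ-topology, with `η_n = Y_n` and `w_n` a weighted vector functional on `M'`. -/
theorem continuous_vecPredual {t : ℝ≥0} (f : P.NormedE t →L[ℂ] ℂ)
    (hf : f ∈ vecPredual (P.inclE t)) :
    @Continuous (P.E t) ℂ (CorrespondenceData.sigmaTopology (E := P.E t) (P.productSystem.corr t))
      inferInstance f := by
  obtain ⟨w, Y, h, k, hw, hws, hY, hh, hk, hsum⟩ := exists_vecAtoms_series (N := M)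
    (R := fun a => (a : H →L[ℂ] H)) (L := P.leftAct t)
    (fun X => ⟨by rintro ⟨X, rfl⟩; exact X.2, fun hX => ⟨⟨X, hX⟩, rfl⟩⟩) hf
  have key : (f : P.E t → ℂ) = fun X : P.E t => ∑' n,
      ((w n : ℂ) • coeffFunctional M.commutant (h n) (k n)) (P.ip (Y n) X) := by
    ext X
    rw [← (hsum X).tsum_eq]
    refine tsum_congr fun n => ?_
    exact congrArg ((w n : ℂ) * ·) (P.inner_E_apply (Y n) X (h n) (k n))
  rw [key]
  refine continuous_iInf_dom (i := ⟨(Y, fun n => (w n : ℂ) • coeffFunctional M.commutant (h n) (k n)),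
    fun n => ?_, ?_⟩) continuous_induced_dom
  · let _ := sigmaWeakOn M.commutant
    exact (isNormalFunctional_coeffFunctional M.commutant (h n) (k n)).const_smul (w n : ℂ)
  · refine Summable.of_nonneg_of_le (fun n => mul_nonneg (norm_nonneg _) (Real.sqrt_nonneg _))
      (fun n => ?_) hws
    have h1 : (P.productSystem.corr t).norm (Y n) ≤ 1 := (P.corr_norm (Y n)).trans_le (hY n)
    have h2 : ‖(w n : ℂ) • coeffFunctional M.commutant (h n) (k n)‖ ≤ w n := by
      rw [norm_smul, Complex.norm_real, Real.norm_of_nonneg (hw n)]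
      exact mul_le_of_le_one_right (hw n) ((norm_coeffFunctional_le _ _ _).trans
        (mul_le_one₀ (hh n) (norm_nonneg _) (hk n)))
    exact (mul_le_mul h2 h1 (Real.sqrt_nonneg _) (hw n)).trans_eq (mul_one _)

/-- A σ-weak functional of `ι_t^* X` is `∑ ⟨ι_t h_n, X k_n⟩`, a norm-convergent series of vector
functionals and so an element of `vecPredual`. The passage through the predual is needed because
`ι_t` need not lie in `E(t)`. -/
theorem continuous_identityRep (t : ℝ≥0) :
    @Continuous (P.E t) _
      (CorrespondenceData.sigmaTopology (E := P.E t) (P.productSystem.corr t)) (sigmaWeak H)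
      (P.identityRep t) := by
  refine continuous_iInf_rng.2 ?_
  rintro ⟨⟨h, k⟩, hh, hk⟩
  refine continuous_induced_rng.2 ?_
  have hs : Summable fun n => vecFunctional (P.inclE t) (P.iota t (h n)) (k n) := by
    refine Summable.of_norm_bounded ((hh.add hk).mul_left 1) fun n => ?_
    refine (norm_vecFunctional_apply_le _ _ _).trans ?_
    have h1 : ‖P.iota t (h n)‖ ≤ ‖h n‖ := ((P.iota t).le_opNorm _).trans
      (mul_le_of_le_one_left (norm_nonneg _) (P.norm_iota_le t))
    have h2 : ‖P.iota t (h n)‖ * ‖k n‖ ≤ ‖h n‖ * ‖k n‖ := by gcongr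
    nlinarith [sq_nonneg (‖h n‖ - ‖k n‖), sq_nonneg ‖h n‖, sq_nonneg ‖k n‖]
  have hmem : ∑' n, vecFunctional (P.inclE t) (P.iota t (h n)) (k n) ∈
      vecPredual (P.inclE t) :=
    (isClosed_vecPredual _).mem_of_tendsto hs.hasSum
      (Filter.Eventually.of_forall fun s => Submodule.sum_mem _ fun n _ => vecFunctional_mem _ _ _)
  have e : (fun X : P.E t => ∑' n, ⟪h n, P.identityRep t X (k n)⟫_ℂ) =
      ⇑(∑' n, vecFunctional (P.inclE t) (P.iota t (h n)) (k n)) := by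
    ext X
    have h3 := (hs.hasSum.map (ContinuousLinearMap.apply ℂ ℂ (show P.NormedE t from X))
      (ContinuousLinearMap.continuous _)).tsum_eq
    refine Eq.trans (tsum_congr fun n => ?_) h3
    exact (P.iota t).adjoint_inner_right _ _
  exact (congrArg (@Continuous (P.E t) ℂ
    (CorrespondenceData.sigmaTopology (E := P.E t) (P.productSystem.corr t)) inferInstance) e).mpr
    (P.continuous_vecPredual _ hmem)

theorem identityRep_unit (a : M.commutant) :
    P.identityRep 0 (P.productSystem.unit a) = (a : H →L[ℂ] H) := by
  change (P.iota 0).adjoint ∘L P.iota 0 ∘L (a : H →L[ℂ] H) = a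
  rw [← ContinuousLinearMap.comp_assoc, adjoint_iota_comp_iota]
  rfl

theorem norm_matrixOp_identityRep_sq_le {t : ℝ≥0} (n : ℕ) (X : Fin n → Fin n → P.E t) :
    ‖matrixOp fun i j => P.identityRep t (X i j)‖ ^ 2 ≤
      ‖matrixOp fun i j => ((∑ k, P.ip (X k i) (X k j) : M.commutant) : H →L[ℂ] H)‖ := by
  have hV : ‖(P.iota t).adjoint‖ ≤ 1 := by
    rw [LinearIsometryEquiv.norm_map]
    exact P.norm_iota_le t
  refine (norm_matrixOp_comp_sq_le (P.iota t).adjoint hV fun i j => (X i j).1).trans_eq ?_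
  congr 2
  ext1 i
  ext1 j
  exact (map_sum (coeRep M.commutant) (fun k => P.ip (X k i) (X k j)) _).symm

theorem isCovariantRepresentation :
    IsCovariantRepresentation P.productSystem P.identityRep where
  completelyContractive _ := P.norm_matrixOp_identityRep_sq_le
  continuous t := P.continuous_identityRep t
  zero_one := P.identityRep_unit 1
  zero_mul a b := by rw [identityRep_unit, identityRep_unit, identityRep_unit]; rfl
  zero_star a := by rw [identityRep_unit, identityRep_unit]; rfl
  zero_normal := by
    simp only [identityRep_unit]
    exact isNormalInto_coe M.commutant
  map_mul t s X Y := by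
    change (P.iota (t + s)).adjoint ∘L P.idTensOp s (show P.E t from X) ∘L (show P.E s from Y).1 =
      ((P.iota t).adjoint ∘L (show P.E t from X).1) ∘L (P.iota s).adjoint ∘L (show P.E s from Y).1
    rw [← ContinuousLinearMap.comp_assoc, adjoint_iota_comp_idTensOp]
    rfl
  map_left t a X := by
    rw [identityRep_unit]
    change (P.iota t).adjoint ∘L P.commutantAct t a ∘L (show P.E t from X).1 =
      (a : H →L[ℂ] H) ∘L (P.iota t).adjoint ∘L (show P.E t from X).1
    rw [← ContinuousLinearMap.comp_assoc, adjoint_iota_commutantAct]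
    rfl
  map_right t X a := by
    rw [identityRep_unit]
    rfl

end CPSemigroup

end QMarkov

end

theorem theorem2p8 {H : Type u} [NormedAddCommGroup H] [InnerProductSpace ℂ H] [CompleteSpace H]
    (M : VonNeumannAlgebra H) (P : QMarkov.CPSemigroup M) :
    QMarkov.IsDiscreteProductSystem P.productSystem ∧
    QMarkov.IsCovariantRepresentation P.productSystem P.identityRep ∧
    (∀ a : M.commutant, P.identityRep 0 (P.productSystem.unit a) = a) ∧
    (∀ t, P.Ttilde t ∘L (P.Ttilde t).adjoint = 1) ∧
    ∀ (t : ℝ≥0) (S : M), ((P.toFun t S : M) : H →L[ℂ] H) =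
      P.Ttilde t ∘L P.idTens t S ∘L (P.Ttilde t).adjoint :=
  ⟨P.isDiscreteProductSystem, P.isCovariantRepresentation, P.identityRep_unit,
    fun _ => P.Ttilde_comp_adjoint, fun _ S => (P.Ttilde_comp_idTens_comp_adjoint S).symm⟩
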